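/- Let an instance consist of a finite simple graph $G=(V,E)$ with non-negative rational edge costs $c_e$, a finite set $\mathcal{D}$ of pairs of vertices (the demands) such that the two vertices of every pair are connected in $G$, and a rational number $\epsilon>0$. For a set $\mathcal{D}'\subseteq\mathcal{D}$ let $\mathrm{OPT}_{\mathcal{D}'}$ be the minimum of $\sum_{e\in F}c_e$ over all forests $F\subseteq E$ such that the two vertices of every pair in $\mathcal{D}'$ are connected in $F$. There is an algorithm that, given any such instance, computes in time polynomial in the bit size of the instance (the running time being the bit cost on a random access machine, and $\epsilon$ being part of the input) trees $T_1,\dots,T_k$ that are subgraphs of $G$ and a partition of $\mathcal{D}$ into non-empty sets $\mathcal{D}_1,\dots,\mathcal{D}_k$ with the following properties. \begin{enumerate} \item $\mathcal{D}=\bigcup_{i=1}^k\mathcal{D}_i$, and the sets $\mathcal{D}_i$ are pairwise disjoint. \item For every $i$, both vertices of every pair in $\mathcal{D}_i$ are vertices of $T_i$. \item $\sum_{i=1}^k\sum_{e\in E(T_i)}c_e\le\left(\frac{4}{\epsilon}+2\right)\mathrm{OPT}_{\mathcal{D}}$. \item $\sum_{i=1}^k\mathrm{OPT}_{\mathcal{D}_i}\le(1+\epsilon)\,\mathrm{OPT}_{\mathcal{D}}$.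 \end{enumerate} -/

import Mathlib

/-! ### A random access machine with logarithmic cost

Programs are structured (`while`) programs over natural-number registers and unbounded
natural-number arrays with computed (indirect) addresses. Every evaluation of a subexpression
costs one plus the bit length of its value, so that a polynomial bound on the cost is a polynomial
bound in the bit model of computation. -/

namespace RAM

/-- The arithmetic operations; `sub` is truncated, `div` is the floor of the quotient,
and the two comparisons return `1` for true and `0` for false. -/
inductive Op where
  | add
  | sub
  | mul
  | div
  | lt
  | eq

def Op.apply : Op → ℕ → ℕ → ℕ
  | Op.add, a, b => a + b
  | Op.sub, a, b => a - b
  | Op.mul, a, b => a * b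
  | Op.div, a, b => a / b
  | Op.lt, a, b => if a < b then 1 else 0
  | Op.eq, a, b => if a = b then 1 else 0

/-- Expressions: constants, registers, array cells `a[i]`, binary operations. -/
inductive Term where
  | lit (k : ℕ)
  | reg (x : ℕ)
  | cell (a : ℕ) (i : Term)
  | op (o : Op) (s t : Term)

/-- The contents of the registers and of the arrays. -/
structure Store where
  reg : ℕ → ℕ
  arr : ℕ → ℕ → ℕ

def Term.value (σ : Store) : Term → ℕ
  | Term.lit k => k
  | Term.reg x => σ.reg x
  | Term.cell a i => σ.arr a (i.value σ)
  | Term.op o s t => o.apply (s.value σ) (t.value σ)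

/-- The logarithmic cost of evaluating an expression (`Nat.size` is the bit length). -/
def Term.cost (σ : Store) : Term → ℕ
  | Term.lit k => 1 + Nat.size k
  | Term.reg x => 1 + Nat.size (σ.reg x)
  | Term.cell a i => i.cost σ + (1 + Nat.size (σ.arr a (i.value σ)))
  | Term.op o s t => s.cost σ + t.cost σ + (1 + Nat.size (o.apply (s.value σ) (t.value σ)))

/-- Programs. -/
inductive Prog where
  | skip
  /-- `x := e` -/
  | assign (x : ℕ) (e : Term)
  /-- `a[i] := e` -/
  | store (a : ℕ) (i e : Term)
  | seq (p q : Prog)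
  /-- if `e ≠ 0` then `p` else `q` -/
  | ite (e : Term) (p q : Prog)
  /-- while `e ≠ 0` do `p` -/
  | loop (e : Term) (p : Prog)

def Store.setReg (σ : Store) (x v : ℕ) : Store :=
  { σ with reg := Function.update σ.reg x v }

def Store.setCell (σ : Store) (a i v : ℕ) : Store :=
  { σ with arr := Function.update σ.arr a (Function.update (σ.arr a) i v) }

/-- `Exec p σ τ c`: started in `σ`, the program `p` halts in `τ` and its total cost is `c`. -/
inductive Exec : Prog → Store → Store → ℕ → Prop where
  | skip (σ : Store) : Exec Prog.skip σ σ 1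
  | assign (σ : Store) (x : ℕ) (e : Term) :
      Exec (Prog.assign x e) σ (σ.setReg x (e.value σ)) (1 + e.cost σ)
  | store (σ : Store) (a : ℕ) (i e : Term) :
      Exec (Prog.store a i e) σ (σ.setCell a (i.value σ) (e.value σ)) (1 + i.cost σ + e.cost σ)
  | seq {p q : Prog} {σ τ υ : Store} {c d : ℕ} :
      Exec p σ τ c → Exec q τ υ d → Exec (Prog.seq p q) σ υ (c + d)
  | ite_true {e : Term} {p q : Prog} {σ τ : Store} {c : ℕ} :
      e.value σ ≠ 0 → Exec p σ τ c → Exec (Prog.ite e p q) σ τ (1 + e.cost σ + c)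
  | ite_false {e : Term} {p q : Prog} {σ τ : Store} {c : ℕ} :
      e.value σ = 0 → Exec q σ τ c → Exec (Prog.ite e p q) σ τ (1 + e.cost σ + c)
  | loop_true {e : Term} {p : Prog} {σ τ υ : Store} {c d : ℕ} :
      e.value σ ≠ 0 → Exec p σ τ c → Exec (Prog.loop e p) τ υ d →
        Exec (Prog.loop e p) σ υ (1 + e.cost σ + c + d)
  | loop_false {e : Term} {p : Prog} {σ : Store} :
      e.value σ = 0 → Exec (Prog.loop e p) σ σ (1 + e.cost σ)

/-- The initial store on a given input: its length is in register `0`, its entries are in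
array `0`, everything else is zero. -/
def initial (l : List ℕ) : Store where
  reg x := if x = 0 then l.length else 0
  arr a i := if a = 0 then l.getD i 0 else 0

/-- The output of a halted program, read off from register `0` and array `0` likewise. -/
def Store.output (σ : Store) : List ℕ :=
  (List.range (σ.reg 0)).map (σ.arr 0)

/-- The size, in bits, of a list of natural numbers (one extra bit for each separator). -/
def bitSize (l : List ℕ) : ℕ :=
  (l.map fun a => Nat.size a + 1).sum

/-- On the input `l` the program `p` halts with the output `m`, within time `t`
(reading out the output is charged too). -/
def Computes (p : Prog) (l m : List ℕ) (t : ℕ) : Prop :=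
  ∃ (τ : Store) (c : ℕ), Exec p (initial l) τ c ∧ τ.output = m ∧ c + bitSize m ≤ t

end RAM

/-! ### Steiner forests -/

/-- A finite graph with non-negative rational edge costs (the values of `cost` off the edges of
the graph are never used) and a set of demands, that is, of pairs of vertices. -/
structure SteinerInstance where
  n : ℕ
  graph : SimpleGraph (Fin n)
  cost : Sym2 (Fin n) → ℚ≥0
  demands : Finset (Fin n × Fin n)

namespace SteinerInstance

/-- Every demand can be connected in the graph, that is, some Steiner forest exists. -/
def Feasible (I : SteinerInstance) : Prop :=
  ∀ d ∈ I.demands, I.graph.Reachable d.1 d.2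

open scoped Classical in
/-- The total cost of a set of edges. -/
noncomputable def length (I : SteinerInstance) (E : Set (Sym2 (Fin I.n))) : ℚ≥0 :=
  ∑ e with e ∈ E, I.cost e

/-- `F` is a forest in the graph that connects every pair in `D`. -/
def IsSteinerForest (I : SteinerInstance) (D : Finset (Fin I.n × Fin I.n))
    (F : SimpleGraph (Fin I.n)) : Prop :=
  F ≤ I.graph ∧ F.IsAcyclic ∧ ∀ d ∈ D, F.Reachable d.1 d.2

/-- The minimum cost of a Steiner forest for the demand set `D`. -/
noncomputable def opt (I : SteinerInstance) (D : Finset (Fin I.n × Fin I.n)) : ℝ :=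
  sInf {x : ℝ | ∃ F, I.IsSteinerForest D F ∧ x = I.length F.edgeSet}

/-- If the demands in `D` can be connected at all, the infimum defining `opt` is a minimum. -/
theorem opt_isLeast (I : SteinerInstance) (D : Finset (Fin I.n × Fin I.n))
    (h : ∀ d ∈ D, I.graph.Reachable d.1 d.2) :
    IsLeast {x : ℝ | ∃ F, I.IsSteinerForest D F ∧ x = I.length F.edgeSet} (I.opt D) := by
  have hfin : {x : ℝ | ∃ F, I.IsSteinerForest D F ∧ x = I.length F.edgeSet}.Finite := by
    refine (Set.finite_range fun F : SimpleGraph (Fin I.n) =>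
      ((I.length F.edgeSet : ℚ≥0) : ℝ)).subset ?_
    rintro x ⟨F, -, rfl⟩
    exact ⟨F, rfl⟩
  have hne : {x : ℝ | ∃ F, I.IsSteinerForest D F ∧ x = I.length F.edgeSet}.Nonempty := by
    obtain ⟨F, hF, hac, hr⟩ := I.graph.exists_isAcyclic_reachable_eq_le
    refine ⟨_, F, ⟨hF, hac, fun d hd => ?_⟩, rfl⟩
    rw [hr]
    exact h d hd
  exact ⟨hne.csInf_mem hfin, fun x hx => csInf_le hfin.bddBelow hx⟩

open scoped Classical in
/-- The encoding of an instance together with the parameter `ε`: the number `n` of vertices,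
numerator and denominator of `ε`, the adjacency matrix, the matrices of the numerators and of the
denominators of the edge costs, and the 0-1 matrix of the demands. -/
noncomputable def encode (I : SteinerInstance) (ε : ℚ≥0) : List ℕ :=
  [I.n, ε.num, ε.den] ++
    (List.ofFn fun p : Fin (I.n * I.n) =>
      if I.graph.Adj p.divNat p.modNat then 1 else 0) ++
    (List.ofFn fun p : Fin (I.n * I.n) =>
      if I.graph.Adj p.divNat p.modNat then (I.cost s(p.divNat, p.modNat)).num else 0) ++
    (List.ofFn fun p : Fin (I.n * I.n) =>
      if I.graph.Adj p.divNat p.modNat then (I.cost s(p.divNat, p.modNat)).den else 0) ++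
    (List.ofFn fun p : Fin (I.n * I.n) =>
      if (p.divNat, p.modNat) ∈ I.demands then 1 else 0)

/-- Subgraphs `T 0, …, T (k - 1)` of the graph and sets of demands `part 0, …, part (k - 1)`. -/
structure Clustering (I : SteinerInstance) where
  k : ℕ
  T : Fin k → I.graph.Subgraph
  part : Fin k → Finset (Fin I.n × Fin I.n)

open scoped Classical in
/-- The encoding of the output: the number `k`, followed, for each `i < k`, by the 0-1 vector of
the vertices of `T i`, the adjacency matrix of `T i`, and the 0-1 matrix of `part i`. -/
noncomputable def Clustering.encode {I : SteinerInstance} (C : I.Clustering) : List ℕ :=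
  C.k :: (List.ofFn fun i : Fin C.k =>
    (List.ofFn fun v : Fin I.n => if v ∈ (C.T i).verts then 1 else 0) ++
    (List.ofFn fun p : Fin (I.n * I.n) => if (C.T i).Adj p.divNat p.modNat then 1 else 0) ++
    (List.ofFn fun p : Fin (I.n * I.n) =>
      if (p.divNat, p.modNat) ∈ C.part i then 1 else 0)).flatten

end SteinerInstance

/-!
The algorithm grows moats twice.

The first growth has no potentials: as long as a moat separates a demand, it grows, an edge between
two moats is bought as soon as it is tight, and at the end every superfluous edge is deleted. This
is the primal-dual algorithm for the Steiner forest problem. It yields a forest `H₁` that connects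
all demands and has length at most `2 * OPT` (`Moat.Stage.steiner`). The second growth starts with
the components of `H₁` as moats, each with a potential of `1 / ε` times its length; a moat now grows
until its potential is used up, and moats that merge pool what is left. After deletion of the edges
that are not needed to connect vertices which no inactive moat ever separated, this yields the
forest `H₂`, whose components are the trees of the clustering (`Moat.Stage.cluster`).

Both bounds on the length rest on one counting argument. At any time the remaining edges of the
pruned forest form a forest on the moats in which no inactive moat is a leaf (`Moat.two_le_degree`),
so the active moats have average degree at most two (`Moat.Run.card_active_le`), and the forest
costs at most twice the total growth (`Moat.Run.crossSlack_le`). In the first growth every active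
moat is left by some edge of the optimum, so that the total growth is at most `OPT`. In the second
growth it is the sum of the potentials, so `H₂` exceeds `H₁` by at most `2 / ε` times the length of
`H₁`; altogether its length is at most `(1 + 2 / ε) * 2 * OPT`.

For the price of the clustering let `L` be an optimal forest. Call a vertex exhausted if `L` leaves
its moat for as long as this moat is active. Two vertices in one component of `L` end in the same
cluster unless one of them is exhausted (`Moat.exhausted_or_exhausted`). When a moat containing an
exhausted vertex grows, it grows over `L`; hence, if each potential is distributed over the vertices
of its component according to the edges at them, the shares of the exhausted vertices add up to at
most the length of `L` (`Moat.sum_exhausted_le`). All vertices of a component of `H₁` are always in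
the same moat, so these shares are `1 / ε` times the length of the exhausted components, which is
therefore at most `ε * OPT` in total. The demands of a cluster are served by the components of `L`
at its vertices that are not exhausted, each of which is used by one cluster only, and by the
exhausted components of `H₁`. This gives `(1 + ε) * OPT` (`SteinerInstance.cluster_of_stages`).

The arithmetic is integral. Costs are multiplied by a common denominator, and each step passes to
half the previous unit of length, because an edge between two active moats becomes tight after
growth by half its slack. All numbers at most double in each of the polynomially many steps.

The program is written in a language with bounded loops only, in which a value that could be large
is replaced by its minimum with a fixed number in register `4`. In this language the running time is
polynomial by construction (`RAM.Cmd.exists_exec`). With `X` the product of `a + 2` over the entries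
`a` of the input, register `4` contains `X ^ 8`: its bit length is linear in the size of the input,
and it is so large that the minimum never takes effect. So the program carries out the two stages
faithfully (`RAM.main_spec`), and what it writes is the encoding of a clustering with the required
properties (`SteinerInstance.clustering_spec`).
-/

/-! ### Bounded loop programs -/

namespace RAM

instance : Add Term := ⟨Term.op Op.add⟩
instance : Sub Term := ⟨Term.op Op.sub⟩
instance : Mul Term := ⟨Term.op Op.mul⟩
instance : Div Term := ⟨Term.op Op.div⟩
instance (k : ℕ) : OfNat Term k := ⟨Term.lit k⟩

/-- The 0-1 value of `s < t`. -/
def Term.lt (s t : Term) : Term := Term.op Op.lt s t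

/-- The 0-1 value of `s = t`. -/
def Term.eq (s t : Term) : Term := Term.op Op.eq s t

/-- The remainder of `s` modulo `t`. -/
def Term.mod (s t : Term) : Term := s - s / t * t

/-- The minimum of `e` and register `4`, written with truncated subtraction. -/
def Term.clamp (e : Term) : Term := e - (e - Term.reg 4)

namespace Term

variable (σ : Store) (s t : Term)

@[simp] theorem value_lit (k : ℕ) : (lit k).value σ = k := rfl
@[simp] theorem value_ofNat (k : ℕ) : (no_index (OfNat.ofNat k) : Term).value σ = OfNat.ofNat k :=
  rfl
@[simp] theorem value_reg (x : ℕ) : (reg x).value σ = σ.reg x := rfl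
@[simp] theorem value_cell (a : ℕ) (i : Term) : (cell a i).value σ = σ.arr a (i.value σ) := rfl
@[simp] theorem value_add : (s + t).value σ = s.value σ + t.value σ := rfl
@[simp] theorem value_sub : (s - t).value σ = s.value σ - t.value σ := rfl
@[simp] theorem value_mul : (s * t).value σ = s.value σ * t.value σ := rfl
@[simp] theorem value_div : (s / t).value σ = s.value σ / t.value σ := rfl
@[simp] theorem value_lt : (s.lt t).value σ = if s.value σ < t.value σ then 1 else 0 := rfl
@[simp] theorem value_eq : (s.eq t).value σ = if s.value σ = t.value σ then 1 else 0 := rfl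

/-- The remainder is computed as intended for the modulus `0` too, since `s / 0 = 0`. -/
@[simp] theorem value_mod : (s.mod t).value σ = s.value σ % t.value σ := by
  simp only [mod, value_sub, value_mul, value_div]
  have := Nat.div_add_mod' (s.value σ) (t.value σ)
  omega

@[simp] theorem value_clamp : s.clamp.value σ = min (s.value σ) (σ.reg 4) := by
  simp only [clamp, value_sub, value_reg]
  omega

/-- A syntactic guarantee that evaluation does not exceed a bound on the contents of the store. -/
def safe : Term → Bool
  | lit k => k ≤ 1
  | reg _ => true
  | cell _ _ => true
  | op Op.sub s _ => s.safe
  | op Op.div s _ => s.safe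
  | op Op.lt _ _ => true
  | op Op.eq _ _ => true
  | op _ _ _ => false

/-- The bit length of the value of a term is at most this many times that of the bound. -/
def width : Term → ℕ
  | lit k => k.size + 1
  | reg _ => 1
  | cell _ _ => 1
  | op _ s t => s.width + t.width

/-- The cost of a term is at most this many times the bit length of the bound. -/
def weight : Term → ℕ
  | lit k => 1 + k.size
  | reg _ => 1
  | cell _ i => i.weight + 1
  | op _ s t => s.weight + t.weight + (1 + (s.width + t.width))

end Term

/-- Every register and every array cell is at most `M`. -/
def Store.Bdd (M : ℕ) (σ : Store) : Prop :=
  (∀ x, σ.reg x ≤ M) ∧ ∀ a i, σ.arr a i ≤ M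

theorem Term.one_le_width : ∀ e : Term, 1 ≤ e.width
  | lit _ => by simp [width]
  | reg _ => le_rfl
  | cell _ _ => le_rfl
  | op _ s _ => (one_le_width s).trans (Nat.le_add_right _ _)

section Bounds

variable {M B : ℕ} {σ : Store}

theorem Op.size_apply_le (o : Op) (a b : ℕ) : (o.apply a b).size ≤ max 1 (max (a.size + b.size)
    (max a.size b.size + 1)) := by
  have ha := Nat.lt_size_self a
  have hb := Nat.lt_size_self b
  cases o with
  | add =>
    have h : (a + b).size ≤ max a.size b.size + 1 := by
      rw [Nat.size_le, pow_succ]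
      have h1 := Nat.pow_le_pow_right (n := 2) (by norm_num) (le_max_left a.size b.size)
      have h2 := Nat.pow_le_pow_right (n := 2) (by norm_num) (le_max_right a.size b.size)
      omega
    simp only [Op.apply]; omega
  | sub =>
    have := Nat.size_le_size (Nat.sub_le a b)
    simp only [Op.apply]; omega
  | mul =>
    have h : (a * b).size ≤ a.size + b.size := by
      rw [Nat.size_le, pow_add]
      exact Nat.mul_lt_mul'' ha hb
    simp only [Op.apply]; omega
  | div =>
    have := Nat.size_le_size (Nat.div_le_self a b)
    simp only [Op.apply]; omega
  | lt => simp only [Op.apply]; split_ifs <;> simp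
  | eq => simp only [Op.apply]; split_ifs <;> simp

theorem Term.size_value_le (hM : M < 2 ^ B) (h : σ.Bdd M) :
    ∀ e : Term, (e.value σ).size ≤ e.width * (B + 1)
  | lit k => by
    simp only [value_lit, width]
    nlinarith [Nat.zero_le (k.size * B)]
  | reg x => by
    simp only [value_reg, width, Nat.size_le, one_mul]
    exact ((h.1 x).trans_lt hM).trans_le (Nat.pow_le_pow_right (by norm_num) (Nat.le_succ B))
  | cell a i => by
    simp only [value_cell, width, Nat.size_le, one_mul]
    exact ((h.2 a _).trans_lt hM).trans_le (Nat.pow_le_pow_right (by norm_num) (Nat.le_succ B))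
  | op o s t => by
    have h1 := size_value_le hM h s
    have h2 := size_value_le hM h t
    have h3 := o.size_apply_le (s.value σ) (t.value σ)
    have h4 := one_le_width s
    have h5 := one_le_width t
    have h6 : B + 1 ≤ s.width * (B + 1) := Nat.le_mul_of_pos_left _ h4
    have h7 : B + 1 ≤ t.width * (B + 1) := Nat.le_mul_of_pos_left _ h5
    change (o.apply (s.value σ) (t.value σ)).size ≤ (s.width + t.width) * (B + 1)
    rw [add_mul]
    omega

theorem Term.cost_le (hM : M < 2 ^ B) (h : σ.Bdd M) :
    ∀ e : Term, e.cost σ ≤ e.weight * (B + 1)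
  | lit k => Nat.le_mul_of_pos_right _ B.succ_pos
  | reg x => by
    have : (σ.reg x).size ≤ B := Nat.size_le.2 ((h.1 x).trans_lt hM)
    simp only [cost, weight]; omega
  | cell a i => by
    have h1 := cost_le hM h i
    have : (σ.arr a (i.value σ)).size ≤ B := Nat.size_le.2 ((h.2 a _).trans_lt hM)
    simp only [cost, weight, add_mul]; omega
  | op o s t => by
    have h1 := cost_le hM h s
    have h2 := cost_le hM h t
    have h3 := size_value_le hM h (op o s t)
    simp only [width, value] at h3
    simp only [cost, weight, add_mul] at *
    omega

theorem Term.value_le_of_safe (h1 : 1 ≤ M) (h : σ.Bdd M) :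
    ∀ e : Term, e.safe → e.value σ ≤ M
  | lit k, he => by
    simp only [safe, decide_eq_true_eq] at he
    exact he.trans h1
  | reg x, _ => h.1 x
  | cell a i, _ => h.2 a _
  | op Op.sub s t, he => (Nat.sub_le _ _).trans (value_le_of_safe h1 h s he)
  | op Op.div s t, he => (Nat.div_le_self _ _).trans (value_le_of_safe h1 h s he)
  | op Op.lt s t, _ => by simp only [value, Op.apply]; split_ifs <;> omega
  | op Op.eq s t, _ => by simp only [value, Op.apply]; split_ifs <;> omega

theorem Store.Bdd.setReg (h : σ.Bdd M) {x v : ℕ} (hv : v ≤ M) : (σ.setReg x v).Bdd M := by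
  refine ⟨fun y => ?_, h.2⟩
  simp only [Store.setReg, Function.update_apply]
  split_ifs
  exacts [hv, h.1 y]

theorem Store.Bdd.setCell (h : σ.Bdd M) {a i v : ℕ} (hv : v ≤ M) : (σ.setCell a i v).Bdd M := by
  refine ⟨h.1, fun b j => ?_⟩
  simp only [Store.setCell, Function.update_apply]
  split_ifs with h1
  · rw [Function.update_apply]
    split_ifs
    exacts [hv, h.2 a j]
  · exact h.2 b j

end Bounds

/-- Programs in which every loop is a counting loop whose number of rounds is the content of a
register. The instructions `assignC` and `storeC` replace the value by its minimum with
register `4`. -/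
inductive Cmd where
  | skip
  | assign (x : ℕ) (e : Term)
  | assignC (x : ℕ) (e : Term)
  | store (a : ℕ) (i e : Term)
  | storeC (a : ℕ) (i e : Term)
  | seq (p q : Cmd)
  | branch (e : Term) (p q : Cmd)
  /-- for `x < reg b` do `p` -/
  | for (x b : ℕ) (p : Cmd)

/-- Sequential composition. -/
infixr:60 " ;; " => Cmd.seq

namespace Cmd

/-- Translation to programs of the machine. -/
def compile : Cmd → Prog
  | skip => Prog.skip
  | assign x e => Prog.assign x e
  | assignC x e => Prog.assign x e.clamp
  | store a i e => Prog.store a i e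
  | storeC a i e => Prog.store a i e.clamp
  | seq p q => Prog.seq p.compile q.compile
  | branch e p q => Prog.ite e p.compile q.compile
  | .for x b p => Prog.seq (Prog.assign x 0)
      (Prog.loop ((Term.reg x).lt (Term.reg b))
        (Prog.seq p.compile (Prog.assign x (Term.reg x + 1))))

/-- The store after the execution. -/
def den : Cmd → Store → Store
  | skip, σ => σ
  | assign x e, σ => σ.setReg x (e.value σ)
  | assignC x e, σ => σ.setReg x (min (e.value σ) (σ.reg 4))
  | store a i e, σ => σ.setCell a (i.value σ) (e.value σ)
  | storeC a i e, σ => σ.setCell a (i.value σ) (min (e.value σ) (σ.reg 4))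
  | seq p q, σ => q.den (p.den σ)
  | branch e p q, σ => if e.value σ = 0 then q.den σ else p.den σ
  | .for x b p, σ =>
      ((List.range (σ.reg b)).foldl (fun τ i => p.den (τ.setReg x i)) σ).setReg x (σ.reg b)

/-- The registers that a command may change. -/
def regs : Cmd → List ℕ
  | skip => []
  | assign x _ => [x]
  | assignC x _ => [x]
  | store _ _ _ => []
  | storeC _ _ _ => []
  | seq p q => p.regs ++ q.regs
  | branch _ p q => p.regs ++ q.regs
  | .for x _ p => x :: p.regs

/-- The arrays that a command may change. -/
def arrs : Cmd → List ℕ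
  | skip => []
  | assign _ _ => []
  | assignC _ _ => []
  | store a _ _ => [a]
  | storeC a _ _ => [a]
  | seq p q => p.arrs ++ q.arrs
  | branch _ p q => p.arrs ++ q.arrs
  | .for _ _ p => p.arrs

/-- Registers `1`, `2`, `3` (the loop bounds) and `4` (the bound on all numbers) are never written,
a loop does not change its own counter, and unclamped values cannot exceed earlier ones. -/
def wf : Cmd → Bool
  | skip => true
  | assign x e => (x = 0 || 5 ≤ x) && e.safe
  | assignC x _ => x = 0 || 5 ≤ x
  | store _ _ e => e.safe
  | storeC _ _ _ => true
  | seq p q => p.wf && q.wf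
  | branch _ p q => p.wf && q.wf
  | .for x b p => 5 ≤ x && (1 ≤ b && b ≤ 3) && !(p.regs.contains x) && p.wf

theorem den_seq (p q : Cmd) (σ : Store) : (p ;; q).den σ = q.den (p.den σ) := rfl

theorem den_reg : ∀ (c : Cmd) (σ : Store) {x : ℕ}, x ∉ c.regs → (c.den σ).reg x = σ.reg x
  | skip, _, _, _ => rfl
  | assign y e, σ, x, h => by
    simp only [regs, List.mem_singleton] at h
    simp [den, Store.setReg, h]
  | assignC y e, σ, x, h => by
    simp only [regs, List.mem_singleton] at h
    simp [den, Store.setReg, h]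
  | store a i e, _, _, _ => rfl
  | storeC a i e, _, _, _ => rfl
  | seq p q, σ, x, h => by
    simp only [regs, List.mem_append, not_or] at h
    simp only [den]
    rw [den_reg q _ h.2, den_reg p _ h.1]
  | branch e p q, σ, x, h => by
    simp only [regs, List.mem_append, not_or] at h
    simp only [den]
    split_ifs
    exacts [den_reg q _ h.2, den_reg p _ h.1]
  | .for y b p, σ, x, h => by
    simp only [regs, List.mem_cons, not_or] at h
    have key : ∀ l : List ℕ, (l.foldl (fun τ i => p.den (τ.setReg y i)) σ).reg x = σ.reg x := by
      intro l
      induction l using List.reverseRecOn with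
      | nil => rfl
      | append_singleton l i ih =>
        rw [List.foldl_append, List.foldl_cons, List.foldl_nil, den_reg p _ h.2]
        simpa [Store.setReg, h.1] using ih
    simpa [den, Store.setReg, h.1] using key _

theorem den_arr : ∀ (c : Cmd) (σ : Store) {a : ℕ}, a ∉ c.arrs → (c.den σ).arr a = σ.arr a
  | skip, _, _, _ => rfl
  | assign y e, σ, x, h => rfl
  | assignC y e, σ, x, h => rfl
  | store b i e, σ, a, h => by
    simp only [arrs, List.mem_singleton] at h
    simp [den, Store.setCell, h]
  | storeC b i e, σ, a, h => by
    simp only [arrs, List.mem_singleton] at h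
    simp [den, Store.setCell, h]
  | seq p q, σ, x, h => by
    simp only [arrs, List.mem_append, not_or] at h
    simp only [den]
    rw [den_arr q _ h.2, den_arr p _ h.1]
  | branch e p q, σ, x, h => by
    simp only [arrs, List.mem_append, not_or] at h
    simp only [den]
    split_ifs
    exacts [den_arr q _ h.2, den_arr p _ h.1]
  | .for y b p, σ, x, h => by
    simp only [arrs] at h
    have key : ∀ l : List ℕ, (l.foldl (fun τ i => p.den (τ.setReg y i)) σ).arr x = σ.arr x := by
      intro l
      induction l using List.reverseRecOn with
      | nil => rfl
      | append_singleton l i ih =>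
        rw [List.foldl_append, List.foldl_cons, List.foldl_nil, den_arr p _ h]
        exact ih
    exact key _

theorem notMem_regs_of_wf : ∀ {c : Cmd}, c.wf → ∀ {x : ℕ}, 1 ≤ x → x ≤ 4 → x ∉ c.regs
  | skip, _, _, _, _ => by simp [regs]
  | assign y e, h, x, h1, h2 => by simp [wf] at h; simp [regs]; omega
  | assignC y e, h, x, h1, h2 => by simp [wf] at h; simp [regs]; omega
  | store b i e, h, a, h1, h2 => by simp [regs]
  | storeC b i e, h, a, h1, h2 => by simp [regs]
  | seq p q, h, x, h1, h2 => by
    simp only [wf, Bool.and_eq_true] at h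
    simpa [regs] using ⟨notMem_regs_of_wf h.1 h1 h2, notMem_regs_of_wf h.2 h1 h2⟩
  | branch e p q, h, x, h1, h2 => by
    simp only [wf, Bool.and_eq_true] at h
    simpa [regs] using ⟨notMem_regs_of_wf h.1 h1 h2, notMem_regs_of_wf h.2 h1 h2⟩
  | .for y b p, h, x, h1, h2 => by
    simp only [wf, Bool.and_eq_true, decide_eq_true_eq] at h
    simpa [regs] using ⟨by omega, notMem_regs_of_wf h.2 h1 h2⟩

open Polynomial in
/-- The running time, up to the bit length of the numbers, as a polynomial in the loop bounds. -/
noncomputable def time : Cmd → ℕ[X]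
  | skip => 1
  | assign _ e => C (1 + e.weight)
  | assignC _ e => C (1 + e.clamp.weight)
  | store _ i e => C (1 + i.weight + e.weight)
  | storeC _ i e => C (1 + i.weight + e.clamp.weight)
  | seq p q => p.time + q.time
  | branch e p q => C (1 + e.weight) + p.time + q.time
  | .for x b p => C (3 + (Term.reg x).weight + ((Term.reg x).lt (Term.reg b)).weight) +
      X * (C (2 + ((Term.reg x).lt (Term.reg b)).weight + (Term.reg x + 1).weight) + p.time)

/-- The numbers stay below the bound by the clamping, and the number of rounds of a loop is known
when it is entered. So every well-formed program halts, within polynomial time: `s` bounds the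
loop bounds, and `B` the bit length of all numbers. -/
theorem exists_exec {M B s : ℕ} (hM : M < 2 ^ B) (h1 : 1 ≤ M) :
    ∀ (c : Cmd), c.wf → ∀ σ : Store, σ.Bdd M → (∀ b, 1 ≤ b → b ≤ 3 → σ.reg b ≤ s) →
      (c.den σ).Bdd M ∧ ∃ k ≤ c.time.eval s * (B + 1), Exec c.compile σ (c.den σ) k
  | skip, _, σ, hσ, _ => ⟨hσ, 1, by simp [time], Exec.skip σ⟩
  | assign x e, h, σ, hσ, _ => by
    simp only [wf, Bool.and_eq_true] at h
    refine ⟨hσ.setReg (e.value_le_of_safe h1 hσ h.2), _, ?_, Exec.assign σ x e⟩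
    have := e.cost_le hM hσ
    simp only [time, Polynomial.eval_C, add_mul]; omega
  | assignC x e, h, σ, hσ, _ => by
    refine ⟨hσ.setReg ((min_le_right _ _).trans (hσ.1 4)), 1 + e.clamp.cost σ, ?_, ?_⟩
    · have := e.clamp.cost_le hM hσ
      simp only [time, Polynomial.eval_C, add_mul]; omega
    · simpa [den, compile] using Exec.assign σ x e.clamp
  | store a i e, h, σ, hσ, _ => by
    refine ⟨hσ.setCell (e.value_le_of_safe h1 hσ h), _, ?_, Exec.store σ a i e⟩
    have := e.cost_le hM hσ
    have := i.cost_le hM hσ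
    simp only [time, Polynomial.eval_C, add_mul]; omega
  | storeC a i e, h, σ, hσ, _ => by
    refine ⟨hσ.setCell ((min_le_right _ _).trans (hσ.1 4)), 1 + i.cost σ + e.clamp.cost σ, ?_, ?_⟩
    · have := e.clamp.cost_le hM hσ
      have := i.cost_le hM hσ
      simp only [time, Polynomial.eval_C, add_mul]; omega
    · simpa [den, compile] using Exec.store σ a i e.clamp
  | seq p q, h, σ, hσ, hs => by
    simp only [wf, Bool.and_eq_true] at h
    obtain ⟨hp, k, hk, hpk⟩ := exists_exec hM h1 p h.1 σ hσ hs
    obtain ⟨hq, l, hl, hql⟩ := exists_exec hM h1 q h.2 _ hp fun b hb hb' => by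
      rw [den_reg p σ (notMem_regs_of_wf h.1 hb (by omega))]
      exact hs b hb hb'
    refine ⟨hq, k + l, ?_, Exec.seq hpk hql⟩
    simp only [time, Polynomial.eval_add, add_mul]; omega
  | branch e p q, h, σ, hσ, hs => by
    simp only [wf, Bool.and_eq_true] at h
    have he := e.cost_le hM hσ
    obtain ⟨hp, k, hk, hpk⟩ := exists_exec hM h1 p h.1 σ hσ hs
    obtain ⟨hq, l, hl, hql⟩ := exists_exec hM h1 q h.2 σ hσ hs
    by_cases h0 : e.value σ = 0
    · simp only [den, h0, if_true]
      refine ⟨hq, _, ?_, Exec.ite_false h0 hql⟩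
      simp only [time, Polynomial.eval_add, Polynomial.eval_C, add_mul]; omega
    · simp only [den, h0, if_false]
      refine ⟨hp, _, ?_, Exec.ite_true h0 hpk⟩
      simp only [time, Polynomial.eval_add, Polynomial.eval_C, add_mul]; omega
  | .for x b p, h, σ, hσ, hs => by
    simp only [wf, Bool.and_eq_true, decide_eq_true_eq, Bool.not_eq_true', List.contains_eq_mem,
      decide_eq_false_iff_not] at h
    obtain ⟨⟨⟨hx, hb, hb'⟩, hxp⟩, hp⟩ := h
    set N := σ.reg b with hN
    have hNs : N ≤ s := hs b hb hb'
    have hNM : N ≤ M := hσ.1 b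
    let st : ℕ → Store := fun i => (List.range i).foldl (fun τ i => p.den (τ.setReg x i)) σ
    have st_succ : ∀ i, st (i + 1) = p.den ((st i).setReg x i) := fun i => by
      simp [st, List.range_succ]
    have reg_st : ∀ i r, 1 ≤ r → r ≤ 4 → (st i).reg r = σ.reg r := by
      intro i r hr hr'
      induction i with
      | zero => rfl
      | succ i ih =>
        rw [st_succ, den_reg p _ (notMem_regs_of_wf hp hr hr')]
        simpa [Store.setReg, Function.update_apply, show r ≠ x by omega] using ih
    have hs' : ∀ i v r, 1 ≤ r → r ≤ 3 → ((st i).setReg x v).reg r ≤ s := by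
      intro i v r hr hr'
      have := reg_st i r hr (by omega)
      simp only [Store.setReg, Function.update_apply, show r ≠ x by omega, if_false, this]
      exact hs r hr hr'
    have bdd : ∀ i ≤ N, (st i).Bdd M := by
      intro i hi
      induction i with
      | zero => exact hσ
      | succ i ih =>
        rw [st_succ]
        exact (exists_exec hM h1 p hp _ ((ih (by omega)).setReg (by omega)) (hs' i i)).1
    set test := (Term.reg x).lt (Term.reg b) with htest
    set inc := Term.reg x + 1 with hinc
    have htv : ∀ i, test.value ((st i).setReg x i) = if i < N then 1 else 0 := by
      intro i
      have := reg_st i b hb (by omega)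
      simp [htest, Store.setReg, show b ≠ x by omega, this, hN]
    -- the time for the last `j` rounds
    have key : ∀ j i, i + j = N → ∃ k ≤ (1 + test.weight + j *
          (2 + test.weight + inc.weight + p.time.eval s)) * (B + 1),
        Exec (Prog.loop test (Prog.seq p.compile (Prog.assign x inc)))
          ((st i).setReg x i) ((st N).setReg x N) k := by
      intro j
      induction j with
      | zero =>
        intro i hi
        obtain rfl : i = N := by omega
        have hc := test.cost_le hM ((bdd N le_rfl).setReg (x := x) hNM)
        refine ⟨_, ?_, Exec.loop_false (by simp [htv])⟩
        simp only [zero_mul, add_zero, add_mul]; omega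
      | succ j ih =>
        intro i hi
        have hbi := (bdd i (by omega)).setReg (x := x) (v := i) (by omega)
        have hc := test.cost_le hM hbi
        obtain ⟨-, k, hk, hpk⟩ := exists_exec hM h1 p hp _ hbi (hs' i i)
        rw [← st_succ] at hpk
        have hc' := inc.cost_le hM (bdd (i + 1) (by omega))
        have hasg := Exec.assign (st (i + 1)) x inc
        have hv : inc.value (st (i + 1)) = i + 1 := by
          rw [st_succ]
          simp [hinc, den_reg p _ hxp, Store.setReg]
        rw [hv] at hasg
        obtain ⟨l, hl, hlk⟩ := ih (i + 1) (by omega)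
        refine ⟨_, ?_, Exec.loop_true (by simp [htv]; omega) (Exec.seq hpk hasg) hlk⟩
        simp only [add_mul, one_mul] at *
        omega
    obtain ⟨k, hk, hke⟩ := key N 0 (by omega)
    refine ⟨(bdd N le_rfl).setReg hNM, _, ?_, Exec.seq (Exec.assign σ x 0) hke⟩
    have h0 : (0 : Term).cost σ = 1 := rfl
    have hmul : N * (2 + test.weight + inc.weight + p.time.eval s) ≤
      s * (2 + test.weight + inc.weight + p.time.eval s) := Nat.mul_le_mul_right _ hNs
    have hmul := Nat.mul_le_mul_right (B + 1) hmul
    simp only [time, Polynomial.eval_add, Polynomial.eval_C, Polynomial.eval_mul,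
      Polynomial.eval_X, ← htest, ← hinc]
    have hr : (Term.reg x).weight = 1 := rfl
    rw [h0, hr]
    simp only [add_mul, one_mul] at *
    omega

/-! #### Reasoning about loops -/

/-- The rule for loops: `P i` holds after `i` rounds. The invariant need not mention what the body
leaves alone, and it must not depend on the counter, which is set anew in each round. -/
theorem for_rule {x b : ℕ} {p : Cmd} {σ : Store} (P : ℕ → Store → Prop)
    (hstab : ∀ i τ v, P i τ → P i (τ.setReg x v))
    (h0 : P 0 σ)
    (hs : ∀ i < σ.reg b, ∀ τ : Store, (∀ r, r ≠ x → r ∉ p.regs → τ.reg r = σ.reg r) →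
      (∀ a ∉ p.arrs, τ.arr a = σ.arr a) → τ.reg x = i → P i τ → P (i + 1) (p.den τ)) :
    P (σ.reg b) ((Cmd.for x b p).den σ) := by
  have key : ∀ n ≤ σ.reg b,
      (∀ r, r ≠ x → r ∉ p.regs →
        ((List.range n).foldl (fun τ i => p.den (τ.setReg x i)) σ).reg r = σ.reg r) ∧
      (∀ a ∉ p.arrs, ((List.range n).foldl (fun τ i => p.den (τ.setReg x i)) σ).arr a = σ.arr a) ∧
      P n ((List.range n).foldl (fun τ i => p.den (τ.setReg x i)) σ) := by
    intro n hn
    induction n with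
    | zero => exact ⟨fun _ _ _ => rfl, fun _ _ => rfl, h0⟩
    | succ n ih =>
      obtain ⟨h1, h2, h3⟩ := ih (by omega)
      simp only [List.range_succ, List.foldl_append, List.foldl_cons, List.foldl_nil]
      refine ⟨fun r hr hrp => ?_, fun a ha => ?_, hs n (by omega) _ ?_ h2 ?_ (hstab _ _ _ h3)⟩
      · rw [den_reg p _ hrp]
        simpa [Store.setReg, hr] using h1 r hr hrp
      · rw [den_arr p _ ha]
        exact h2 a ha
      · intro r hr hrp
        simpa [Store.setReg, hr] using h1 r hr hrp
      · simp [Store.setReg]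
  exact hstab _ _ _ (key _ le_rfl).2.2

end Cmd

@[simp] theorem Store.setReg_reg (σ : Store) (x v y : ℕ) :
    (σ.setReg x v).reg y = if y = x then v else σ.reg y := by
  simp [Store.setReg, Function.update_apply]

@[simp] theorem Store.setReg_arr (σ : Store) (x v a : ℕ) :
    (σ.setReg x v).arr a = σ.arr a := rfl

@[simp] theorem Store.setCell_reg (σ : Store) (a i v y : ℕ) :
    (σ.setCell a i v).reg y = σ.reg y := rfl

@[simp] theorem Store.setCell_arr (σ : Store) (a i v b j : ℕ) :
    (σ.setCell a i v).arr b j = if b = a ∧ j = i then v else σ.arr b j := by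
  by_cases h1 : b = a <;> by_cases h2 : j = i <;> simp [Store.setCell, h1, h2]

end RAM

/-! ### Moat growing -/

namespace Moat

open Finset
open scoped Classical

variable {V : Type*}

/-- A state of the moat growing process: the moats are the fibres of `lab`, `slack x y` is what is
left of the length of the edge `xy`, `pot c` is what is left of the potential of the moat with
label `c`, and `forest` consists of the edges selected so far. -/
structure State (V : Type*) where
  lab : V → V
  slack : V → V → ℕ
  pot : V → ℕ
  forest : SimpleGraph V

namespace State

variable (dem : V → V → Prop) (s : State V)

/-- A moat is active if it has potential left or separates a demand. -/
def Active (c : V) : Prop :=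
  0 < s.pot c ∨ ∃ x y, dem x y ∧ s.lab x ≠ s.lab y ∧ (c = s.lab x ∨ c = s.lab y)

/-- The indicator of active moats, that is, the speed of growth. -/
noncomputable def rate (c : V) : ℕ := if s.Active dem c then 1 else 0

theorem rate_le_one (c : V) : s.rate dem c ≤ 1 := by
  unfold rate; split_ifs <;> simp

variable {dem s}

theorem rate_eq_one {c : V} (h : s.Active dem c) : s.rate dem c = 1 := if_pos h

theorem rate_eq_zero {c : V} (h : ¬ s.Active dem c) : s.rate dem c = 0 := if_neg h

end State

/-- One step of the process: all active moats grow by `Δ`, in units of half the previous ones (so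
that everything stays integral), until the edge `uv` becomes tight and joins two moats, or the
potential of the moat with label `u = v` is used up, or, if `u = v` and `Δ = 0`, nothing can
happen any more. -/
structure Step (G : SimpleGraph V) (dem : V → V → Prop) (s s' : State V) (Δ : ℕ) (u v : V) :
    Prop where
  slack_le : ∀ x y, G.Adj x y → s.lab x ≠ s.lab y →
    (s.rate dem (s.lab x) + s.rate dem (s.lab y)) * Δ ≤ 2 * s.slack x y
  pot_le : ∀ c, 0 < s.pot c → Δ ≤ 2 * s.pot c
  slack_eq : ∀ x y, s'.slack x y =
    2 * s.slack x y - (s.rate dem (s.lab x) + s.rate dem (s.lab y)) * Δ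
  lab_eq : ∀ w, s'.lab w = if s.lab w = s.lab v then s.lab u else s.lab w
  pot_eq : ∀ c, s'.pot c =
    if s.lab u = s.lab v then 2 * s.pot c - s.rate dem c * Δ
    else if c = s.lab u then (2 * s.pot (s.lab u) - s.rate dem (s.lab u) * Δ) +
      (2 * s.pot (s.lab v) - s.rate dem (s.lab v) * Δ)
    else if c = s.lab v then 0 else 2 * s.pot c - s.rate dem c * Δ
  forest_eq : ∀ x y, s'.forest.Adj x y ↔ s.forest.Adj x y ∨
    s.lab u ≠ s.lab v ∧ (x = u ∧ y = v ∨ x = v ∧ y = u)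
  event : (s.lab u ≠ s.lab v ∧ G.Adj u v ∧
      0 < s.rate dem (s.lab u) + s.rate dem (s.lab v) ∧
      (s.rate dem (s.lab u) + s.rate dem (s.lab v)) * Δ = 2 * s.slack u v) ∨
    (u = v ∧ 0 < s.pot u ∧ Δ = 2 * s.pot u) ∨
    (u = v ∧ Δ = 0 ∧ (∀ c, s.pot c = 0) ∧ ∀ x y, G.Adj x y → s.lab x ≠ s.lab y →
      s.rate dem (s.lab x) + s.rate dem (s.lab y) = 0)

/-- `T` steps of the process, started with moats that are the components of a given forest. -/
structure Run (G : SimpleGraph V) (dem : V → V → Prop) (s : ℕ → State V) (T : ℕ)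
    (Δ : ℕ → ℕ) (u v : ℕ → V) : Prop where
  step : ∀ t < T, Step G dem (s t) (s (t + 1)) (Δ t) (u t) (v t)
  lab_zero : ∀ x y, (s 0).lab x = (s 0).lab y ↔ (s 0).forest.Reachable x y
  forest_le : (s 0).forest ≤ G
  slack_comm : ∀ x y, (s 0).slack x y = (s 0).slack y x

/-- Vertices that are never separated by an inactive moat. -/
def Together (dem : V → V → Prop) (s : ℕ → State V) (T : ℕ) (x y : V) : Prop :=
  ∀ t < T, (s t).lab x ≠ (s t).lab y →
    (s t).Active dem ((s t).lab x) ∧ (s t).Active dem ((s t).lab y)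

/-- `H` is a minimal subgraph of `F` that connects all related vertices. -/
structure IsPruned (R : V → V → Prop) (F H : SimpleGraph V) : Prop where
  le : H ≤ F
  reachable : ∀ x y, R x y → H.Reachable x y
  essential : ∀ x y, H.Adj x y → ∃ a b, R a b ∧ ¬ (H.deleteEdges {s(x, y)}).Reachable a b

theorem reachable_of_forall_adj {H K : SimpleGraph V} (h : ∀ x y, H.Adj x y → K.Reachable x y)
    {a b : V} (hab : H.Reachable a b) : K.Reachable a b := by
  rw [SimpleGraph.reachable_iff_reflTransGen] at hab
  induction hab with
  | refl => exact SimpleGraph.Reachable.refl _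
  | tail _ hbc ih => exact ih.trans (h _ _ hbc)

/-- In a minimal subgraph every edge is a bridge. -/
theorem IsPruned.isAcyclic {R : V → V → Prop} {F H : SimpleGraph V} (h : IsPruned R F H) :
    H.IsAcyclic := by
  rw [SimpleGraph.isAcyclic_iff_forall_adj_isBridge]
  intro x y hxy
  rw [SimpleGraph.isBridge_iff]
  intro hr
  obtain ⟨a, b, hab, hn⟩ := h.essential x y hxy
  refine hn (reachable_of_forall_adj (fun c d hcd => ?_) (h.reachable a b hab))
  by_cases he : s(c, d) = s(x, y)
  · rcases Sym2.eq_iff.1 he with ⟨rfl, rfl⟩ | ⟨rfl, rfl⟩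
    exacts [hr, hr.symm]
  · exact SimpleGraph.Adj.reachable (by simpa [hcd] using he)

/-- The only edge of a cut is not needed to connect vertices on the same side of the cut. -/
theorem reachable_deleteEdges_of_cut {H : SimpleGraph V} {S : Set V} {x y : V} (hx : x ∈ S)
    (hy : y ∉ S) (hcut : ∀ a b, H.Adj a b → a ∈ S → b ∉ S → a = x ∧ b = y) {a b : V}
    (hab : H.Reachable a b) (hS : a ∈ S ↔ b ∈ S) :
    (H.deleteEdges {s(x, y)}).Reachable a b := by
  have hadj : ∀ c d, H.Adj c d → (c ∈ S ↔ d ∈ S) → (H.deleteEdges {s(x, y)}).Adj c d := by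
    intro c d hcd hiff
    rw [SimpleGraph.deleteEdges_adj]
    refine ⟨hcd, fun he => ?_⟩
    rcases Sym2.eq_iff.1 he with ⟨rfl, rfl⟩ | ⟨rfl, rfl⟩
    exacts [hy (hiff.1 hx), hy (hiff.2 hx)]
  rw [SimpleGraph.reachable_iff_reflTransGen] at hab
  -- a walk that has left the side of `a` did so through `xy`, and its part up to the end of that
  -- edge on this side remains
  have key : ((b ∈ S ↔ a ∈ S) → (H.deleteEdges {s(x, y)}).Reachable a b) ∧
      (¬ (b ∈ S ↔ a ∈ S) → (H.deleteEdges {s(x, y)}).Reachable a (if a ∈ S then x else y)) := by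
    clear hS
    induction hab with
    | refl => simp
    | @tail b c _ hbc ih =>
      have hbc : H.Adj b c := hbc
      by_cases h1 : b ∈ S ↔ c ∈ S
      · refine ⟨fun h2 => (ih.1 (h1.trans h2)).trans (hadj b c hbc h1).reachable, fun h2 => ?_⟩
        exact ih.2 fun h3 => h2 (h1.symm.trans h3)
      · by_cases hb : b ∈ S
        · have hc : c ∉ S := fun hc => h1 (by simp [hb, hc])
          obtain ⟨rfl, rfl⟩ := hcut b c hbc hb hc
          by_cases ha : a ∈ S <;> simp_all
        · have hc : c ∈ S := by by_contra hc; exact h1 (by simp [hb, hc])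
          obtain ⟨rfl, rfl⟩ := hcut c b hbc.symm hc hb
          by_cases ha : a ∈ S <;> simp_all
  exact key.1 hS.symm

/-- A walk between the two sides of a cut contains an edge of the cut. -/
theorem exists_adj_of_reachable {H : SimpleGraph V} {S : Set V} {a b : V} (h : H.Reachable a b)
    (ha : a ∈ S) (hb : b ∉ S) : ∃ x y, H.Adj x y ∧ x ∈ S ∧ y ∉ S := by
  rw [SimpleGraph.reachable_iff_reflTransGen] at h
  induction h with
  | refl => exact absurd ha hb
  | @tail b c _ hbc ih =>
    by_cases hbS : b ∈ S
    · exact ⟨b, c, hbc, hbS, hb⟩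
    · exact ih hbS

section run

variable {G : SimpleGraph V} {dem : V → V → Prop} {s s' : State V} {Δ : ℕ} {u v : V}

theorem Step.lab_congr (h : Step G dem s s' Δ u v) {x y : V} (hxy : s.lab x = s.lab y) :
    s'.lab x = s'.lab y := by
  rw [h.lab_eq, h.lab_eq, hxy]

theorem Step.forest_mono (h : Step G dem s s' Δ u v) : s.forest ≤ s'.forest :=
  fun x y hxy => (h.forest_eq x y).2 (Or.inl hxy)

theorem Step.adj_of_ne (h : Step G dem s s' Δ u v) (hne : s.lab u ≠ s.lab v) : G.Adj u v := by
  rcases h.event with h | h | h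
  · exact h.2.1
  · exact absurd (by rw [h.1]) hne
  · exact absurd (by rw [h.1]) hne

/-- A pair that is separated before a step but not after it consists of the two moats that
the step joins. -/
theorem Step.eq_or_eq_of_joined (h : Step G dem s s' Δ u v) {x y : V} (hne : s.lab x ≠ s.lab y)
    (heq : s'.lab x = s'.lab y) : s.lab u ≠ s.lab v ∧
      (s.lab x = s.lab u ∧ s.lab y = s.lab v ∨ s.lab x = s.lab v ∧ s.lab y = s.lab u) := by
  rw [h.lab_eq, h.lab_eq] at heq
  split_ifs at heq with h1 h2 h2
  · exact absurd (h1.trans h2.symm) hne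
  · refine ⟨fun h3 => ?_, Or.inr ⟨h1, heq.symm⟩⟩
    exact h2 (heq.symm.trans h3)
  · exact ⟨fun h3 => h1 (heq.trans h3), Or.inl ⟨heq, h2⟩⟩
  · exact absurd heq hne

variable {s : ℕ → State V} {T : ℕ} {Δ : ℕ → ℕ} {u v : ℕ → V}

namespace Run

variable (h : Run G dem s T Δ u v)

include h

theorem lab_mono {t t' : ℕ} (ht : t ≤ t') (hT : t' ≤ T) {x y : V}
    (hxy : (s t).lab x = (s t).lab y) : (s t').lab x = (s t').lab y := by
  induction t', ht using Nat.le_induction with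
  | base => exact hxy
  | succ t' _ ih => exact (h.step t' (by omega)).lab_congr (ih (by omega))

theorem slack_symm {t : ℕ} (ht : t ≤ T) (x y : V) : (s t).slack x y = (s t).slack y x := by
  induction t with
  | zero => exact h.slack_comm x y
  | succ t ih =>
    rw [(h.step t (by omega)).slack_eq, (h.step t (by omega)).slack_eq, ih (by omega), add_comm]

theorem lab_eq_of_adj {t : ℕ} (ht : t ≤ T) {x y : V} (hxy : (s t).forest.Adj x y) :
    (s t).lab x = (s t).lab y := by
  induction t with
  | zero => exact (h.lab_zero x y).2 hxy.reachable
  | succ t ih =>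
    have hs := h.step t (by omega)
    rcases (hs.forest_eq x y).1 hxy with h1 | ⟨-, ⟨rfl, rfl⟩ | ⟨rfl, rfl⟩⟩
    · exact hs.lab_congr (ih (by omega) h1)
    all_goals simp [hs.lab_eq]

theorem forest_le_graph {t : ℕ} (ht : t ≤ T) : (s t).forest ≤ G := by
  induction t with
  | zero => exact h.forest_le
  | succ t ih =>
    have hs := h.step t (by omega)
    intro x y hxy
    rcases (hs.forest_eq x y).1 hxy with h1 | ⟨hne, ⟨rfl, rfl⟩ | ⟨rfl, rfl⟩⟩
    · exact ih (by omega) h1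
    · exact hs.adj_of_ne hne
    · exact (hs.adj_of_ne hne).symm

/-- No edge is selected inside a moat. -/
theorem adj_of_lab_eq {t t' : ℕ} (ht : t ≤ t') (hT : t' ≤ T) {x y : V}
    (hxy : (s t').forest.Adj x y) (hl : (s t).lab x = (s t).lab y) : (s t).forest.Adj x y := by
  induction t', ht using Nat.le_induction with
  | base => exact hxy
  | succ t' ht ih =>
    have hl' := h.lab_mono ht (by omega) hl
    rcases ((h.step t' (by omega)).forest_eq x y).1 hxy with h1 | ⟨hne, ⟨rfl, rfl⟩ | ⟨rfl, rfl⟩⟩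
    · exact ih (by omega) h1
    · exact absurd hl' hne
    · exact absurd hl'.symm hne

/-- Every moat is connected by the selected edges. -/
theorem reachable_of_lab_eq {t : ℕ} (ht : t ≤ T) {x y : V} (hxy : (s t).lab x = (s t).lab y) :
    (s t).forest.Reachable x y := by
  induction t generalizing x y with
  | zero => exact (h.lab_zero x y).1 hxy
  | succ t ih =>
    have hs := h.step t (by omega)
    have hmono : ∀ {a b}, (s t).lab a = (s t).lab b → (s (t + 1)).forest.Reachable a b :=
      fun hab => (ih (by omega) hab).mono hs.forest_mono
    by_cases hne : (s t).lab x = (s t).lab y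
    · exact hmono hne
    · obtain ⟨huv, h1 | h1⟩ := hs.eq_or_eq_of_joined hne hxy
      · have : (s (t + 1)).forest.Adj (u t) (v t) := (hs.forest_eq _ _).2 (by simp [huv])
        exact (hmono h1.1).trans (this.reachable.trans (hmono h1.2.symm))
      · have : (s (t + 1)).forest.Adj (v t) (u t) := (hs.forest_eq _ _).2 (by simp [huv])
        exact (hmono h1.1).trans (this.reachable.trans (hmono h1.2.symm))

end Run

end run

end Moat

/-! ### The length of a pruned forest -/

namespace Moat

open Finset
open scoped Classical

variable {V : Type*} [Fintype V]

namespace State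

variable (dem : V → V → Prop) (s : State V)

/-- The ordered pairs of adjacent vertices in different moats. -/
noncomputable def cross (R : SimpleGraph V) : Finset (V × V) :=
  univ.filter fun z => R.Adj z.1 z.2 ∧ s.lab z.1 ≠ s.lab z.2

/-- The total slack of the ordered pairs of adjacent vertices in different moats. -/
noncomputable def crossSlack (R : SimpleGraph V) : ℕ := ∑ z ∈ s.cross R, s.slack z.1 z.2

/-- The labels of the active moats. -/
noncomputable def active : Finset V := univ.filter (s.Active dem)

/-- The edges of `L` leave the moat with label `c`. -/
def Cut (L : SimpleGraph V) (c : V) : Prop := ∃ y z, L.Adj y z ∧ s.lab y = c ∧ s.lab z ≠ c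

variable {dem s} {R : SimpleGraph V}

theorem mem_cross {z : V × V} : z ∈ s.cross R ↔ R.Adj z.1 z.2 ∧ s.lab z.1 ≠ s.lab z.2 := by
  simp [cross]

theorem swap_mem_cross {z : V × V} : z.swap ∈ s.cross R ↔ z ∈ s.cross R := by
  simp only [mem_cross, Prod.fst_swap, Prod.snd_swap, R.adj_comm z.2 z.1, ne_comm]

/-- The speed at which the slack of `R` decreases, by the number of edges at each active moat. -/
theorem sum_rate_add_rate : ∑ z ∈ s.cross R, (s.rate dem (s.lab z.1) + s.rate dem (s.lab z.2)) =
    2 * #((s.cross R).filter fun z => s.Active dem (s.lab z.1)) := by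
  have h1 : ∑ z ∈ s.cross R, s.rate dem (s.lab z.2) = ∑ z ∈ s.cross R, s.rate dem (s.lab z.1) :=
    sum_nbij' Prod.swap Prod.swap (fun z hz => swap_mem_cross.2 hz)
      (fun z hz => swap_mem_cross.2 hz) (by simp) (by simp) (by simp)
  have h2 : ∑ z ∈ s.cross R, s.rate dem (s.lab z.1) =
      #((s.cross R).filter fun z => s.Active dem (s.lab z.1)) := by
    rw [card_filter]; rfl
  rw [sum_add_distrib, h1, h2, two_mul]

/-- Each active moat that `R` leaves uses up slack of `R`, twice since the pairs are ordered. -/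
theorem two_mul_card_cut_le : 2 * #(univ.filter fun c => s.Active dem c ∧ s.Cut R c) ≤
    ∑ z ∈ s.cross R, (s.rate dem (s.lab z.1) + s.rate dem (s.lab z.2)) := by
  rw [sum_rate_add_rate]
  refine Nat.mul_le_mul_left _ (le_trans (card_le_card ?_)
    (card_image_le (f := fun z : V × V => s.lab z.1)))
  intro c hc
  obtain ⟨hc, y, z, hyz, rfl, hz⟩ := (mem_filter.1 hc).2
  exact mem_image.2 ⟨(y, z), mem_filter.2 ⟨mem_cross.2 ⟨hyz, hz.symm⟩, hc⟩, rfl⟩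

end State

section step

variable {G : SimpleGraph V} {dem : V → V → Prop} {s s' : State V} {Δ : ℕ} {u v : V}
  {R : SimpleGraph V}

theorem Step.cross_subset (h : Step G dem s s' Δ u v) : s'.cross R ⊆ s.cross R := by
  intro z hz
  rw [State.mem_cross] at hz ⊢
  exact ⟨hz.1, fun h1 => hz.2 (h.lab_congr h1)⟩

/-- The balance of the slack over the pairs that are separated before the step. The factor two is
the change of units. -/
theorem Step.sum_slack_add (h : Step G dem s s' Δ u v) (hR : R ≤ G) :
    2 * s.crossSlack R = ∑ z ∈ s.cross R, s'.slack z.1 z.2 +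
      (∑ z ∈ s.cross R, (s.rate dem (s.lab z.1) + s.rate dem (s.lab z.2))) * Δ := by
  rw [State.crossSlack, mul_sum, sum_mul, ← sum_add_distrib]
  refine sum_congr rfl fun z hz => ?_
  rw [State.mem_cross] at hz
  have := h.slack_le z.1 z.2 (hR hz.1) hz.2
  rw [h.slack_eq]
  omega

theorem Step.crossSlack_add_le (h : Step G dem s s' Δ u v) (hR : R ≤ G) :
    s'.crossSlack R + (∑ z ∈ s.cross R, (s.rate dem (s.lab z.1) + s.rate dem (s.lab z.2))) * Δ ≤
      2 * s.crossSlack R := by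
  rw [h.sum_slack_add hR]
  exact Nat.add_le_add_right (sum_le_sum_of_subset h.cross_subset) _

end step

variable {G : SimpleGraph V} {dem : V → V → Prop} {s : ℕ → State V} {T : ℕ}
  {Δ : ℕ → ℕ} {u v : ℕ → V}

namespace Run

section

variable (h : Run G dem s T Δ u v)

include h

/-- Of the pairs that are joined by a step, the final forest contains only the tight edge. -/
theorem eq_of_mem_cross_diff {R : SimpleGraph V} (hR : R ≤ (s T).forest) {t : ℕ} (ht : t < T)
    {z : V × V} (hz : z ∈ (s t).cross R) (hz' : z ∉ (s (t + 1)).cross R) :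
    (s t).lab (u t) ≠ (s t).lab (v t) ∧ (z = (u t, v t) ∨ z = (v t, u t)) := by
  rw [State.mem_cross] at hz
  simp only [State.mem_cross, hz.1, true_and, not_not] at hz'
  have hadj := h.adj_of_lab_eq (t := t + 1) ht le_rfl (hR hz.1) hz'
  rcases ((h.step t ht).forest_eq _ _).1 hadj with h1 | ⟨hne, h1 | h1⟩
  · exact absurd (h.lab_eq_of_adj ht.le h1) hz.2
  · exact ⟨hne, Or.inl (Prod.ext h1.1 h1.2)⟩
  · exact ⟨hne, Or.inr (Prod.ext h1.1 h1.2)⟩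

theorem cross_last {R : SimpleGraph V} (hR : R ≤ (s T).forest) : (s T).cross R = ∅ := by
  refine eq_empty_of_forall_notMem fun z hz => ?_
  rw [State.mem_cross] at hz
  exact hz.2 (h.lab_eq_of_adj le_rfl (hR hz.1))

/-- The edges of the final forest between different moats form a forest on the moats, so there are
at most as many of them as moats that they touch. Backwards in time, a step that joins two moats
adds a moat and at most the two orientations of the tight edge. -/
theorem card_cross_le {R : SimpleGraph V} (hR : R ≤ (s T).forest) {t : ℕ} (ht : t ≤ T) :
    #((s t).cross R) ≤ 2 * #(((s t).cross R).image fun z => (s t).lab z.1) := by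
  induction ht using Nat.decreasingInduction with
  | self => simp [h.cross_last hR]
  | of_succ t ht ih =>
    have hs := h.step t ht
    set A := ((s t).cross R).image fun z => (s t).lab z.1 with hA
    set A' := ((s (t + 1)).cross R).image fun z => (s (t + 1)).lab z.1 with hA'
    -- how the step changes the labels
    let m : V → V := fun c => if c = (s t).lab (v t) then (s t).lab (u t) else c
    have hsub : A' ⊆ A.image m := by
      intro c hc
      obtain ⟨z, hz, rfl⟩ := mem_image.1 hc
      exact mem_image.2 ⟨_, mem_image_of_mem _ (hs.cross_subset hz), (hs.lab_eq _).symm⟩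
    have hle : #A' ≤ #A := (card_le_card hsub).trans card_image_le
    by_cases he : ∃ z ∈ (s t).cross R, z ∉ (s (t + 1)).cross R
    · obtain ⟨z, hz, hz'⟩ := he
      obtain ⟨hne, hzuv⟩ := h.eq_of_mem_cross_diff hR ht hz hz'
      have huv : (u t, v t) ∈ (s t).cross R := by
        rcases hzuv with rfl | rfl
        exacts [hz, State.swap_mem_cross.1 hz]
      have hu : (s t).lab (u t) ∈ A := mem_image.2 ⟨_, huv, rfl⟩
      have hv : (s t).lab (v t) ∈ A := mem_image.2 ⟨_, State.swap_mem_cross.2 huv, rfl⟩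
      have hsub' : A' ⊆ A.erase ((s t).lab (v t)) := by
        refine hsub.trans fun c hc => ?_
        obtain ⟨b, hb, rfl⟩ := mem_image.1 hc
        by_cases hbv : b = (s t).lab (v t)
        · simp only [m, hbv, if_true]
          exact mem_erase.2 ⟨hne, hu⟩
        · simp only [m, hbv, if_false]
          exact mem_erase.2 ⟨hbv, hb⟩
      have h1 := card_le_card hsub'
      rw [card_erase_of_mem hv] at h1
      have h2 : 0 < #A := card_pos.2 ⟨_, hv⟩
      have h3 : (s t).cross R ⊆ (s (t + 1)).cross R ∪ {(u t, v t), (v t, u t)} := by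
        intro y hy
        by_cases hy' : y ∈ (s (t + 1)).cross R
        · exact mem_union_left _ hy'
        · have := (h.eq_of_mem_cross_diff hR ht hy hy').2
          exact mem_union_right _ (by simpa using this)
      have h4 := (card_le_card h3).trans (card_union_le _ _)
      have h5 := card_le_two (a := (u t, v t)) (b := (v t, u t))
      omega
    · push Not at he
      have := card_le_card (show (s t).cross R ⊆ (s (t + 1)).cross R from he)
      omega

/-- A subforest none of whose leaves is an inactive moat has, on average, degree at most two at
the active moats. -/
theorem card_active_le {R : SimpleGraph V} (hR : R ≤ (s T).forest) {t : ℕ} (ht : t ≤ T)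
    (hdeg : ∀ z ∈ (s t).cross R, ¬ (s t).Active dem ((s t).lab z.1) →
      2 ≤ #(((s t).cross R).filter fun y => (s t).lab y.1 = (s t).lab z.1)) :
    #(((s t).cross R).filter fun z => (s t).Active dem ((s t).lab z.1)) ≤
      2 * #((s t).active dem) := by
  have h1 := h.card_cross_le hR ht
  set E := (s t).cross R
  have h2 := card_filter_add_card_filter_not (s := E) fun z => (s t).Active dem ((s t).lab z.1)
  have h3 := card_filter_add_card_filter_not (s := E.image fun z => (s t).lab z.1)
    ((s t).Active dem)
  have h4 : #((E.image fun z => (s t).lab z.1).filter ((s t).Active dem)) ≤ #((s t).active dem) :=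
    card_le_card (filter_subset_filter _ (subset_univ _))
  have h5 : 2 * #((E.image fun z => (s t).lab z.1).filter fun c => ¬ (s t).Active dem c) ≤
      #(E.filter fun z => ¬ (s t).Active dem ((s t).lab z.1)) := by
    rw [filter_image]
    refine mul_card_image_le_card _ _ fun c hc => ?_
    obtain ⟨z, hz, rfl⟩ := mem_image.1 hc
    rw [mem_filter] at hz
    refine (hdeg z hz.1 hz.2).trans (card_le_card fun y hy => ?_)
    rw [mem_filter] at hy
    refine mem_filter.2 ⟨mem_filter.2 ⟨hy.1, ?_⟩, hy.2⟩
    rw [hy.2]; exact hz.2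
  omega

/-- If `g` decreases at least as fast as the total growth of the active moats, then it bounds
the length of a subforest none of whose leaves is ever an inactive moat. -/
theorem crossSlack_le {R : SimpleGraph V} (hR : R ≤ (s T).forest)
    (hdeg : ∀ t < T, ∀ z ∈ (s t).cross R, ¬ (s t).Active dem ((s t).lab z.1) →
      2 ≤ #(((s t).cross R).filter fun y => (s t).lab y.1 = (s t).lab z.1))
    (g : ℕ → ℕ) (hg : ∀ t < T, g (t + 1) + 2 * #((s t).active dem) * Δ t ≤ 2 * g t)
    {t : ℕ} (ht : t ≤ T) : (s t).crossSlack R ≤ 2 * g t := by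
  induction ht using Nat.decreasingInduction with
  | self => simp [State.crossSlack, h.cross_last hR]
  | of_succ t ht ih =>
    have hs := h.step t ht
    have h1 := hs.sum_slack_add (hR.trans (h.forest_le_graph le_rfl))
    rw [State.sum_rate_add_rate] at h1
    have h2 := h.card_active_le hR ht.le (hdeg t ht)
    -- the pairs that the step joins have no slack left
    have h3 : ∑ z ∈ (s t).cross R, (s (t + 1)).slack z.1 z.2 = (s (t + 1)).crossSlack R := by
      refine (sum_subset hs.cross_subset fun z hz hz' => ?_).symm
      obtain ⟨hne, hzuv⟩ := h.eq_of_mem_cross_diff hR ht hz hz'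
      have huv : (s (t + 1)).slack (u t) (v t) = 0 := by
        rcases hs.event with he | he | he
        · rw [hs.slack_eq, he.2.2.2]; omega
        · exact absurd (by rw [he.1]) hne
        · exact absurd (by rw [he.1]) hne
      rcases hzuv with rfl | rfl
      · exact huv
      · rw [h.slack_symm ht]; exact huv
    have h4 := Nat.mul_le_mul_right (Δ t) h2
    have h5 := hg t ht
    rw [h3] at h1
    nlinarith

end

end Run

/-- No inactive moat is a leaf of the pruned forest: the only edge that leaves it would not be
needed, since it separates no pair that has to be connected. -/
theorem two_le_degree {H : SimpleGraph V} (hH : IsPruned (Together dem s T) (s T).forest H)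
    {t : ℕ} (ht : t < T) {z : V × V} (hz : z ∈ (s t).cross H)
    (hin : ¬ (s t).Active dem ((s t).lab z.1)) :
    2 ≤ #(((s t).cross H).filter fun y => (s t).lab y.1 = (s t).lab z.1) := by
  by_contra hlt
  have hone : ∀ y ∈ ((s t).cross H).filter fun y => (s t).lab y.1 = (s t).lab z.1, y = z := by
    intro y hy
    exact card_le_one.1 (by omega) y hy z (by simp [hz])
  have hz' := State.mem_cross.1 hz
  obtain ⟨a, b, hab, hn⟩ := hH.essential z.1 z.2 hz'.1
  refine hn (reachable_deleteEdges_of_cut (S := {x | (s t).lab x = (s t).lab z.1}) rfl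
    (fun h1 => hz'.2 h1.symm) (fun c d hcd hc hd => ?_) (hH.reachable a b hab) ?_)
  · have := hone (c, d) (mem_filter.2
      ⟨State.mem_cross.2 ⟨hcd, fun h1 => hd (h1.symm.trans hc)⟩, hc⟩)
    exact ⟨congrArg Prod.fst this, congrArg Prod.snd this⟩
  · change (s t).lab a = (s t).lab z.1 ↔ (s t).lab b = (s t).lab z.1
    by_cases hl : (s t).lab a = (s t).lab b
    · rw [hl]
    · obtain ⟨ha, hb⟩ := hab t ht hl
      constructor
      · intro h1; rw [h1] at ha; exact absurd ha hin
      · intro h1; rw [h1] at hb; exact absurd hb hin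

end Moat

/-! ### Termination and exhausted vertices -/

namespace Moat

open Finset
open scoped Classical

section

variable {V : Type*} {G : SimpleGraph V} {dem : V → V → Prop}

/-- An inactive state does not change. -/
theorem Step.of_inactive {s s' : State V} {Δ : ℕ} {u v : V} (h : Step G dem s s' Δ u v)
    (hin : ∀ c, ¬ s.Active dem c) :
    s'.lab = s.lab ∧ (∀ c, s'.pot c = 0) ∧ ∀ c, ¬ s'.Active dem c := by
  have hpot : ∀ c, s.pot c = 0 := fun c => by
    by_contra hc
    exact hin c (Or.inl (Nat.pos_of_ne_zero hc))
  have huv : u = v := by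
    rcases h.event with h1 | h1 | h1
    · have := h1.2.2.1
      rw [State.rate_eq_zero (hin _), State.rate_eq_zero (hin _)] at this
      omega
    · exact h1.1
    · exact h1.1
  subst huv
  have hl : s'.lab = s.lab := by
    funext w; rw [h.lab_eq]; split_ifs with hw
    exacts [hw.symm, rfl]
  have hpot' : ∀ c, s'.pot c = 0 := fun c => by rw [h.pot_eq, if_pos rfl, hpot]; omega
  refine ⟨hl, hpot', fun c hc => ?_⟩
  rcases hc with hc | ⟨x, y, hd, hne, hc⟩
  · rw [hpot'] at hc; omega
  · rw [hl] at hne hc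
    exact hin c (Or.inr ⟨x, y, hd, hne, hc⟩)

variable {s : ℕ → State V} {T : ℕ} {Δ : ℕ → ℕ} {u v : ℕ → V}

/-- A vertex is exhausted by `L` from time `t` on if `L` leaves its moat as long as this moat
has been active without interruption. -/
def Exhausted (dem : V → V → Prop) (s : ℕ → State V) (T : ℕ) (L : SimpleGraph V) (t : ℕ) (x : V) :
    Prop :=
  ∀ j, t ≤ j → j < T → (∀ i, t ≤ i → i ≤ j → (s i).Active dem ((s i).lab x)) →
    (s j).Cut L ((s j).lab x)

/-- If an inactive moat separates two vertices that `L` connects, then `L` exhausts one of them. -/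
theorem exhausted_or_exhausted (h : Run G dem s T Δ u v) {L : SimpleGraph V} {x y : V}
    (hxy : L.Reachable x y) (hsep : ¬ Together dem s T x y) :
    Exhausted dem s T L 0 x ∨ Exhausted dem s T L 0 y := by
  by_contra hno
  rw [not_or] at hno
  -- the moment at which the moat of `x` is active and contains a whole component of `L`
  have key : ∀ {x y}, L.Reachable x y → ¬ Exhausted dem s T L 0 x → ∃ j < T,
      (∀ i ≤ j, (s i).Active dem ((s i).lab x)) ∧ (s j).lab x = (s j).lab y := by
    intro x y hxy hx
    simp only [Exhausted] at hx
    push Not at hx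
    obtain ⟨j, -, hj, hact, hcut⟩ := hx
    refine ⟨j, hj, fun i hi => hact i i.zero_le hi, ?_⟩
    by_contra hne
    obtain ⟨a, b, hab, ha, hb⟩ := exists_adj_of_reachable
      (S := {z | (s j).lab z = (s j).lab x}) hxy rfl (fun h1 => hne h1.symm)
    exact hcut ⟨a, b, hab, ha, hb⟩
  obtain ⟨j, hj, hactx, hlx⟩ := key hxy hno.1
  obtain ⟨k, hk, hacty, hly⟩ := key hxy.symm hno.2
  refine hsep fun t ht hne => ⟨hactx t ?_, hacty t ?_⟩
  · by_contra hlt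
    exact hne (h.lab_mono (t := j) (by omega) ht.le hlx)
  · by_contra hlt
    exact hne (h.lab_mono (t := k) (by omega) ht.le hly.symm)

end

variable {V : Type*} [Fintype V]

section step

variable {G : SimpleGraph V} {dem : V → V → Prop} {s s' : State V} {Δ : ℕ} {u v : V}

/-- The number of moats plus the number of positive potentials, which decreases until nothing can
happen any more. -/
noncomputable def State.measure (s : State V) : ℕ :=
  #(univ.image s.lab) + #(univ.filter fun c => 0 < s.pot c)

/-- Joining two moats removes a label and does not increase the number of positive potentials, as
the two potentials are pooled; the other kind of event removes a positive potential. -/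
theorem Step.measure_lt (h : Step G dem s s' Δ u v) :
    s'.measure < s.measure ∨ (∀ c, s.pot c = 0) ∧ ∀ x y, G.Adj x y → s.lab x ≠ s.lab y →
      s.rate dem (s.lab x) + s.rate dem (s.lab y) = 0 := by
  rcases h.event with h1 | h1 | h1
  · left
    obtain ⟨hne, -⟩ := h1
    have hlab : univ.image s'.lab ⊆ (univ.image s.lab).erase (s.lab v) := by
      intro c hc
      obtain ⟨x, -, rfl⟩ := mem_image.1 hc
      rw [h.lab_eq]
      split_ifs with hx
      · exact mem_erase.2 ⟨hne, mem_image_of_mem _ (mem_univ _)⟩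
      · exact mem_erase.2 ⟨hx, mem_image_of_mem _ (mem_univ _)⟩
    have hmem : s.lab v ∈ univ.image s.lab := mem_image_of_mem _ (mem_univ _)
    have h2 := card_le_card hlab
    rw [card_erase_of_mem hmem] at h2
    have h3 : 0 < #(univ.image s.lab) := card_pos.2 ⟨_, hmem⟩
    have h4 : #(univ.filter fun c => 0 < s'.pot c) ≤ #(univ.filter fun c => 0 < s.pot c) := by
      have hp := h.pot_eq
      simp only [hne, if_false] at hp
      by_cases hv : 0 < s.pot (s.lab v)
      · have hsub : (univ.filter fun c => 0 < s'.pot c) ⊆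
            insert (s.lab u) ((univ.filter fun c => 0 < s.pot c).erase (s.lab v)) := by
          intro c hc
          have hc := (mem_filter.1 hc).2
          rw [hp] at hc
          split_ifs at hc with h5 h6
          · exact mem_insert.2 (Or.inl h5)
          · exact absurd hc (by omega)
          · exact mem_insert_of_mem (mem_erase.2 ⟨h6, mem_filter.2 ⟨mem_univ _, by omega⟩⟩)
        have h5 := (card_le_card hsub).trans (card_insert_le _ _)
        rw [card_erase_of_mem (by simpa using hv)] at h5
        have : 0 < #(univ.filter fun c => 0 < s.pot c) := card_pos.2 ⟨_, by simpa using hv⟩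
        omega
      · refine card_le_card fun c hc => mem_filter.2 ⟨mem_univ _, ?_⟩
        have hc := (mem_filter.1 hc).2
        rw [hp] at hc
        split_ifs at hc with h5 h6
        · subst h5; omega
        · omega
        · omega
    unfold State.measure
    omega
  · left
    obtain ⟨rfl, hpos, rfl⟩ := h1
    have hl : s'.lab = s.lab := by
      funext w; rw [h.lab_eq]; split_ifs with hw
      exacts [hw.symm, rfl]
    have hsub : (univ.filter fun c => 0 < s'.pot c) ⊆
        (univ.filter fun c => 0 < s.pot c).erase u := by
      intro c hc
      have hc := (mem_filter.1 hc).2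
      rw [h.pot_eq, if_pos rfl] at hc
      refine mem_erase.2 ⟨?_, mem_filter.2 ⟨mem_univ _, by omega⟩⟩
      rintro rfl
      rw [State.rate_eq_one (Or.inl hpos)] at hc
      omega
    have h2 := card_le_card hsub
    have hu : u ∈ univ.filter fun c => 0 < s.pot c := by simpa using hpos
    rw [card_erase_of_mem hu] at h2
    have : 0 < #(univ.filter fun c => 0 < s.pot c) := card_pos.2 ⟨_, hu⟩
    unfold State.measure
    rw [hl]; omega
  · exact Or.inr h1.2.2

end step

variable {G : SimpleGraph V} {dem : V → V → Prop} {s : ℕ → State V} {T : ℕ}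
  {Δ : ℕ → ℕ} {u v : ℕ → V}

/-- After more steps than twice the number of vertices nothing is active. Demands that are connected
in `G` are needed: otherwise a component of `G` could stay active for ever. -/
theorem Run.inactive_of_lt (h : Run G dem s T Δ u v) (hfeas : ∀ x y, dem x y → G.Reachable x y)
    {t : ℕ} (ht : t ≤ T) (hV : 2 * Fintype.card V < t) (c : V) : ¬ (s t).Active dem c := by
  have hmeas : (s 0).measure ≤ 2 * Fintype.card V := by
    have h1 := card_le_univ (univ.image (s 0).lab)
    have h2 := card_le_univ (univ.filter fun c => 0 < (s 0).pot c)
    unfold State.measure; omega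
  have hex : ∃ r < t, ∀ c, ¬ (s r).Active dem c := by
    by_contra hno
    push Not at hno
    have hdec : ∀ r ≤ t, (s r).measure + r ≤ (s 0).measure := by
      intro r hr
      induction r with
      | zero => simp
      | succ r ih =>
        have ih := ih (by omega)
        rcases (h.step r (by omega)).measure_lt with h1 | ⟨hpot, hrate⟩
        · omega
        · exfalso
          obtain ⟨c, hc⟩ := hno r (by omega)
          rcases hc with hc | ⟨x, y, hd, hne, -⟩
          · rw [hpot] at hc; omega
          · obtain ⟨a, b, hab, ha, hb⟩ := exists_adj_of_reachable
              (S := {z | (s r).lab z = (s r).lab x}) (hfeas x y hd) rfl (fun h1 => hne h1.symm)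
            have ha : (s r).lab a = (s r).lab x := ha
            have := hrate a b hab fun h1 => hb (h1.symm.trans ha)
            rw [ha, State.rate_eq_one (c := (s r).lab x)
              (Or.inr ⟨x, y, hd, hne, Or.inl rfl⟩)] at this
            omega
    have := hdec t le_rfl
    omega
  obtain ⟨r, hr, hin⟩ := hex
  have key : ∀ k, r + k ≤ T → ∀ c, ¬ (s (r + k)).Active dem c := by
    intro k
    induction k with
    | zero => exact fun _ => hin
    | succ k ih => exact fun hk => ((h.step (r + k) hk).of_inactive (ih (by omega))).2.2
  obtain ⟨k, rfl⟩ := Nat.exists_eq_add_of_le hr.le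
  exact key k ht c

/-- Distribute the potentials over the vertices. Then the part of those that `L` exhausts is at
most the length of `L`: whenever the moat of such a vertex grows, it is paid for by its vertices in
proportion to what they have left, and it uses up as much slack of `L`. The factor two is due to the
ordered pairs in `crossSlack`. -/
theorem sum_exhausted_le (h : Run G dem s T Δ u v) {L : SimpleGraph V} (hL : L ≤ G)
    (hact : ∀ t < T, ∀ c, (s t).Active dem c ↔ 0 < (s t).pot c) (hlast : ∀ c, (s T).pot c = 0)
    {t : ℕ} (ht : t ≤ T) (r : V → ℚ) (hr : ∀ x, 0 ≤ r x)
    (hsum : ∀ c, ∑ x with (s t).lab x = c, r x = (s t).pot c) :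
    2 * ∑ x with Exhausted dem s T L t x, r x ≤ (s t).crossSlack L := by
  -- the shares in a potential that is zero are zero
  have hzero : ∀ t (r : V → ℚ), (∀ x, 0 ≤ r x) →
      (∀ c, ∑ x with (s t).lab x = c, r x = (s t).pot c) →
      ∀ x, (s t).pot ((s t).lab x) = 0 → r x = 0 := by
    intro t r hr hsum x hx
    have := hsum ((s t).lab x)
    rw [hx, Nat.cast_zero, sum_eq_zero_iff_of_nonneg fun x _ => hr x] at this
    exact this x (by simp)
  induction ht using Nat.decreasingInduction generalizing r with
  | self =>
    have : ∀ x, r x = 0 := fun x => hzero T r hr hsum x (hlast _)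
    simp [this]
  | of_succ t ht ih =>
    have hs := h.step t ht
    set S := s t with hS
    -- what is left of the potential of a moat after the growth, before moats are joined
    let q : V → ℕ := fun c => 2 * S.pot c - S.rate dem c * Δ t
    have hq : ∀ c, 0 < S.pot c → (q c : ℚ) = 2 * S.pot c - Δ t := by
      intro c hc
      have := hs.pot_le c hc
      have hrate : S.rate dem c = 1 := State.rate_eq_one ((hact t ht c).2 hc)
      simp only [q, hrate, one_mul]
      rw [Nat.cast_sub this]; push_cast; ring
    -- every vertex pays in proportion to its share
    let r' : V → ℚ := fun x => r x * (q (S.lab x) / S.pot (S.lab x))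
    have hr' : ∀ x, 0 ≤ r' x := fun x => mul_nonneg (hr x) (by positivity)
    have hsum1 : ∀ c, ∑ x with S.lab x = c, r' x = q c := by
      intro c
      have h1 : ∑ x with S.lab x = c, r' x = (∑ x with S.lab x = c, r x) * (q c / S.pot c) := by
        rw [sum_mul]
        refine sum_congr rfl fun x hx => ?_
        rw [mem_filter] at hx
        simp only [r', hx.2]
      rw [h1, hsum]
      by_cases hc : S.pot c = 0
      · simp [q, hc]
      · field_simp
    have hsum' : ∀ c, ∑ x with (s (t + 1)).lab x = c, r' x = (s (t + 1)).pot c := by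
      intro c
      rw [hs.pot_eq]
      by_cases hne : S.lab (u t) = S.lab (v t)
      · rw [if_pos hne, ← hsum1 c]
        refine sum_congr (filter_congr fun x _ => ?_) fun _ _ => rfl
        rw [hs.lab_eq]
        split_ifs with h1
        · rw [h1, hne]
        · rfl
      · rw [if_neg hne]
        split_ifs with hcu hcv
        · rw [Nat.cast_add]
          change _ = (q (S.lab (u t)) : ℚ) + (q (S.lab (v t)) : ℚ)
          rw [← hsum1, ← hsum1, ← sum_union]
          · refine sum_congr ?_ fun _ _ => rfl
            ext x
            simp only [mem_filter, mem_univ, true_and, mem_union, hs.lab_eq, hcu]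
            split_ifs with h1
            · simp [h1]
            · simp [h1]
          · rw [disjoint_filter]
            intro x _ h1 h2
            exact hne (h1.symm.trans h2)
        · rw [Nat.cast_zero]
          refine sum_eq_zero fun x hx => ?_
          exfalso
          rw [mem_filter, hs.lab_eq, hcv] at hx
          split_ifs at hx with h1
          · exact hne hx.2
          · exact h1 hx.2
        · change _ = (q c : ℚ)
          rw [← hsum1 c]
          refine sum_congr (filter_congr fun x _ => ?_) fun _ _ => rfl
          rw [hs.lab_eq]
          split_ifs with h1
          · rw [h1]
            exact ⟨fun h2 => absurd h2.symm hcu, fun h2 => absurd h2.symm hcv⟩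
          · rfl
    have ih := ih r' hr' hsum'
    -- what a vertex contributes to the growth
    let charge : V → ℚ := fun x => r x * (Δ t / S.pot (S.lab x))
    have hcharge : ∀ x, 0 ≤ charge x := fun x => mul_nonneg (hr x) (by positivity)
    have hsplit : ∀ x, 2 * r x = r' x + charge x := by
      intro x
      by_cases hx : S.pot (S.lab x) = 0
      · simp [r', charge, hzero t r hr hsum x hx]
      · have h1 : (S.pot (S.lab x) : ℚ) ≠ 0 := by exact_mod_cast hx
        simp only [r', charge, hq _ (Nat.pos_of_ne_zero hx)]
        field_simp
        ring
    have hstep : ∀ x, Exhausted dem s T L t x → 0 < S.pot (S.lab x) →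
        Exhausted dem s T L (t + 1) x ∧ S.Cut L (S.lab x) := by
      intro x hx hpos
      have hax := (hact t ht _).2 hpos
      refine ⟨fun j hj hjT hij => hx j (by omega) hjT fun i hti hij' => ?_,
        hx t le_rfl ht fun i h1 h2 => ?_⟩
      · rcases hti.eq_or_lt with rfl | hlt
        · exact hax
        · exact hij i hlt hij'
      · obtain rfl : t = i := le_antisymm h1 h2
        exact hax
    have hne0 : ∀ x, r x ≠ 0 → 0 < S.pot (S.lab x) := fun x hx =>
      Nat.pos_of_ne_zero fun h1 => hx (hzero t r hr hsum x h1)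
    -- the vertices that are exhausted from `t` on are also exhausted from `t + 1` on, unless they
    -- have no share
    have h1 : ∑ x with Exhausted dem s T L t x, r' x ≤
        ∑ x with Exhausted dem s T L (t + 1) x, r' x := by
      rw [sum_filter, sum_filter]
      refine sum_le_sum fun x _ => ?_
      by_cases h0 : r x = 0
      · simp [r', h0]
      · by_cases hx : Exhausted dem s T L t x
        · rw [if_pos hx, if_pos (hstep x hx (hne0 x h0)).1]
        · rw [if_neg hx]
          split_ifs
          exacts [hr' x, le_rfl]
    set C := univ.filter fun c => S.Active dem c ∧ S.Cut L c with hC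
    -- the exhausted vertices with a share contribute to moats that `L` leaves only
    have h2 : ∑ x with Exhausted dem s T L t x, charge x ≤ #C * (Δ t : ℚ) := by
      calc ∑ x with Exhausted dem s T L t x, charge x
          ≤ ∑ x with S.lab x ∈ C, charge x := by
            rw [sum_filter, sum_filter]
            refine sum_le_sum fun x _ => ?_
            by_cases h0 : r x = 0
            · simp [charge, h0]
            · by_cases hx : Exhausted dem s T L t x
              · have hpos := hne0 x h0
                rw [if_pos hx, if_pos]
                exact mem_filter.2 ⟨mem_univ _, (hact t ht _).2 hpos, (hstep x hx hpos).2⟩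
              · rw [if_neg hx]
                split_ifs
                exacts [hcharge x, le_rfl]
        _ = ∑ c ∈ C, ∑ x with S.lab x = c, charge x := by
            rw [← sum_fiberwise_of_maps_to (s := univ.filter fun x => S.lab x ∈ C) (t := C)
              (g := S.lab) (fun x hx => (mem_filter.1 hx).2)]
            refine sum_congr rfl fun c hc => sum_congr ?_ fun _ _ => rfl
            ext x
            simp only [mem_filter, mem_univ, true_and]
            exact ⟨fun h1 => h1.2, fun h1 => ⟨h1 ▸ hc, h1⟩⟩
        _ = ∑ c ∈ C, (Δ t : ℚ) := by
            refine sum_congr rfl fun c hc => ?_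
            have hpos := (hact t ht c).1 (mem_filter.1 hc).2.1
            have h3 : ∑ x with S.lab x = c, charge x =
                (∑ x with S.lab x = c, r x) * (Δ t / S.pot c) := by
              rw [sum_mul]
              refine sum_congr rfl fun x hx => ?_
              rw [mem_filter] at hx
              simp only [charge, hx.2]
            rw [h3, hsum]
            have : (S.pot c : ℚ) ≠ 0 := by exact_mod_cast hpos.ne'
            field_simp
        _ = #C * (Δ t : ℚ) := by rw [sum_const, nsmul_eq_mul]
    have h3 := hs.crossSlack_add_le hL
    have h4 := Nat.mul_le_mul_right (Δ t) (State.two_mul_card_cut_le (dem := dem) (s := S) (R := L))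
    have h5 : (s (t + 1)).crossSlack L + 2 * #C * Δ t ≤ 2 * S.crossSlack L := by
      exact (Nat.add_le_add_left h4 _).trans h3
    have h5' : ((s (t + 1)).crossSlack L : ℚ) + 2 * #C * Δ t ≤ 2 * S.crossSlack L := by
      exact_mod_cast h5
    have h6 : 2 * ∑ x with Exhausted dem s T L t x, r x =
        ∑ x with Exhausted dem s T L t x, r' x + ∑ x with Exhausted dem s T L t x, charge x := by
      rw [mul_sum, ← sum_add_distrib]
      exact sum_congr rfl fun x _ => hsplit x
    nlinarith

/-- The joining of two moats does not change the sum of the potentials. -/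
theorem Step.sum_pot {s s' : State V} {Δ : ℕ} {u v : V} (h : Step G dem s s' Δ u v) :
    ∑ c, s'.pot c = ∑ c, (2 * s.pot c - s.rate dem c * Δ) := by
  by_cases hne : s.lab u = s.lab v
  · refine sum_congr rfl fun c _ => ?_
    rw [h.pot_eq, if_pos hne]
  · have hsub := subset_univ ({s.lab u, s.lab v} : Finset V)
    rw [← sum_sdiff hsub, ← sum_sdiff hsub (f := fun c => 2 * s.pot c - s.rate dem c * Δ),
      sum_pair hne, sum_pair hne]
    have h2 := h.pot_eq (s.lab u)
    have h3 := h.pot_eq (s.lab v)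
    simp only [hne, if_false, if_true, Ne.symm hne] at h2 h3
    rw [h2, h3, add_zero]
    congr 1
    refine sum_congr rfl fun c hc => ?_
    simp only [mem_sdiff, mem_univ, true_and, mem_insert, mem_singleton, not_or] at hc
    rw [h.pot_eq, if_neg hne, if_neg hc.1, if_neg hc.2]

theorem Step.sum_pot_le {s s' : State V} {Δ : ℕ} {u v : V} (h : Step G dem s s' Δ u v) :
    ∑ c, s'.pot c ≤ 2 * ∑ c, s.pot c := by
  rw [h.sum_pot, mul_sum]
  exact sum_le_sum fun c _ => Nat.sub_le _ _

/-- If only moats with a potential are active, the potentials pay for the growth. -/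
theorem Step.sum_pot_add {s s' : State V} {Δ : ℕ} {u v : V} (h : Step G dem s s' Δ u v)
    (hact : ∀ c, s.Active dem c ↔ 0 < s.pot c) :
    ∑ c, s'.pot c + #(s.active dem) * Δ = 2 * ∑ c, s.pot c := by
  have h2 : #(s.active dem) * Δ = ∑ c, s.rate dem c * Δ := by
    rw [← sum_mul, State.active, card_filter]; rfl
  rw [h.sum_pot, h2, ← sum_add_distrib, mul_sum]
  refine sum_congr rfl fun c _ => ?_
  by_cases hc : 0 < s.pot c
  · have := h.pot_le c hc
    rw [State.rate_eq_one ((hact c).2 hc)]; omega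
  · rw [State.rate_eq_zero (fun h' => hc ((hact c).1 h'))]; omega

end Moat

/-! ### The two stages -/

namespace Moat

open Finset
open scoped Classical

section stage

variable {V : Type*} [Fintype V]

/-- The total cost of the ordered pairs of adjacent vertices. -/
noncomputable def pairCost (c : V → V → ℕ) (R : SimpleGraph V) : ℕ :=
  ∑ z : V × V with R.Adj z.1 z.2, c z.1 z.2

/-- One stage of the algorithm: `T` steps of moat growing from the components of `H`, with
`q / p` times the length of a component as its potential, followed by pruning. All
lengths are scaled by `2 * p`, and every edge counts twice in `pairCost`. -/
def Stage (G : SimpleGraph V) (dem : V → V → Prop) (c : V → V → ℕ) (p q T : ℕ)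
    (H H' : SimpleGraph V) : Prop :=
  ∃ (s : ℕ → State V) (Δ : ℕ → ℕ) (u v : ℕ → V), Run G dem s T Δ u v ∧
    (s 0).forest = H ∧ (∀ x y, (s 0).slack x y = 2 * (p * c x y)) ∧
    (∀ a, (s 0).pot a = ∑ z : V × V with H.Adj z.1 z.2 ∧ (s 0).lab z.1 = a, q * c z.1 z.2) ∧
    IsPruned (Together dem s T) (s T).forest H'

variable {G : SimpleGraph V} {dem : V → V → Prop} {c : V → V → ℕ} {p q T : ℕ}
  {H H' : SimpleGraph V}

theorem crossSlack_zero_le {s : State V} (hs : ∀ x y, s.slack x y = 2 * (p * c x y))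
    (R : SimpleGraph V) : s.crossSlack R ≤ 2 * p * pairCost c R := by
  rw [State.crossSlack, pairCost, mul_sum]
  refine (sum_le_sum_of_subset (f := fun z : V × V => s.slack z.1 z.2) fun z hz => ?_).trans
    (sum_le_sum fun z _ => ?_)
  · exact mem_filter.2 ⟨mem_univ _, (State.mem_cross.1 hz).1⟩
  · rw [hs, mul_assoc]

/-- Vertices that are not separated by an inactive moat end up in the same moat. -/
theorem Run.lab_last_eq {s : ℕ → State V} {Δ : ℕ → ℕ} {u v : ℕ → V} (h : Run G dem s T Δ u v)
    (hfeas : ∀ x y, dem x y → G.Reachable x y) (hT : 2 * Fintype.card V + 1 < T) {x y : V}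
    (hxy : Together dem s T x y) : (s T).lab x = (s T).lab y := by
  by_contra hne
  have hne' : (s (T - 1)).lab x ≠ (s (T - 1)).lab y :=
    fun h1 => hne (h.lab_mono (by omega) le_rfl h1)
  exact h.inactive_of_lt hfeas (t := T - 1) (by omega) (by omega) _
    (hxy (T - 1) (by omega) hne').1

theorem Run.sum_pot_zero {s : ℕ → State V}
    (hpot : ∀ a, (s 0).pot a = ∑ z : V × V with H.Adj z.1 z.2 ∧ (s 0).lab z.1 = a, q * c z.1 z.2) :
    ∑ a, (s 0).pot a = q * pairCost c H := by
  rw [pairCost, mul_sum, ← sum_fiberwise _ fun z : V × V => (s 0).lab z.1]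
  refine sum_congr rfl fun a _ => ?_
  rw [hpot, filter_filter]

/-- Without potentials, all demands get connected at no more than twice the minimal cost, because
each active moat separates a demand and so uses up slack of `L`. -/
theorem Stage.steiner (h : Stage G dem c p q T ⊥ H') (hp : 0 < p) :
    H' ≤ G ∧ H'.IsAcyclic ∧ (∀ x y, dem x y → H'.Reachable x y) ∧
      ∀ L ≤ G, (∀ x y, dem x y → L.Reachable x y) → pairCost c H' ≤ 2 * pairCost c L := by
  obtain ⟨s, Δ, u, v, hr, hs0, hslack, hpot, hH'⟩ := h
  have hpot0 : ∀ t ≤ T, ∀ a, (s t).pot a = 0 := by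
    intro t ht
    induction t with
    | zero => intro a; simp [hpot]
    | succ t ih =>
      intro a
      have ih := ih (by omega)
      rw [(hr.step t (by omega)).pot_eq]
      split_ifs <;> simp [ih]
  have hle := hr.forest_le_graph le_rfl
  refine ⟨hH'.le.trans hle, hH'.isAcyclic, fun x y hd => ?_, fun L hL hcon => ?_⟩
  · exact hH'.reachable x y fun t ht hne =>
      ⟨Or.inr ⟨x, y, hd, hne, Or.inl rfl⟩, Or.inr ⟨x, y, hd, hne, Or.inr rfl⟩⟩
  · have h1 := hr.crossSlack_le hH'.le (fun t ht z hz hin => two_le_degree hH' ht hz hin)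
      (fun t => (s t).crossSlack L) (fun t ht => ?_) (t := 0) (Nat.zero_le _)
    · have h2 : (s 0).crossSlack H' = 2 * p * pairCost c H' := by
        rw [State.crossSlack, pairCost, mul_sum]
        refine sum_congr ?_ fun z _ => by rw [hslack, mul_assoc]
        ext z
        rw [State.mem_cross, mem_filter]
        refine ⟨fun h1 => ⟨mem_univ _, h1.1⟩, fun h1 => ⟨h1.2, fun h2 => ?_⟩⟩
        rw [hr.lab_zero, hs0, SimpleGraph.reachable_bot] at h2
        exact h1.2.ne h2
      have h3 := crossSlack_zero_le hslack L
      rw [h2] at h1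
      have h4 : 2 * p * pairCost c H' ≤ 2 * p * (2 * pairCost c L) := by
        calc _ ≤ _ := h1
          _ ≤ 2 * (2 * p * pairCost c L) := Nat.mul_le_mul_left _ h3
          _ = _ := by ring
      exact Nat.le_of_mul_le_mul_left h4 (by positivity)
    -- the growth of the active moats, in terms of the slack of `L`
    · have hs := hr.step t ht
      refine le_trans (Nat.add_le_add_left (Nat.mul_le_mul_right _ (le_trans ?_
        (State.two_mul_card_cut_le (dem := dem) (s := s t) (R := L)))) _) (hs.crossSlack_add_le hL)
      refine Nat.mul_le_mul_left _ (card_le_card fun a ha => ?_)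
      have ha : (s t).Active dem a := (mem_filter.1 ha).2
      refine mem_filter.2 ⟨mem_univ _, ha, ?_⟩
      rcases ha with ha | ⟨x, y, hd, hne, ha⟩
      · rw [hpot0 t ht.le] at ha; omega
      · have hxy := hcon x y hd
        rcases ha with rfl | rfl
        · obtain ⟨b, d, hbd, hb, hd⟩ := exists_adj_of_reachable
            (S := {z | (s t).lab z = (s t).lab x}) hxy rfl (fun h1 => hne h1.symm)
          exact ⟨b, d, hbd, hb, hd⟩
        · obtain ⟨b, d, hbd, hb, hd⟩ := exists_adj_of_reachable
            (S := {z | (s t).lab z = (s t).lab y}) hxy.symm rfl hne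
          exact ⟨b, d, hbd, hb, hd⟩

/-- If all demands are connected from the beginning, the components of the result
are clusters, up to the vertices in `Q`: those that `L` exhausts. Both bounds contain the factor
`q / p` between the length of a component and its potential. -/
theorem Stage.cluster (h : Stage G dem c p q T H H')
    (hdem : ∀ x y, dem x y → H.Reachable x y) (hHG : H ≤ G) (hT : 2 * Fintype.card V + 1 < T) :
    H' ≤ G ∧ H'.IsAcyclic ∧ (∀ x y, H.Reachable x y → H'.Reachable x y) ∧
      p * pairCost c H' ≤ (p + 2 * q) * pairCost c H ∧
      ∀ L ≤ G, ∃ Q : V → Prop, (∀ x y, H.Reachable x y → Q x → Q y) ∧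
        (∀ x y, L.Reachable x y → ¬ Q x → ¬ Q y → H'.Reachable x y) ∧
        q * ∑ z : V × V with H.Adj z.1 z.2 ∧ Q z.1, c z.1 z.2 ≤ p * pairCost c L := by
  obtain ⟨s, Δ, u, v, hr, rfl, hslack, hpot, hH'⟩ := h
  have hfeas : ∀ x y, dem x y → G.Reachable x y := fun x y hd => (hdem x y hd).mono hHG
  have hlab : ∀ x y, (s 0).forest.Reachable x y → ∀ t ≤ T, (s t).lab x = (s t).lab y :=
    fun x y hxy t ht => hr.lab_mono (Nat.zero_le t) ht ((hr.lab_zero x y).2 hxy)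
  -- no moat separates a demand, so activity is a matter of the potential alone
  have hact : ∀ t < T, ∀ a, (s t).Active dem a ↔ 0 < (s t).pot a := by
    refine fun t ht a => ⟨fun h1 => h1.elim id ?_, Or.inl⟩
    rintro ⟨x, y, hd, hne, -⟩
    exact absurd (hlab x y (hdem x y hd) t ht.le) hne
  have hin := hr.inactive_of_lt hfeas le_rfl (by omega)
  have hlast : ∀ a, (s T).pot a = 0 := fun a => by
    by_contra h1
    exact hin a (Or.inl (Nat.pos_of_ne_zero h1))
  refine ⟨hH'.le.trans (hr.forest_le_graph le_rfl), hH'.isAcyclic, fun x y hxy => ?_, ?_,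
    fun L hL => ⟨Exhausted dem s T L 0, ?_, fun x y hxy hx hy => ?_, ?_⟩⟩
  · exact hH'.reachable x y fun t ht hne => absurd (hlab x y hxy t ht.le) hne
  · have h1 := hr.crossSlack_le hH'.le (fun t ht z hz hin => two_le_degree hH' ht hz hin)
      (fun t => 2 * ∑ a, (s t).pot a) (fun t ht => ?_) (t := 0) (Nat.zero_le _)
    · rw [Run.sum_pot_zero hpot] at h1
      have h2 : 2 * p * pairCost c H' ≤ 2 * p * pairCost c (s 0).forest + (s 0).crossSlack H' := by
        rw [pairCost, pairCost, ← sum_filter_add_sum_filter_not _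
          (fun z : V × V => (s 0).lab z.1 = (s 0).lab z.2) fun z => c z.1 z.2, mul_add]
        refine Nat.add_le_add (Nat.mul_le_mul_left _ (sum_le_sum_of_subset fun z hz => ?_)) ?_
        · simp only [mem_filter, mem_univ, true_and] at hz ⊢
          exact hr.adj_of_lab_eq (Nat.zero_le T) le_rfl (hH'.le hz.1) hz.2
        · rw [State.crossSlack, mul_sum, filter_filter]
          refine le_of_eq (sum_congr rfl fun z _ => ?_)
          rw [hslack, mul_assoc]
      nlinarith
    · have := (hr.step t ht).sum_pot_add (hact t ht)
      nlinarith
  · intro x y hxy hx j hj hjT hij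
    have h1 := hlab x y hxy
    rw [← h1 j hjT.le]
    exact hx j hj hjT fun i hi hij' => by rw [h1 i (by omega)]; exact hij i hi hij'
  · by_contra hno
    exact (exhausted_or_exhausted hr hxy fun h1 => hno (hH'.reachable x y h1)).elim hx hy
  · have h1 := sum_exhausted_le hr hL hact hlast (t := 0) (Nat.zero_le _)
      (fun x => ∑ y with (s 0).forest.Adj x y, (q * c x y : ℚ)) (fun x => by positivity) ?_
    · have h2 : (∑ x with Exhausted dem s T L 0 x, ∑ y with (s 0).forest.Adj x y,
          (q * c x y : ℚ)) = ((q * ∑ z : V × V with (s 0).forest.Adj z.1 z.2 ∧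
            Exhausted dem s T L 0 z.1, c z.1 z.2 : ℕ) : ℚ) := by
        push_cast
        rw [mul_sum, sum_filter, sum_filter, ← univ_product_univ, sum_product]
        refine sum_congr rfl fun x _ => ?_
        by_cases hx : Exhausted dem s T L 0 x <;> simp [hx, sum_filter]
      have h3 := crossSlack_zero_le hslack L
      rw [h2] at h1
      have h4 : 2 * (q * ∑ z : V × V with (s 0).forest.Adj z.1 z.2 ∧
            Exhausted dem s T L 0 z.1, c z.1 z.2) ≤ (s 0).crossSlack L := by exact_mod_cast h1
      nlinarith
    · intro a
      rw [hpot]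
      push_cast
      rw [sum_filter, sum_filter, ← univ_product_univ, sum_product]
      refine sum_congr rfl fun x _ => ?_
      by_cases hx : (s 0).lab x = a <;> simp [hx, sum_filter]

end stage

end Moat

namespace SteinerInstance

open Finset
open scoped Classical

variable (I : SteinerInstance)

/-- Every edge is counted twice in a sum over ordered pairs. -/
theorem sum_cost_eq (R : SimpleGraph (Fin I.n)) :
    ∑ z : Fin I.n × Fin I.n with R.Adj z.1 z.2, I.cost s(z.1, z.2) = 2 * I.length R.edgeSet := by
  rw [length, ← sum_fiberwise_of_maps_to (g := fun z : Fin I.n × Fin I.n => s(z.1, z.2))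
    (t := univ.filter fun e => e ∈ R.edgeSet) (fun z hz => by simpa using hz), mul_sum]
  refine sum_congr (by ext; simp) fun e he => ?_
  induction e with
  | h a b =>
    have hab : R.Adj a b := by simpa using he
    have : ((univ.filter fun z : Fin I.n × Fin I.n => R.Adj z.1 z.2).filter
        fun z => s(z.1, z.2) = s(a, b)) = {(a, b), (b, a)} := by
      ext ⟨x, y⟩
      simp only [mem_filter, mem_univ, true_and, Sym2.eq_iff, mem_insert, mem_singleton,
        Prod.mk.injEq]
      constructor
      · exact fun h1 => h1.2
      · rintro (⟨rfl, rfl⟩ | ⟨rfl, rfl⟩)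
        exacts [⟨hab, Or.inl ⟨rfl, rfl⟩⟩, ⟨hab.symm, Or.inr ⟨rfl, rfl⟩⟩]
    rw [this, sum_pair (fun h1 => hab.ne (congrArg Prod.fst h1)), Sym2.eq_swap (a := b), two_mul]

theorem length_mono {E E' : Set (Sym2 (Fin I.n))} (h : E ⊆ E') : I.length E ≤ I.length E' :=
  sum_le_sum_of_subset fun e he => by
    simp only [mem_filter, mem_univ, true_and] at he ⊢
    exact h he

theorem opt_nonneg (D : Finset (Fin I.n × Fin I.n)) : 0 ≤ I.opt D :=
  Real.sInf_nonneg (by rintro x ⟨F, -, rfl⟩; positivity)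

/-- A graph that connects the demands contains a forest that does. -/
theorem opt_le {D : Finset (Fin I.n × Fin I.n)} {R : SimpleGraph (Fin I.n)} (hR : R ≤ I.graph)
    (h : ∀ d ∈ D, R.Reachable d.1 d.2) : I.opt D ≤ I.length R.edgeSet := by
  obtain ⟨F, hF, hac, hr⟩ := R.exists_isAcyclic_reachable_eq_le
  have h1 : I.opt D ≤ I.length F.edgeSet :=
    (I.opt_isLeast D fun d hd => (h d hd).mono hR).2
      ⟨F, ⟨hF.trans hR, hac, fun d hd => by rw [hr]; exact h d hd⟩, rfl⟩
  have h2 : I.length F.edgeSet ≤ I.length R.edgeSet :=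
    I.length_mono (SimpleGraph.edgeSet_mono hF)
  exact h1.trans (by exact_mod_cast h2)

variable {I} {c : Fin I.n → Fin I.n → ℕ} {D : ℕ}

/-- The costs `c` are the edge costs times the common denominator `D`. -/
theorem pairCost_eq (hc : ∀ x y, I.graph.Adj x y → (c x y : ℚ≥0) = D * I.cost s(x, y))
    {R : SimpleGraph (Fin I.n)} (hR : R ≤ I.graph) :
    (Moat.pairCost c R : ℝ) = 2 * D * I.length R.edgeSet := by
  have h1 : (Moat.pairCost c R : ℚ≥0) = 2 * D * I.length R.edgeSet := by
    rw [mul_comm (2 : ℚ≥0), mul_assoc, ← I.sum_cost_eq R, Moat.pairCost, mul_sum, Nat.cast_sum]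
    exact sum_congr rfl fun z hz => hc _ _ (hR (mem_filter.1 hz).2)
  exact_mod_cast congrArg (fun x : ℚ≥0 => (x : ℝ)) h1

/-- The two stages of moat growing yield the clustering. The optimal forest for the demands of the
cluster `a` is compared with the graph `K a` of the edges of an optimal forest `L` for all demands
and of the first forest `H₁` that serve `a`; every edge of `L` belongs to at most one `K a`, and so
does every edge of `H₁` at a vertex in `Q`. -/
theorem cluster_of_stages {ε : ℚ≥0} (hε : 0 < ε) (hI : I.Feasible) (hD : 0 < D)
    (hc : ∀ x y, I.graph.Adj x y → (c x y : ℚ≥0) = D * I.cost s(x, y))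
    {T : ℕ} (hT : 2 * I.n + 1 < T)
    {H₁ H₂ : SimpleGraph (Fin I.n)}
    (h₁ : Moat.Stage I.graph (fun x y => (x, y) ∈ I.demands) c ε.num ε.den T ⊥ H₁)
    (h₂ : Moat.Stage I.graph (fun x y => (x, y) ∈ I.demands) c ε.num ε.den T H₁ H₂) :
    H₂ ≤ I.graph ∧ H₂.IsAcyclic ∧ (∀ d ∈ I.demands, H₂.Reachable d.1 d.2) ∧
      (I.length H₂.edgeSet : ℝ) ≤ (4 / (ε : ℝ) + 2) * I.opt I.demands ∧
      ∀ lab : Fin I.n → Fin I.n, (∀ x y, H₂.Reachable x y ↔ lab x = lab y) →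
        ∑ a, I.opt (I.demands.filter fun d => lab d.1 = a) ≤
          (1 + (ε : ℝ)) * I.opt I.demands := by
  have hp : 0 < ε.num := NNRat.num_pos.2 hε
  have hq : 0 < ε.den := ε.den_pos
  have hpq : (ε : ℝ) = ε.num / ε.den := by
    conv_lhs => rw [← NNRat.num_div_den ε]
    push_cast; rfl
  have hp' : (0 : ℝ) < ε.num := by exact_mod_cast hp
  have hq' : (0 : ℝ) < ε.den := by exact_mod_cast hq
  have hD' : (0 : ℝ) < D := by exact_mod_cast hD
  have hcard : Fintype.card (Fin I.n) = I.n := Fintype.card_fin _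
  obtain ⟨hG₁, -, hr₁, hopt₁⟩ := h₁.steiner hp
  obtain ⟨hG₂, hac, hr₂, hlen, hQ⟩ := h₂.cluster hr₁ hG₁ (by rw [hcard]; exact hT)
  obtain ⟨L, ⟨hLG, -, hLr⟩, hLopt⟩ := (I.opt_isLeast I.demands hI).1
  have hL := pairCost_eq hc hLG
  have hone : (I.length H₁.edgeSet : ℝ) ≤ 2 * I.opt I.demands := by
    have h3 := hopt₁ L hLG fun x y hd => hLr (x, y) hd
    have h4 : (Moat.pairCost c H₁ : ℝ) ≤ 2 * Moat.pairCost c L := by exact_mod_cast h3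
    rw [hL, pairCost_eq hc hG₁, ← hLopt] at h4
    have h5 : (2 * D : ℝ) * I.length H₁.edgeSet ≤ 2 * D * (2 * I.opt I.demands) := by linarith
    exact le_of_mul_le_mul_left h5 (by positivity)
  refine ⟨hG₂, hac, fun d hd => hr₂ _ _ (hr₁ _ _ hd), ?_, fun lab hlab => ?_⟩
  · have h3 : (ε.num : ℝ) * Moat.pairCost c H₂ ≤ (ε.num + 2 * ε.den) * Moat.pairCost c H₁ := by
      exact_mod_cast hlen
    rw [pairCost_eq hc hG₁, pairCost_eq hc hG₂] at h3
    have h4 : (ε.num : ℝ) * I.length H₂.edgeSet ≤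
        (ε.num + 2 * ε.den) * (2 * I.opt I.demands) := by
      have h5 : (2 * D : ℝ) * (ε.num * I.length H₂.edgeSet) ≤
          2 * D * ((ε.num + 2 * ε.den) * I.length H₁.edgeSet) := by linarith
      exact (le_of_mul_le_mul_left h5 (by positivity)).trans
        (mul_le_mul_of_nonneg_left hone (by positivity))
    have h6 : (4 / (ε : ℝ) + 2) * I.opt I.demands =
        ((ε.num + 2 * ε.den) * (2 * I.opt I.demands)) / ε.num := by
      rw [hpq]; field_simp; ring
    rw [h6, le_div_iff₀ hp']
    linarith
  · obtain ⟨Q, hQr, hQL, hQc⟩ := hQ L hLG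
    -- the edges of the optimum that serve the cluster with label `a`
    let A : Fin I.n → Fin I.n × Fin I.n → Prop := fun a z =>
      L.Adj z.1 z.2 ∧ ∃ w, L.Reachable z.1 w ∧ ¬ Q w ∧ lab w = a
    -- the edges of the first forest that are bought again for it
    let B : Fin I.n → Fin I.n × Fin I.n → Prop := fun a z =>
      (H₁.Adj z.1 z.2 ∧ Q z.1) ∧ lab z.1 = a
    obtain ⟨K, hK⟩ : ∃ K : Fin I.n → SimpleGraph (Fin I.n),
        ∀ a x y, (K a).Adj x y ↔ A a (x, y) ∨ B a (x, y) := by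
      refine ⟨fun a => ⟨fun x y => A a (x, y) ∨ B a (x, y), ⟨?_⟩, ⟨?_⟩⟩, fun _ _ _ => Iff.rfl⟩
      · rintro x y (⟨h3, w, h4, h5⟩ | ⟨⟨h3, h4⟩, h5⟩)
        · exact Or.inl ⟨h3.symm, w, h3.symm.reachable.trans h4, h5⟩
        · refine Or.inr ⟨⟨h3.symm, hQr x y h3.reachable h4⟩, ?_⟩
          exact ((hlab x y).1 (hr₂ x y h3.reachable)).symm.trans h5
      · rintro x (⟨h3, -⟩ | ⟨⟨h3, -⟩, -⟩)
        exacts [h3.ne rfl, h3.ne rfl]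
    have hKG : ∀ a, K a ≤ I.graph := by
      intro a x y h3
      rcases (hK a x y).1 h3 with ⟨h3, -⟩ | ⟨⟨h3, -⟩, -⟩
      exacts [hLG h3, hG₁ h3]
    have hKr : ∀ a, ∀ d ∈ I.demands.filter (fun d => lab d.1 = a), (K a).Reachable d.1 d.2 := by
      intro a d hd
      obtain ⟨hd, hda⟩ := mem_filter.1 hd
      by_cases hQd : Q d.1
      · have hreach := hr₁ d.1 d.2 hd
        have key : ∀ y, H₁.Reachable d.1 y → (K a).Reachable d.1 y := by
          intro y hy
          have hy' := (SimpleGraph.reachable_iff_reflTransGen _ _).1 hy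
          induction hy' with
          | refl => exact SimpleGraph.Reachable.refl _
          | @tail x y hx hxy ih =>
            have hx := (SimpleGraph.reachable_iff_reflTransGen _ _).2 hx
            refine (ih hx).trans (SimpleGraph.Adj.reachable
              ((hK _ _ _).2 (Or.inr ⟨⟨hxy, hQr _ _ hx hQd⟩, ?_⟩)))
            exact ((hlab _ _).1 (hr₂ _ _ hx)).symm.trans hda
        exact key _ hreach
      · have hreach := hLr d hd
        have key : ∀ y, L.Reachable d.1 y → (K a).Reachable d.1 y := by
          intro y hy
          have hy' := (SimpleGraph.reachable_iff_reflTransGen _ _).1 hy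
          induction hy' with
          | refl => exact SimpleGraph.Reachable.refl _
          | @tail x y hx hxy ih =>
            have hx := (SimpleGraph.reachable_iff_reflTransGen _ _).2 hx
            exact (ih hx).trans (SimpleGraph.Adj.reachable
              ((hK _ _ _).2 (Or.inl ⟨hxy, d.1, hx.symm, hQd, hda⟩)))
        exact key _ hreach
    have hsum : ∑ a, Moat.pairCost c (K a) ≤ Moat.pairCost c L +
        ∑ z : Fin I.n × Fin I.n with H₁.Adj z.1 z.2 ∧ Q z.1, c z.1 z.2 := by
      simp only [Moat.pairCost, sum_filter]
      rw [sum_comm, ← sum_add_distrib]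
      refine sum_le_sum fun z _ => ?_
      have h3 : ∀ a, (if (K a).Adj z.1 z.2 then c z.1 z.2 else 0) ≤
          (if A a z then c z.1 z.2 else 0) + (if B a z then c z.1 z.2 else 0) := by
        intro a
        by_cases ha : A a z
        · rw [if_pos ha]; split_ifs <;> omega
        · by_cases hb : B a z
          · rw [if_pos hb]; split_ifs <;> omega
          · have : ¬ (K a).Adj z.1 z.2 := fun h4 => ((hK _ _ _).1 h4).elim ha hb
            rw [if_neg this]; omega
      -- an edge that serves at most one cluster is counted at most once
      have honce : ∀ (P : Fin I.n → Prop) (R : Prop) [DecidablePred P] [Decidable R],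
          (∀ a, P a → R) →
          (∀ a b, P a → P b → a = b) →
          ∑ a, (if P a then c z.1 z.2 else 0) ≤ if R then c z.1 z.2 else 0 := by
        intro P R _ _ hPR huniq
        by_cases hex : ∃ a, P a
        · obtain ⟨a, ha⟩ := hex
          rw [sum_eq_single a (fun b _ hb => if_neg fun h4 => hb (huniq b a h4 ha))
            (fun h4 => absurd (mem_univ a) h4), if_pos ha, if_pos (hPR a ha)]
        · push Not at hex
          rw [sum_eq_zero fun a _ => if_neg (hex a)]
          exact Nat.zero_le _
      refine (sum_le_sum fun a _ => h3 a).trans ?_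
      rw [sum_add_distrib]
      refine Nat.add_le_add (honce (fun a => A a z) _ (fun a ha => ha.1) ?_)
        (honce (fun a => B a z) _ (fun a ha => ha.1) ?_)
      · rintro a b ⟨-, w, h4, h5, rfl⟩ ⟨-, w', h4', h5', rfl⟩
        exact (hlab _ _).1 (hQL w w' (h4.symm.trans h4') h5 h5')
      · rintro a b ⟨-, rfl⟩ ⟨-, rfl⟩
        rfl
    have h3 : ∀ a, (2 * D : ℝ) * I.opt (I.demands.filter fun d => lab d.1 = a) ≤
        Moat.pairCost c (K a) := by
      intro a
      rw [pairCost_eq hc (hKG a)]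
      exact mul_le_mul_of_nonneg_left (I.opt_le (hKG a) (hKr a)) (by positivity)
    have h4 : (2 * D : ℝ) * ∑ a, I.opt (I.demands.filter fun d => lab d.1 = a) ≤
        Moat.pairCost c L +
          (∑ z : Fin I.n × Fin I.n with H₁.Adj z.1 z.2 ∧ Q z.1, c z.1 z.2 : ℕ) := by
      rw [mul_sum]
      refine (sum_le_sum fun a _ => h3 a).trans ?_
      exact_mod_cast hsum
    have h5 : (ε.den : ℝ) *
        (∑ z : Fin I.n × Fin I.n with H₁.Adj z.1 z.2 ∧ Q z.1, c z.1 z.2 : ℕ) ≤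
          ε.num * Moat.pairCost c L := by exact_mod_cast hQc
    set W : ℝ := ((∑ z : Fin I.n × Fin I.n with H₁.Adj z.1 z.2 ∧ Q z.1, c z.1 z.2 : ℕ) : ℝ)
    have h6 : W ≤ ε * Moat.pairCost c L := by
      rw [hpq, div_mul_eq_mul_div, le_div_iff₀ hq']
      linarith
    rw [hL, ← hLopt] at h4 h6
    have h7 : (2 * D : ℝ) * ∑ a, I.opt (I.demands.filter fun d => lab d.1 = a) ≤
        2 * D * ((1 + (ε : ℝ)) * I.opt I.demands) := by linarith
    exact le_of_mul_le_mul_left h7 (by positivity)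

end SteinerInstance

/-! ### The program -/

namespace RAM

open Term Cmd

/-! Arrays: `0` input and output, `1` adjacency matrix, `2` matrix of the demands, `3` integral
costs, `4` adjacency matrix of the forest, `5` labels of the moats, `6` slacks, `7` potentials,
`8` rates of the moats, `9` matrix of the pairs that an inactive moat separates.
Registers: `1` length of the input, `2` number `n` of vertices, `3` its square, `4` bound for all
numbers; all others are scratch. A matrix entry `(x, y)` has index `x * n + y`. -/

/-- The row of the matrix index in register `x`. -/
def row (x : ℕ) : Term := reg x / reg 2

/-- The column of the matrix index in register `x`. -/
def col (x : ℕ) : Term := (reg x).mod (reg 2)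

/-- The label of the moat that contains the row of the index in register `x`. -/
def rowLab (x : ℕ) : Term := cell 5 (row x)

/-- The label of the moat that contains the column of the index in register `x`. -/
def colLab (x : ℕ) : Term := cell 5 (col x)

/-- Is the index in register `x` that of a pair of vertices in different moats? -/
def apart (x : ℕ) : Term := 1 - (rowLab x).eq (colLab x)

/-- The sum of the rates of the moats at the ends of the pair in register `x`. -/
def speed (x : ℕ) : Term := cell 8 (rowLab x) + cell 8 (colLab x)

/-- Replace the label in register `9` by the one in register `8`. -/
def relabel : Cmd :=
  .for 10 2 (branch ((cell 5 (reg 10)).eq (reg 9)) (store 5 (reg 10) (reg 8)) skip)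

/-- Label the components of the forest. -/
def components : Cmd :=
  .for 7 2 (store 5 (reg 7) (reg 7)) ;;
  .for 7 3 (branch (cell 4 (reg 7)) (assign 8 (rowLab 7) ;; assign 9 (colLab 7) ;; relabel) skip)

/-- The initial moats, potentials and slacks of a stage. -/
def initStage : Cmd :=
  components ;;
  .for 7 2 (store 7 (reg 7) 0) ;;
  .for 7 3 (branch (cell 4 (reg 7))
    (storeC 7 (rowLab 7) (cell 7 (rowLab 7) + cell 0 2 * cell 3 (reg 7))) skip) ;;
  .for 7 3 (storeC 6 (reg 7) (2 * (cell 0 1 * cell 3 (reg 7)))) ;;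
  .for 7 3 (store 9 (reg 7) 0)

/-- Find the active moats. -/
def findActive : Cmd :=
  .for 7 2 (store 8 (reg 7) (lt 0 (cell 7 (reg 7)))) ;;
  .for 7 3 (branch (cell 2 (reg 7) * apart 7) (store 8 (rowLab 7) 1 ;; store 8 (colLab 7) 1) skip)

/-- Record the pairs that are separated by an inactive moat. -/
def separate : Cmd :=
  .for 7 3 (branch (apart 7 * (1 - cell 8 (rowLab 7) * cell 8 (colLab 7))) (store 9 (reg 7) 1) skip)

/-- Find the next event: the growth until then in register `11`, whether there is one in register
`12`, and the pair of vertices in registers `13` and `14`, which are equal if a potential is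
used up. Registers `15` and `16` tell whether the current pair gives rise to an event, and after
how much growth: as the slack divided by half the speed `1` or `2`, which is `3 - speed` times the
slack. -/
def findEvent : Cmd :=
  assign 11 0 ;; assign 12 0 ;; assign 13 0 ;; assign 14 0 ;;
  .for 7 3 (
    branch ((row 7).eq (col 7)) (assign 15 (cell 7 (row 7)) ;; assignC 16 (2 * cell 7 (row 7)))
      (assignC 15 (cell 1 (reg 7) * (apart 7 * speed 7)) ;;
        assignC 16 (cell 6 (reg 7) * (3 - speed 7))) ;;
    branch (reg 15 * (1 - reg 12 * (1 - (reg 16).lt (reg 11))))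
      (assign 11 (reg 16) ;; assign 12 1 ;; assign 13 (row 7) ;; assign 14 (col 7)) skip)

/-- Grow the moats, and pass to half the unit of length. -/
def update : Cmd :=
  .for 7 3 (storeC 6 (reg 7) (2 * cell 6 (reg 7) - speed 7 * reg 11)) ;;
  .for 7 2 (storeC 7 (reg 7) (2 * cell 7 (reg 7) - cell 8 (reg 7) * reg 11))

/-- Join the two moats of the event. -/
def join : Cmd :=
  assign 8 (cell 5 (reg 13)) ;; assign 9 (cell 5 (reg 14)) ;;
  branch ((reg 8).eq (reg 9)) skip
    (store 4 (reg 13 * reg 2 + reg 14) 1 ;; store 4 (reg 14 * reg 2 + reg 13) 1 ;;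
      storeC 7 (reg 8) (cell 7 (reg 8) + cell 7 (reg 9)) ;; store 7 (reg 9) 0 ;; relabel)

/-- One step of the moat growing process. -/
def growStep : Cmd := findActive ;; separate ;; findEvent ;; update ;; join

/-- Delete every edge of the forest that is not needed to connect the pairs which no inactive moat
separates. -/
def prune : Cmd :=
  .for 20 3 (branch (cell 4 (reg 20))
    (store 4 (reg 20) 0 ;; store 4 (col 20 * reg 2 + row 20) 0 ;; components ;; assign 12 0 ;;
      .for 7 3 (branch ((1 - cell 9 (reg 7)) * apart 7) (assign 12 1) skip) ;;
      branch (reg 12) (store 4 (reg 20) 1 ;; store 4 (col 20 * reg 2 + row 20) 1) skip)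
    skip)

/-- A whole stage. The length of the input is more than the number of steps after which nothing is
active. -/
def stage : Cmd := initStage ;; .for 20 1 growStep ;; prune

/-- Read the input and make the costs integral, with the product of all positive entries of the
input as the common denominator. A non-edge gets the cost `0`, as its numerator in the input is
`0`. -/
def readInput : Cmd :=
  assign 5 1 ;;
  .for 7 1 (branch (cell 0 (reg 7)) (assignC 5 (reg 5 * cell 0 (reg 7))) skip) ;;
  .for 7 3 (store 1 (reg 7) (cell 0 (3 + reg 7))) ;;
  .for 7 3 (store 2 (reg 7) (cell 0 (3 + 3 * reg 3 + reg 7))) ;;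
  .for 7 3 (storeC 3 (reg 7)
    (cell 0 (3 + reg 3 + reg 7) * (reg 5 / cell 0 (3 + 2 * reg 3 + reg 7))))

/-- Append a number to the output. -/
def emit (e : Term) : Cmd := storeC 0 (reg 5) e ;; assignC 5 (reg 5 + 1)

/-- Write the clusters with a demand. Register `5` is the length of the output so far, and register
`6` the number of clusters. The input, which is not needed any more, is overwritten. -/
def writeOutput : Cmd :=
  assign 5 1 ;; assign 6 0 ;;
  .for 20 2 (
    assign 12 0 ;;
    .for 7 3 (branch (cell 2 (reg 7) * (rowLab 7).eq (reg 20)) (assign 12 1) skip) ;;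
    branch (reg 12) (
      assignC 6 (reg 6 + 1) ;;
      .for 7 2 (emit ((cell 5 (reg 7)).eq (reg 20))) ;;
      .for 7 3 (emit (cell 4 (reg 7) * (rowLab 7).eq (reg 20))) ;;
      .for 7 3 (emit (cell 2 (reg 7) * (rowLab 7).eq (reg 20)))) skip) ;;
  store 0 0 (reg 6) ;; assign 0 (reg 5)

/-- Everything after the computation of the bound in register `4`. -/
def main : Cmd := readInput ;; stage ;; stage ;; components ;; writeOutput

theorem wf_main : main.wf = true := by decide

end RAM

/-! ### Correctness of the parts of the program -/

namespace RAM

open Term Cmd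
open scoped Classical

/-- A loop whose round `i` sets the entry `i` of an array to `f i`. -/
theorem Cmd.for_map {x b a : ℕ} {p : Cmd} {σ : Store} (f : ℕ → ℕ) (hregs : p.regs = [])
    (harrs : ∀ a' ∈ p.arrs, a' = a)
    (hp : ∀ i < σ.reg b, ∀ τ : Store, (∀ r, r ≠ x → τ.reg r = σ.reg r) →
      (∀ a', a' ≠ a → τ.arr a' = σ.arr a') → τ.reg x = i → (∀ j, i ≤ j → τ.arr a j = σ.arr a j) →
      ∀ j, (p.den τ).arr a j = if j = i then f i else τ.arr a j) (j : ℕ) :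
    ((Cmd.for x b p).den σ).arr a j = if j < σ.reg b then f j else σ.arr a j := by
  refine Cmd.for_rule (fun i τ => ∀ j, τ.arr a j = if j < i then f j else σ.arr a j)
    (fun _ _ _ h => h) (by simp) (fun i hi τ hr ha hx hP j => ?_) j
  rw [hp i hi τ (fun r hr' => hr r hr' (by simp [hregs]))
    (fun a' h => ha a' fun h' => h (harrs a' h')) hx (fun j hj => by rw [hP, if_neg (by omega)])]
  split_ifs with h1 h2 h2
  · rw [h1]
  · omega
  · rw [hP, if_pos (by omega)]
  · rw [hP, if_neg (by omega)]

section index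

variable {n : ℕ} (x y : Fin n)

theorem index_lt : (x : ℕ) * n + y < n * n := by
  have h1 := x.isLt
  have h2 := y.isLt
  have := Nat.mul_le_mul_right n (show (x : ℕ) + 1 ≤ n by omega)
  rw [add_mul] at this
  omega

@[simp] theorem index_div : ((x : ℕ) * n + y) / n = x := by
  rw [mul_comm, Nat.mul_add_div (by have := x.isLt; omega), Nat.div_eq_of_lt y.isLt, add_zero]

@[simp] theorem val_mod : (y : ℕ) % n = y := Nat.mod_eq_of_lt y.isLt

@[simp] theorem index_mod : ((x : ℕ) * n + y) % n = y := by
  rw [mul_comm, Nat.mul_add_mod, Nat.mod_eq_of_lt y.isLt]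

theorem exists_index {i : ℕ} (hi : i < n * n) : ∃ x y : Fin n, i = x * n + y := by
  have hn : 0 < n := Nat.pos_of_ne_zero (by rintro rfl; omega)
  exact ⟨⟨i / n, Nat.div_lt_of_lt_mul hi⟩, ⟨i % n, Nat.mod_lt _ hn⟩, (Nat.div_add_mod' i n).symm⟩

@[simp] theorem index_inj {x y x' y' : Fin n} :
    (x : ℕ) * n + y = x' * n + y' ↔ x = x' ∧ y = y' := by
  refine ⟨fun h => ⟨?_, ?_⟩, fun h => by rw [h.1, h.2]⟩
  · have := congrArg (· / n) h
    simpa [Fin.ext_iff] using this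
  · have := congrArg (· % n) h
    simpa [Fin.ext_iff] using this

end index

variable {n : ℕ} {σ : Store}

/-- The array `a` contains the 0-1 matrix of the relation `R`. -/
def IsMatrix (σ : Store) (a : ℕ) (R : Fin n → Fin n → Prop) : Prop :=
  ∀ x y : Fin n, σ.arr a (x * n + y) = if R x y then 1 else 0

theorem IsMatrix.congr {a : ℕ} {R R' : Fin n → Fin n → Prop} (h : IsMatrix σ a R)
    (hR : ∀ x y, R x y ↔ R' x y) : IsMatrix σ a R' := by
  have : R = R' := by
    funext x y
    exact propext (hR x y)
  rwa [← this]

theorem relabel_spec (w : ℕ) : (relabel.den σ).arr 5 w =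
    if w < σ.reg 2 then if σ.arr 5 w = σ.reg 9 then σ.reg 8 else σ.arr 5 w else σ.arr 5 w := by
  refine Cmd.for_map (fun w => if σ.arr 5 w = σ.reg 9 then σ.reg 8 else σ.arr 5 w) rfl
    (by simp [Cmd.arrs]) (fun i hi τ hr ha hx h5 j => ?_) w
  by_cases h : σ.arr 5 i = σ.reg 9 <;> simp [den, hr, hx, h5, h]
  rintro rfl
  exact h5 _ le_rfl

/-- Afterwards the labels tell the components of the forest apart. In the loop over the edges, the
vertices with the same label are connected, and the edges seen so far have ends with the same
label. -/
theorem components_spec {H : SimpleGraph (Fin n)} (h2 : σ.reg 2 = n) (h3 : σ.reg 3 = n * n)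
    (h4 : IsMatrix σ 4 H.Adj) : ∃ lab : Fin n → Fin n,
      (∀ x : Fin n, (components.den σ).arr 5 x = lab x) ∧
      ∀ x y, lab x = lab y ↔ H.Reachable x y := by
  unfold components
  simp only [den_seq]
  set σ' := (Cmd.for 7 2 (store 5 (reg 7) (reg 7))).den σ with hσ'
  have hr : ∀ r, r ≠ 7 → σ'.reg r = σ.reg r := fun r hr => den_reg _ _ (by simpa [regs] using hr)
  have ha : ∀ a, a ≠ 5 → σ'.arr a = σ.arr a := fun a ha => den_arr _ _ (by simpa [arrs] using ha)
  have h5 : ∀ x : Fin n, σ'.arr 5 x = x := by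
    intro x
    rw [hσ', Cmd.for_map (fun i => i) rfl (by simp [arrs])
      (fun i hi τ hr ha hx h5 j => by simp [den, hx]), if_pos (by rw [h2]; exact x.isLt)]
  have key := Cmd.for_rule (σ := σ') (x := 7) (b := 3)
    (p := branch (cell 4 (reg 7)) (assign 8 (rowLab 7) ;; assign 9 (colLab 7) ;; relabel) skip)
    (fun i τ => ∃ lab : Fin n → Fin n, (∀ x : Fin n, τ.arr 5 x = lab x) ∧
      (∀ x y, lab x = lab y → H.Reachable x y) ∧
      ∀ x y : Fin n, (x : ℕ) * n + y < i → H.Adj x y → lab x = lab y)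
    (fun _ _ _ h => h) ⟨id, h5, by rintro x y rfl; exact SimpleGraph.Reachable.refl _, by simp⟩ ?_
  · obtain ⟨lab, hl, hl1, hl2⟩ := key
    refine ⟨lab, hl, fun x y => ⟨hl1 x y, fun hxy => ?_⟩⟩
    rw [SimpleGraph.reachable_iff_reflTransGen] at hxy
    induction hxy with
    | refl => rfl
    | tail _ hbc ih =>
      refine ih.trans (hl2 _ _ ?_ hbc)
      rw [hr 3 (by decide), h3]
      exact index_lt _ _
  · rintro i hi τ hr' ha' hx ⟨lab, hl, hl1, hl2⟩
    rw [hr 3 (by decide), h3] at hi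
    obtain ⟨a, b, rfl⟩ := exists_index hi
    have hτ4 : τ.arr 4 = σ.arr 4 := by
      rw [ha' 4 (by decide), ha 4 (by decide)]
    have hτ2 : τ.reg 2 = n := by rw [hr' 2 (by decide) (by decide), hr 2 (by decide), h2]
    simp only [den, value_cell, value_reg, hτ4, hx, h4 a b]
    by_cases hab : H.Adj a b
    · simp only [hab, if_true, one_ne_zero, if_false]
      refine ⟨fun w => if lab w = lab b then lab a else lab w, fun w => ?_, ?_, ?_⟩
      · rw [relabel_spec]
        simp [rowLab, colLab, row, col, hτ2, hx, hl, Fin.val_inj]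
        split_ifs <;> rfl
      · intro x y hxy
        have hab' := hab.reachable
        dsimp only at hxy
        split_ifs at hxy with h1 h2 h2
        · exact (hl1 _ _ h1).trans (hl1 _ _ h2).symm
        · exact (hl1 _ _ h1).trans (hab'.symm.trans (hl1 _ _ hxy))
        · exact (hl1 _ _ hxy).trans (hab'.trans (hl1 _ _ h2).symm)
        · exact hl1 _ _ hxy
      · intro x y hlt hxy
        rcases Nat.lt_succ_iff_lt_or_eq.1 hlt with h1 | h1
        · simp only [hl2 x y h1 hxy]
        · obtain ⟨rfl, rfl⟩ := index_inj.1 h1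
          simp
    · simp only [hab, if_false, if_true]
      refine ⟨lab, hl, hl1, fun x y hlt hxy => ?_⟩
      rcases Nat.lt_succ_iff_lt_or_eq.1 hlt with h1 | h1
      · exact hl2 x y h1 hxy
      · obtain ⟨rfl, rfl⟩ := index_inj.1 h1
        exact absurd hxy hab

end RAM

/-! ### Correctness of a growth step -/

namespace RAM

open Term Cmd
open scoped Classical

variable {n : ℕ} {σ τ : Store} {G : SimpleGraph (Fin n)} {dem : Fin n → Fin n → Prop}
  {c : Fin n → Fin n → ℕ} {p q L M : ℕ} {s : Moat.State (Fin n)}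

/-- The data that the program never changes: the graph, the demands, the costs, the two numbers `p`
and `q` whose quotient is `ε`, the length `L` of the input, and the bound `M` on all numbers. -/
structure Env (G : SimpleGraph (Fin n)) (dem : Fin n → Fin n → Prop) (c : Fin n → Fin n → ℕ)
    (p q L M : ℕ) (σ : Store) : Prop where
  reg1 : σ.reg 1 = L
  reg2 : σ.reg 2 = n
  reg3 : σ.reg 3 = n * n
  reg4 : σ.reg 4 = M
  arr0 : σ.arr 0 1 = p ∧ σ.arr 0 2 = q
  arr1 : IsMatrix σ 1 G.Adj
  arr2 : IsMatrix σ 2 dem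
  arr3 : ∀ x y : Fin n, σ.arr 3 (x * n + y) = c x y

theorem Env.congr (h : Env G dem c p q L M σ) (hr : ∀ r, 1 ≤ r → r ≤ 4 → τ.reg r = σ.reg r)
    (ha : ∀ a, a ≤ 3 → τ.arr a = σ.arr a) : Env G dem c p q L M τ := by
  obtain ⟨h1, h2, h3, h4, h5, h6, h7, h8⟩ := h
  constructor
  · rw [hr 1 (by decide) (by decide), h1]
  · rw [hr 2 (by decide) (by decide), h2]
  · rw [hr 3 (by decide) (by decide), h3]
  · rw [hr 4 (by decide) (by decide), h4]
  · rw [ha 0 (by decide)]; exact h5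
  · intro x y; rw [ha 1 (by decide)]; exact h6 x y
  · intro x y; rw [ha 2 (by decide)]; exact h7 x y
  · intro x y; rw [ha 3 (by decide)]; exact h8 x y

theorem Env.den (h : Env G dem c p q L M σ) (C : Cmd) (hr : ∀ r ∈ C.regs, 5 ≤ r)
    (ha : ∀ a ∈ C.arrs, 4 ≤ a) : Env G dem c p q L M (C.den σ) :=
  h.congr (fun r _ h2 => den_reg C σ fun hm => by have := hr r hm; omega)
    fun a h1 => den_arr C σ fun hm => by have := ha a hm; omega

/-- The arrays contain the state `s` of the moat growing process. -/
structure Represents (σ : Store) (s : Moat.State (Fin n)) : Prop where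
  lab : ∀ x : Fin n, σ.arr 5 x = s.lab x
  slack : ∀ x y : Fin n, σ.arr 6 (x * n + y) = s.slack x y
  pot : ∀ x : Fin n, σ.arr 7 x = s.pot x
  forest : IsMatrix σ 4 s.forest.Adj

theorem Represents.congr (h : Represents σ s) (ha : ∀ a, 4 ≤ a → a ≤ 7 → τ.arr a = σ.arr a) :
    Represents τ s := by
  obtain ⟨h1, h2, h3, h4⟩ := h
  constructor
  · intro x; rw [ha 5 (by decide) (by decide)]; exact h1 x
  · intro x y; rw [ha 6 (by decide) (by decide)]; exact h2 x y
  · intro x; rw [ha 7 (by decide) (by decide)]; exact h3 x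
  · intro x y; rw [ha 4 (by decide) (by decide)]; exact h4 x y

section terms

variable {i : ℕ} {a b : Fin n} (h2 : σ.reg 2 = n) (hi : σ.reg i = a * n + b)

include h2 hi

theorem value_row : (row i).value σ = a := by simp [row, h2, hi]

theorem value_col : (col i).value σ = b := by
  simp only [col, value_mod, value_reg, h2, hi, index_mod]

theorem value_rowLab : (rowLab i).value σ = σ.arr 5 a := by
  rw [rowLab, value_cell, value_row h2 hi]

theorem value_colLab : (colLab i).value σ = σ.arr 5 b := by
  rw [colLab, value_cell, value_col h2 hi]

theorem value_apart (h : ∀ x : Fin n, σ.arr 5 x = s.lab x) :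
    (apart i).value σ = if s.lab a = s.lab b then 0 else 1 := by
  simp only [apart, value_sub, value_ofNat, value_eq, value_rowLab h2 hi, value_colLab h2 hi, h,
    Fin.val_inj]
  split_ifs <;> rfl

theorem value_speed (h : ∀ x : Fin n, σ.arr 5 x = s.lab x)
    (h8 : ∀ x : Fin n, σ.arr 8 x = s.rate dem x) :
    (speed i).value σ = s.rate dem (s.lab a) + s.rate dem (s.lab b) := by
  simp only [speed, value_add, value_cell, value_rowLab h2 hi, value_colLab h2 hi, h, h8]

end terms

theorem findActive_spec (hE : Env G dem c p q L M σ) (hS : Represents σ s) (x : Fin n) :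
    (findActive.den σ).arr 8 x = s.rate dem x := by
  unfold findActive
  simp only [den_seq]
  set σ' := (Cmd.for 7 2 (store 8 (reg 7) (lt 0 (cell 7 (reg 7))))).den σ with hσ'
  have hE' : Env G dem c p q L M σ' := hE.den _ (by decide) (by decide)
  have hS' : Represents σ' s := hS.congr fun a h1 h2 => den_arr _ _ (by simp [arrs]; omega)
  have h8 : ∀ x : Fin n, σ'.arr 8 x = if 0 < s.pot x then 1 else 0 := by
    intro x
    rw [hσ', Cmd.for_map (fun i => if 0 < σ.arr 7 i then 1 else 0) rfl (by simp [arrs])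
      (fun i hi τ hr ha hx h5 j => by simp [den, hx, ha]), if_pos (by rw [hE.reg2]; exact x.isLt),
      hS.pot]
  have key := Cmd.for_rule (σ := σ') (x := 7) (b := 3)
    (p := branch (cell 2 (reg 7) * apart 7) (store 8 (rowLab 7) 1 ;; store 8 (colLab 7) 1) skip)
    (fun i τ => ∀ x : Fin n, τ.arr 8 x = if 0 < s.pot x ∨ ∃ a b : Fin n, (a : ℕ) * n + b < i ∧
      dem a b ∧ s.lab a ≠ s.lab b ∧ (x = s.lab a ∨ x = s.lab b) then 1 else 0)
    (fun _ _ _ h => h) (by simpa using h8) ?_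
  · rw [key x, hE'.reg3]
    by_cases hA : s.Active dem x
    · rw [Moat.State.rate_eq_one hA, if_pos]
      exact hA.imp id fun ⟨a, b, h⟩ => ⟨a, b, index_lt a b, h⟩
    · rw [Moat.State.rate_eq_zero hA, if_neg]
      exact fun h => hA (h.imp id fun ⟨a, b, _, h⟩ => ⟨a, b, h⟩)
  · intro i hi τ hr ha hx hP x
    rw [hE'.reg3] at hi
    obtain ⟨a, b, rfl⟩ := exists_index hi
    have hEτ : Env G dem c p q L M τ := hE'.congr
      (fun r h1 h2 => hr r (by omega) (by simp [regs])) (fun a h1 => ha a (by simp [arrs]; omega))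
    have hSτ : Represents τ s := hS'.congr fun a h1 h2 => ha a (by simp [arrs]; omega)
    have hcond : (cell 2 (reg 7) * apart 7).value τ =
        if dem a b ∧ s.lab a ≠ s.lab b then 1 else 0 := by
      rw [value_mul, value_apart hEτ.reg2 hx hSτ.lab, value_cell, value_reg, hx, hEτ.arr2]
      by_cases h1 : dem a b <;> by_cases h2 : s.lab a = s.lab b <;> simp [h1, h2]
    have hstep : ∀ x : Fin n, (∃ a' b' : Fin n, (a' : ℕ) * n + b' < a * n + b + 1 ∧
        dem a' b' ∧ s.lab a' ≠ s.lab b' ∧ (x = s.lab a' ∨ x = s.lab b')) ↔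
        (∃ a' b' : Fin n, (a' : ℕ) * n + b' < a * n + b ∧
        dem a' b' ∧ s.lab a' ≠ s.lab b' ∧ (x = s.lab a' ∨ x = s.lab b')) ∨
        (dem a b ∧ s.lab a ≠ s.lab b) ∧ (x = s.lab a ∨ x = s.lab b) := by
      intro x
      constructor
      · rintro ⟨a', b', h1, h2, h3, h4⟩
        rcases Nat.lt_succ_iff_lt_or_eq.1 h1 with h1 | h1
        · exact Or.inl ⟨a', b', h1, h2, h3, h4⟩
        · obtain ⟨rfl, rfl⟩ := index_inj.1 h1
          exact Or.inr ⟨⟨h2, h3⟩, h4⟩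
      · rintro (⟨a', b', h1, h2⟩ | ⟨⟨h2, h3⟩, h4⟩)
        · exact ⟨a', b', by omega, h2⟩
        · exact ⟨a, b, by omega, h2, h3, h4⟩
    simp only [Cmd.den, hcond]
    by_cases hd : dem a b ∧ s.lab a ≠ s.lab b
    · have hcl : (colLab 7).value (τ.setCell 8 (s.lab a) 1) = s.lab b := by
        rw [value_colLab (σ := τ.setCell 8 (s.lab a) 1) (i := 7) (a := a) (b := b) hEτ.reg2 hx]
        simpa using hSτ.lab b
      rw [if_pos hd, if_neg one_ne_zero, value_rowLab hEτ.reg2 hx, hSτ.lab]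
      simp only [value_ofNat, Store.setCell_arr, hcl, true_and, Fin.val_inj, hP, hstep, hd]
      by_cases h3 : x = s.lab b <;> by_cases h4 : x = s.lab a <;> simp [h3, h4, hd.2]
    · simp only [hd, if_false, if_true, hP, hstep, false_and, or_false]

/-- The pairs that are separated by an inactive moat are added to those in array `9`. -/
theorem separate_spec {R : Fin n → Fin n → Prop} (hE : Env G dem c p q L M σ)
    (hS : Represents σ s) (h8 : ∀ x : Fin n, σ.arr 8 x = s.rate dem x) (h9 : IsMatrix σ 9 R) :
    IsMatrix (separate.den σ) 9 fun x y =>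
      R x y ∨ s.lab x ≠ s.lab y ∧ ¬ (s.Active dem (s.lab x) ∧ s.Active dem (s.lab y)) := by
  intro x y
  unfold separate
  rw [Cmd.for_map (fun i => if ∃ x y : Fin n, i = x * n + y ∧ s.lab x ≠ s.lab y ∧
    ¬ (s.Active dem (s.lab x) ∧ s.Active dem (s.lab y)) then 1 else σ.arr 9 i) rfl
    (by simp [arrs]), if_pos (by rw [hE.reg3]; exact index_lt x y)]
  · simp only [index_inj, h9 x y]
    by_cases h1 : s.lab x ≠ s.lab y ∧ ¬ (s.Active dem (s.lab x) ∧ s.Active dem (s.lab y))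
    · rw [if_pos ⟨x, y, ⟨rfl, rfl⟩, h1⟩, if_pos (Or.inr h1)]
    · rw [if_neg]
      · simp only [h1, or_false]
      · rintro ⟨x', y', ⟨rfl, rfl⟩, h2⟩
        exact h1 h2
  · intro i hi τ hr ha hx h5 j
    rw [hE.reg3] at hi
    obtain ⟨a, b, rfl⟩ := exists_index hi
    have hEτ : Env G dem c p q L M τ := hE.congr
      (fun r h1 h2 => hr r (by omega)) (fun a h1 => ha a (by omega))
    have hSτ : Represents τ s := hS.congr fun a h1 h2 => ha a (by omega)
    have hex : (∃ x y : Fin n, (a : ℕ) * n + b = x * n + y ∧ s.lab x ≠ s.lab y ∧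
        ¬ (s.Active dem (s.lab x) ∧ s.Active dem (s.lab y))) ↔
        s.lab a ≠ s.lab b ∧ ¬ (s.Active dem (s.lab a) ∧ s.Active dem (s.lab b)) := by
      constructor
      · rintro ⟨x, y, h1, h2⟩
        obtain ⟨rfl, rfl⟩ := index_inj.1 h1
        exact h2
      · exact fun h => ⟨a, b, rfl, h⟩
    have hcond : (apart 7 * (1 - cell 8 (rowLab 7) * cell 8 (colLab 7))).value τ =
        if s.lab a ≠ s.lab b ∧ ¬ (s.Active dem (s.lab a) ∧ s.Active dem (s.lab b))
          then 1 else 0 := by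
      simp only [value_mul, value_sub, value_cell, value_apart hEτ.reg2 hx hSτ.lab, value_ofNat,
        value_rowLab hEτ.reg2 hx, value_colLab hEτ.reg2 hx, hSτ.lab, ha 8 (by decide), h8,
        Moat.State.rate]
      by_cases h1 : s.lab a = s.lab b
      · simp [h1]
      · by_cases h2 : s.Active dem (s.lab a) <;> by_cases h3 : s.Active dem (s.lab b) <;>
          simp [h1, h2, h3]
    simp only [Cmd.den, hcond, hex]
    split_ifs with h1 h2 h2 h3
    all_goals first | rfl | skip
    all_goals simp_all

/-- The pair `a, b` is an edge that gets tight or, if `a = b`, a potential that gets used up. -/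
def Candidate (G : SimpleGraph (Fin n)) (dem : Fin n → Fin n → Prop) (s : Moat.State (Fin n))
    (a b : Fin n) : Prop :=
  a = b ∧ 0 < s.pot a ∨ G.Adj a b ∧ s.lab a ≠ s.lab b ∧
    0 < s.rate dem (s.lab a) + s.rate dem (s.lab b)

/-- The growth until the event of a candidate, in half units. For the speeds `r = 1` and `r = 2`
the number `3 - r` is `2 / r`. -/
noncomputable def gain (dem : Fin n → Fin n → Prop) (s : Moat.State (Fin n)) (a b : Fin n) : ℕ :=
  if a = b then 2 * s.pot a
  else s.slack a b * (3 - (s.rate dem (s.lab a) + s.rate dem (s.lab b)))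

/-- The search finds a candidate with the smallest growth, if there is a candidate. Otherwise it
returns the growth `0` and a vertex paired with itself, which stands for an idle step. -/
theorem findEvent_spec (hE : Env G dem c p q L M σ) (hS : Represents σ s)
    (h8 : ∀ x : Fin n, σ.arr 8 x = s.rate dem x) (hM : 0 < M)
    (hslack : ∀ x y, 2 * s.slack x y ≤ M) (hpot : ∀ x, 2 * s.pot x ≤ M) :
    ((∀ a b, ¬ Candidate G dem s a b) ∧ (findEvent.den σ).reg 11 = 0 ∧
      (findEvent.den σ).reg 13 = 0 ∧ (findEvent.den σ).reg 14 = 0) ∨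
    ∃ u v, Candidate G dem s u v ∧ (findEvent.den σ).reg 11 = gain dem s u v ∧
      (findEvent.den σ).reg 13 = u ∧ (findEvent.den σ).reg 14 = v ∧
      ∀ a b, Candidate G dem s a b → gain dem s u v ≤ gain dem s a b := by
  unfold findEvent
  set body := branch ((row 7).eq (col 7))
      (assign 15 (cell 7 (row 7)) ;; assignC 16 (2 * cell 7 (row 7)))
      (assignC 15 (cell 1 (reg 7) * (apart 7 * speed 7)) ;;
        assignC 16 (cell 6 (reg 7) * (3 - speed 7))) with hbody
  set choose := branch (reg 15 * (1 - reg 12 * (1 - (reg 16).lt (reg 11))))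
      (assign 11 (reg 16) ;; assign 12 1 ;; assign 13 (row 7) ;; assign 14 (col 7)) skip
    with hchoose
  have hbr : body.regs = [15, 16, 15, 16] := rfl
  have hba : body.arrs = [] := rfl
  have hcr : choose.regs = [11, 12, 13, 14] := rfl
  have hca : choose.arrs = [] := rfl
  simp only [den_seq]
  set σ' := (assign 14 0).den ((assign 13 0).den ((assign 12 0).den ((assign 11 0).den σ))) with hσ'
  have hE' : Env G dem c p q L M σ' := by
    rw [hσ']
    exact (((hE.den _ (by decide) (by decide)).den _ (by decide) (by decide)).den _
      (by decide) (by decide)).den _ (by decide) (by decide)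
  have hS' : Represents σ' s := hS.congr fun _ _ _ => rfl
  have h8' : ∀ x : Fin n, σ'.arr 8 x = s.rate dem x := h8
  have key := Cmd.for_rule (σ := σ') (x := 7) (b := 3) (p := body ;; choose)
    (fun i τ => ((∀ a b : Fin n, (a : ℕ) * n + b < i → ¬ Candidate G dem s a b) ∧ τ.reg 11 = 0 ∧
      τ.reg 12 = 0 ∧ τ.reg 13 = 0 ∧ τ.reg 14 = 0) ∨
    ∃ u v : Fin n, Candidate G dem s u v ∧ τ.reg 11 = gain dem s u v ∧ τ.reg 12 = 1 ∧
      τ.reg 13 = u ∧ τ.reg 14 = v ∧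
      ∀ a b : Fin n, (a : ℕ) * n + b < i → Candidate G dem s a b →
        gain dem s u v ≤ gain dem s a b)
    (fun i τ v h => by simpa using h) ?_ ?_
  · rw [hE'.reg3] at key
    rcases key with ⟨h1, h2, -, h3⟩ | ⟨u, v, h1, h2, -, h3, h4, h5⟩
    · exact Or.inl ⟨fun a b => h1 a b (index_lt a b), h2, h3⟩
    · exact Or.inr ⟨u, v, h1, h2, h3, h4, fun a b => h5 a b (index_lt a b)⟩
  · left
    simp [hσ', den]
  · intro i hi τ hr ha hx hP
    rw [hE'.reg3] at hi
    obtain ⟨a, b, rfl⟩ := exists_index hi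
    have hEτ : Env G dem c p q L M τ := hE'.congr
      (fun r h1 h2 => hr r (by omega) (by simp [regs, hbr, hcr]; omega))
      (fun a h1 => ha a (by simp [arrs, hba, hca]))
    have hSτ : Represents τ s := hS'.congr fun a h1 h2 => ha a (by simp [arrs, hba, hca])
    have h8τ : ∀ x : Fin n, τ.arr 8 x = s.rate dem x := by
      rw [ha 8 (by simp [arrs, hba, hca])]; exact h8'
    rw [den_seq]
    set τ' := body.den τ with hτ'
    have hr' : ∀ r, r ≠ 15 → r ≠ 16 → τ'.reg r = τ.reg r := fun r h1 h2 =>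
      den_reg _ _ (by rw [hbr]; simp [h1, h2])
    have hfacts : (τ'.reg 15 ≠ 0 ↔ Candidate G dem s a b) ∧
        (Candidate G dem s a b → τ'.reg 16 = gain dem s a b) := by
      have hrow := value_row hEτ.reg2 hx
      have hcol := value_col hEτ.reg2 hx
      rw [hτ', hbody]
      simp only [Cmd.den, value_eq, hrow, hcol, Fin.val_inj]
      by_cases hab : a = b
      · subst hab
        have hrow' := value_row (σ := τ.setReg 15 (s.pot a)) (i := 7) (a := a) (b := a)
          (by simpa using hEτ.reg2) (by simpa using hx)
        simp [Candidate, gain, hrow, hrow', hSτ.pot, hEτ.reg4, hpot, Nat.pos_iff_ne_zero]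
      · have hsp := value_speed hEτ.reg2 hx hSτ.lab h8τ
        have hsp' := value_speed
          (σ := τ.setReg 15 (min ((cell 1 (reg 7) * (apart 7 * speed 7)).value τ) (τ.reg 4)))
          (i := 7) (a := a) (b := b) (by simpa using hEτ.reg2) (by simpa using hx) hSτ.lab h8τ
        have hap := value_apart hEτ.reg2 hx hSτ.lab
        simp only [hab, if_false, if_true, value_mul, value_cell, value_reg, value_sub, value_ofNat,
          Store.setReg_reg, Store.setReg_arr, show (15 : ℕ) ≠ 16 by decide,
          show (4 : ℕ) ≠ 15 by decide, show (7 : ℕ) ≠ 15 by decide, hEτ.reg4, hx, hSτ.slack,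
          hEτ.arr1 a b, hap, hsp] at hsp' ⊢
        rw [hsp']
        simp only [Candidate, gain, hab, false_and, false_or, if_false]
        have hle1 := s.rate_le_one dem (s.lab a)
        have hle2 := s.rate_le_one dem (s.lab b)
        have hsl := hslack a b
        constructor
        · by_cases h1 : G.Adj a b
          · by_cases h2 : s.lab a = s.lab b
            · simp [h2]
            · simp only [h1, h2, if_true, if_false, one_mul, true_and, ne_eq, not_false_eq_true]
              omega
          · simp [h1]
        · rintro ⟨-, -, h3⟩
          refine min_eq_left (le_trans ?_ hsl)
          rw [mul_comm 2]
          exact Nat.mul_le_mul_left _ (by omega)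
    have hcond : (reg 15 * (1 - reg 12 * (1 - (reg 16).lt (reg 11)))).value τ' ≠ 0 ↔
        Candidate G dem s a b ∧ (τ.reg 12 = 0 ∨ τ'.reg 16 < τ.reg 11) := by
      rw [← hfacts.1, ← hr' 12 (by decide) (by decide), ← hr' 11 (by decide) (by decide)]
      simp only [value_mul, value_sub, value_reg, value_ofNat, value_lt, Nat.mul_ne_zero_iff]
      refine and_congr Iff.rfl ?_
      split_ifs with h1
      · simp [h1]
      · simp only [h1, or_false, if_false]; omega
    have hE2 : τ'.reg 2 = n := by rw [hr' 2 (by decide) (by decide)]; exact hEτ.reg2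
    have hx' : τ'.reg 7 = a * n + b := by rw [hr' 7 (by decide) (by decide)]; exact hx
    by_cases hC : (reg 15 * (1 - reg 12 * (1 - (reg 16).lt (reg 11)))).value τ' = 0
    · have hden : choose.den τ' = τ' := by
        rw [hchoose]; simp only [Cmd.den, hC, if_true]
      rw [hden]
      rw [← not_iff_not, not_not] at hcond
      have hC' := hcond.1 hC
      rw [hr' 11 (by decide) (by decide), hr' 12 (by decide) (by decide),
        hr' 13 (by decide) (by decide), hr' 14 (by decide) (by decide)]
      rcases hP with ⟨h1, h2, h3, h4⟩ | ⟨u, v, h1, h2, h3, h4, h5, h6⟩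
      · refine Or.inl ⟨fun a' b' hlt hc => ?_, h2, h3, h4⟩
        rcases Nat.lt_succ_iff_lt_or_eq.1 hlt with h5 | h5
        · exact h1 a' b' h5 hc
        · obtain ⟨rfl, rfl⟩ := index_inj.1 h5
          exact hC' ⟨hc, Or.inl h3⟩
      · refine Or.inr ⟨u, v, h1, h2, h3, h4, h5, fun a' b' hlt hc => ?_⟩
        rcases Nat.lt_succ_iff_lt_or_eq.1 hlt with h7 | h7
        · exact h6 a' b' h7 hc
        · obtain ⟨rfl, rfl⟩ := index_inj.1 h7
          rw [← hfacts.2 hc, ← h2]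
          by_contra hlt'
          exact hC' ⟨hc, Or.inr (by omega)⟩
    · obtain ⟨hc, hC'⟩ := hcond.1 hC
      have hg := hfacts.2 hc
      have hden : (choose.den τ').reg 11 = gain dem s a b ∧ (choose.den τ').reg 12 = 1 ∧
          (choose.den τ').reg 13 = a ∧ (choose.den τ').reg 14 = b := by
        rw [hchoose]; simp only [Cmd.den, hC, if_false]
        rw [value_row (a := a) (b := b) (by simpa using hE2) (by simpa using hx'),
          value_col (a := a) (b := b) (by simpa using hE2) (by simpa using hx')]
        simp [hg]
      refine Or.inr ⟨a, b, hc, hden.1, hden.2.1, hden.2.2.1, hden.2.2.2, fun a' b' hlt hc' => ?_⟩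
      rcases Nat.lt_succ_iff_lt_or_eq.1 hlt with h7 | h7
      · rcases hP with ⟨h1, -⟩ | ⟨u, v, h1, h2, h3, h4, h5, h6⟩
        · exact absurd hc' (h1 a' b' h7)
        · have := h6 a' b' h7 hc'
          rw [← hg]
          omega
      · obtain ⟨rfl, rfl⟩ := index_inj.1 h7
        exact le_rfl

end RAM

namespace RAM

open Term Cmd Finset
open scoped Classical

variable {n : ℕ} {σ τ : Store} {G : SimpleGraph (Fin n)} {dem : Fin n → Fin n → Prop}
  {c : Fin n → Fin n → ℕ} {p q L M : ℕ} {s : Moat.State (Fin n)}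

theorem update_spec (hE : Env G dem c p q L M σ) (hS : Represents σ s)
    (h8 : ∀ x : Fin n, σ.arr 8 x = s.rate dem x)
    (hslack : ∀ x y, 2 * s.slack x y ≤ M) (hpot : ∀ x, 2 * s.pot x ≤ M) :
    (∀ x y : Fin n, (update.den σ).arr 6 (x * n + y) =
      2 * s.slack x y - (s.rate dem (s.lab x) + s.rate dem (s.lab y)) * σ.reg 11) ∧
    ∀ x : Fin n, (update.den σ).arr 7 x = 2 * s.pot x - s.rate dem x * σ.reg 11 := by
  unfold update
  rw [den_seq]
  set σ' := (Cmd.for 7 3 (storeC 6 (reg 7) (2 * cell 6 (reg 7) - speed 7 * reg 11))).den σ with hσ'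
  have hr' : ∀ r, r ≠ 7 → σ'.reg r = σ.reg r := fun r h => den_reg _ _ (by simpa [regs] using h)
  have ha' : ∀ a, a ≠ 6 → σ'.arr a = σ.arr a := fun a h => den_arr _ _ (by simpa [arrs] using h)
  constructor
  · intro x y
    rw [den_arr _ _ (by simp [arrs]), hσ', Cmd.for_map (a := 6)
      (fun i => if h : ∃ x y : Fin n, i = x * n + y then 2 * s.slack h.choose h.choose_spec.choose -
        (s.rate dem (s.lab h.choose) + s.rate dem (s.lab h.choose_spec.choose)) * σ.reg 11 else 0)
      rfl (by simp [arrs]), if_pos (by rw [hE.reg3]; exact index_lt x y)]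
    · have hex : ∃ x' y' : Fin n, (x : ℕ) * n + y = x' * n + y' := ⟨x, y, rfl⟩
      obtain ⟨h1, h2⟩ := index_inj.1 hex.choose_spec.choose_spec
      rw [dif_pos hex, ← h2, ← h1]
    · intro i hi τ hr ha hx h6 j
      rw [hE.reg3] at hi
      have hex := exists_index hi
      have hi' := hex.choose_spec.choose_spec
      set x' := hex.choose
      set y' := hex.choose_spec.choose
      have hEτ : Env G dem c p q L M τ := hE.congr
        (fun r h1 h2 => hr r (by omega)) (fun a h1 => ha a (by omega))
      have hlab : ∀ x : Fin n, τ.arr 5 x = s.lab x := by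
        rw [ha 5 (by decide)]; exact hS.lab
      have hsp := value_speed (dem := dem) hEτ.reg2 (hx.trans hi') hlab
        (by rw [ha 8 (by decide)]; exact h8)
      have hval : τ.arr 6 i = s.slack x' y' := by rw [h6 i le_rfl, hi', hS.slack]
      simp only [Cmd.den, Store.setCell_arr, value_sub, value_mul, value_ofNat, value_cell,
        value_reg, hsp, hx, hval, hEτ.reg4, hr 11 (by decide), true_and]
      rw [dif_pos hex, min_eq_left ((Nat.sub_le _ _).trans (hslack x' y'))]
  · intro x
    rw [Cmd.for_map (a := 7) (fun i => min (2 * σ.arr 7 i - σ.arr 8 i * σ.reg 11) M) rfl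
      (by simp [arrs]), if_pos (by rw [hr' 2 (by decide), hE.reg2]; exact x.isLt), hS.pot, h8,
      min_eq_left ((Nat.sub_le _ _).trans (hpot x))]
    intro i hi τ hr ha hx h7 j
    have hval : τ.arr 7 i = σ.arr 7 i := by rw [h7 i le_rfl, ha' 7 (by decide)]
    simp only [Cmd.den, Store.setCell_arr, value_sub, value_mul, value_ofNat, value_cell,
        value_reg, hx, hval, hr 4 (by decide), hr' 4 (by decide), hE.reg4, hr 11 (by decide),
        hr' 11 (by decide), ha 8 (by decide), ha' 8 (by decide), true_and]

/-- The labels, the potentials and the forest after the event. If two moats are joined, the sum of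
their potentials must not exceed the bound `M`. -/
theorem join_spec {u v : Fin n} {f : Fin n → ℕ} {F : SimpleGraph (Fin n)} {lab : Fin n → Fin n}
    (h2 : σ.reg 2 = n) (h4 : σ.reg 4 = M) (hlab : ∀ x : Fin n, σ.arr 5 x = lab x)
    (hf : ∀ x : Fin n, σ.arr 7 x = f x) (hF : IsMatrix σ 4 F.Adj) (hu : σ.reg 13 = u)
    (hv : σ.reg 14 = v) (hM : lab u ≠ lab v → f (lab u) + f (lab v) ≤ M) :
    (∀ w : Fin n, (join.den σ).arr 5 w = (if lab w = lab v then lab u else lab w : Fin n)) ∧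
    (∀ x : Fin n, (join.den σ).arr 7 x = if lab u = lab v then f x
      else if x = lab u then f (lab u) + f (lab v) else if x = lab v then 0 else f x) ∧
    IsMatrix (join.den σ) 4 fun x y => F.Adj x y ∨
      lab u ≠ lab v ∧ (x = u ∧ y = v ∨ x = v ∧ y = u) := by
  unfold join
  by_cases hne : lab u = lab v
  · have hden : ∀ a, ((assign 8 (cell 5 (reg 13)) ;; assign 9 (cell 5 (reg 14)) ;;
        branch ((reg 8).eq (reg 9)) skip (store 4 (reg 13 * reg 2 + reg 14) 1 ;;
        store 4 (reg 14 * reg 2 + reg 13) 1 ;; storeC 7 (reg 8) (cell 7 (reg 8) + cell 7 (reg 9)) ;;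
        store 7 (reg 9) 0 ;; relabel)).den σ).arr a = σ.arr a := by
      intro a
      simp [den, hu, hv, hlab, hne]
    simp only [hden, IsMatrix, hlab, hf, hne]
    refine ⟨fun w => ?_, fun x => ?_, fun x y => ?_⟩
    · split_ifs with h <;> simp_all
    · simp
    · simpa using hF x y
  · set σ₁ := (assign 9 (cell 5 (reg 14))).den ((assign 8 (cell 5 (reg 13))).den σ) with hσ₁
    set σ₂ := (store 7 (reg 9) 0).den ((storeC 7 (reg 8) (cell 7 (reg 8) + cell 7 (reg 9))).den
      ((store 4 (reg 14 * reg 2 + reg 13) 1).den ((store 4 (reg 13 * reg 2 + reg 14) 1).den σ₁)))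
      with hσ₂
    have hr8 : σ₁.reg 8 = lab u := by simp [hσ₁, den, hu, hlab]
    have hr9 : σ₁.reg 9 = lab v := by simp [hσ₁, den, hv, hlab]
    have hden : ((assign 8 (cell 5 (reg 13)) ;; assign 9 (cell 5 (reg 14)) ;;
        branch ((reg 8).eq (reg 9)) skip (store 4 (reg 13 * reg 2 + reg 14) 1 ;;
        store 4 (reg 14 * reg 2 + reg 13) 1 ;; storeC 7 (reg 8) (cell 7 (reg 8) + cell 7 (reg 9)) ;;
        store 7 (reg 9) 0 ;; relabel)).den σ) = relabel.den σ₂ := by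
      rw [den_seq, den_seq, ← hσ₁, den]
      have h0 : ((reg 8).eq (reg 9)).value σ₁ = 0 := by simp [hr8, hr9, Fin.val_inj, hne]
      rw [if_pos h0]
      rfl
    have hregs : ∀ r, σ₂.reg r = σ₁.reg r := fun r => rfl
    have hrs : ∀ r, r ≠ 8 → r ≠ 9 → σ₁.reg r = σ.reg r := by
      intro r h8 h9
      simp [hσ₁, den, h8, h9]
    have harr : ∀ a, a ≠ 5 → (relabel.den σ₂).arr a = σ₂.arr a := fun a ha =>
      den_arr _ _ (by simpa [relabel, arrs] using ha)
    rw [hden]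
    refine ⟨fun w => ?_, fun x => ?_, fun x y => ?_⟩
    · have h5 : σ₂.arr 5 = σ.arr 5 := by
        funext j; simp [hσ₂, hσ₁, den]
      rw [relabel_spec, hregs, hregs, hregs, hr8, hr9, hrs 2 (by decide) (by decide), h2,
        if_pos w.isLt, h5, hlab]
      simp only [Fin.val_inj]
      split_ifs <;> rfl
    · rw [harr 7 (by decide)]
      have h7 : σ₁.arr 7 = σ.arr 7 := rfl
      have hr4 : σ₁.reg 4 = M := (hrs 4 (by decide) (by decide)).trans h4
      simp only [hσ₂, den, Store.setCell_arr, value_reg, Store.setCell_reg, value_add, value_cell,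
        hr8, hr9, value_ofNat, hr4, h7, true_and, hne, if_false, Fin.val_inj,
        show (7 : ℕ) ≠ 4 by decide, false_and, hf, min_eq_left (hM hne)]
      by_cases h1 : x = lab v
      · have : x ≠ lab u := fun h3 => hne (h3.symm.trans h1)
        simp [h1, Ne.symm hne]
      · simp [h1]
    · rw [harr 4 (by decide)]
      have h13 : σ₁.reg 13 = u := (hrs 13 (by decide) (by decide)).trans hu
      have h14 : σ₁.reg 14 = v := (hrs 14 (by decide) (by decide)).trans hv
      have hr2 : σ₁.reg 2 = n := (hrs 2 (by decide) (by decide)).trans h2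
      have h4' : σ₁.arr 4 = σ.arr 4 := rfl
      simp only [hσ₂, den, Store.setCell_arr, value_reg, Store.setCell_reg, value_add, value_cell,
        value_mul, value_ofNat, h13, h14, hr2, h4', true_and, hne, not_false_eq_true, ne_eq,
        show (4 : ℕ) ≠ 7 by decide, false_and, if_false, index_inj, hF x y]
      by_cases h1 : x = u ∧ y = v <;> by_cases h2 : x = v ∧ y = u <;> simp [h1, h2]

/-- The state after a step of size `Δ` that ends with the event at the pair `u, v`. -/
noncomputable def nextState (dem : Fin n → Fin n → Prop) (s : Moat.State (Fin n)) (Δ : ℕ)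
    (u v : Fin n) : Moat.State (Fin n) where
  lab w := if s.lab w = s.lab v then s.lab u else s.lab w
  slack x y := 2 * s.slack x y - (s.rate dem (s.lab x) + s.rate dem (s.lab y)) * Δ
  pot x := if s.lab u = s.lab v then 2 * s.pot x - s.rate dem x * Δ else if x = s.lab u then
      (2 * s.pot (s.lab u) - s.rate dem (s.lab u) * Δ) +
        (2 * s.pot (s.lab v) - s.rate dem (s.lab v) * Δ) else if x = s.lab v then 0 else
        2 * s.pot x - s.rate dem x * Δ
  forest :=
    { Adj := fun x y => s.forest.Adj x y ∨ s.lab u ≠ s.lab v ∧ (x = u ∧ y = v ∨ x = v ∧ y = u)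
      symm := ⟨fun x y h => h.imp (fun h => h.symm) fun h => ⟨h.1, h.2.symm.imp And.symm And.symm⟩⟩
      loopless := ⟨by
        rintro x (h | ⟨h1, ⟨rfl, h⟩ | ⟨rfl, h⟩⟩)
        · exact h.ne rfl
        · exact h1 (by rw [h])
        · exact h1 (by rw [h])⟩ }

/-- Growth until the first event is a step of the process. -/
theorem step_nextState {Δ : ℕ} {u v : Fin n}
    (hmin : ∀ a b, Candidate G dem s a b → Δ ≤ gain dem s a b)
    (hcase : Candidate G dem s u v ∧ Δ = gain dem s u v ∨
      u = v ∧ Δ = 0 ∧ ∀ a b, ¬ Candidate G dem s a b) :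
    Moat.Step G dem s (nextState dem s Δ u v) Δ u v := by
  have hcand : ∀ x y, G.Adj x y → s.lab x ≠ s.lab y →
      (s.rate dem (s.lab x) + s.rate dem (s.lab y)) * Δ ≤ 2 * s.slack x y := by
    intro x y hxy hne
    have h1 := s.rate_le_one dem (s.lab x)
    have h2 := s.rate_le_one dem (s.lab y)
    set r := s.rate dem (s.lab x) + s.rate dem (s.lab y) with hr
    rcases Nat.eq_zero_or_pos r with h0 | h0
    · rw [h0, zero_mul]; exact Nat.zero_le _
    · have h3 := hmin x y (Or.inr ⟨hxy, hne, h0⟩)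
      rw [gain, if_neg hxy.ne, ← hr] at h3
      obtain h4 | h4 : r = 1 ∨ r = 2 := by omega
      all_goals rw [h4] at h3 ⊢; omega
  refine ⟨hcand, fun a ha => ?_, fun _ _ => rfl, fun _ => ?_, fun _ => ?_, fun _ _ => Iff.rfl, ?_⟩
  rotate_left
  · simp only [nextState]; split_ifs <;> rfl
  · simp only [nextState]; split_ifs <;> rfl
  rotate_left
  · have h3 := hmin a a (Or.inl ⟨rfl, ha⟩)
    rwa [gain, if_pos rfl] at h3
  · rcases hcase with ⟨⟨rfl, h1⟩ | ⟨h1, h2, h3⟩, hΔ⟩ | ⟨huv, hΔ, hno⟩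
    · rw [gain, if_pos rfl] at hΔ
      exact Or.inr (Or.inl ⟨rfl, h1, hΔ⟩)
    · refine Or.inl ⟨h2, h1, h3, ?_⟩
      have h4 := s.rate_le_one dem (s.lab u)
      have h5 := s.rate_le_one dem (s.lab v)
      rw [gain, if_neg h1.ne] at hΔ
      set r := s.rate dem (s.lab u) + s.rate dem (s.lab v)
      obtain h6 | h6 : r = 1 ∨ r = 2 := by omega
      all_goals rw [h6] at hΔ ⊢; omega
    · refine Or.inr (Or.inr ⟨huv, hΔ, fun a => ?_, fun x y hxy hne => ?_⟩)
      · by_contra h1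
        exact hno a a (Or.inl ⟨rfl, Nat.pos_of_ne_zero h1⟩)
      · by_contra h1
        exact hno x y (Or.inr ⟨hxy, hne, Nat.pos_of_ne_zero h1⟩)

/-- One round of the main loop is a step of the process, and it adds the pairs that are separated by
an inactive moat to those in array `9`. -/
theorem growStep_spec {R : Fin n → Fin n → Prop} (hn : 0 < n) (hE : Env G dem c p q L M σ)
    (hS : Represents σ s) (h9 : IsMatrix σ 9 R) (hM : 0 < M)
    (hslack : ∀ x y, 2 * s.slack x y ≤ M) (hpot : 2 * ∑ x, s.pot x ≤ M) :
    ∃ (s' : Moat.State (Fin n)) (Δ : ℕ) (u v : Fin n), Moat.Step G dem s s' Δ u v ∧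
      Represents (growStep.den σ) s' ∧ IsMatrix (growStep.den σ) 9 fun x y =>
        R x y ∨ s.lab x ≠ s.lab y ∧ ¬ (s.Active dem (s.lab x) ∧ s.Active dem (s.lab y)) := by
  have hpot' : ∀ x, 2 * s.pot x ≤ M := fun x =>
    (Nat.mul_le_mul_left 2 (single_le_sum (fun _ _ => Nat.zero_le _) (mem_univ x))).trans hpot
  unfold growStep
  simp only [den_seq]
  obtain ⟨σ₁, hσ₁⟩ : ∃ τ, τ = findActive.den σ := ⟨_, rfl⟩
  rw [← hσ₁]
  have hE₁ : Env G dem c p q L M σ₁ := hσ₁ ▸ hE.den _ (by decide) (by decide)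
  have hS₁ : Represents σ₁ s := hS.congr fun a h1 h2 => by
    rw [hσ₁, den_arr _ _ (by simp [findActive, arrs]; omega)]
  have h8₁ := hσ₁ ▸ findActive_spec hE hS
  have h9₁ : IsMatrix σ₁ 9 R := fun x y => by
    rw [hσ₁, den_arr _ _ (by simp [findActive, arrs])]; exact h9 x y
  obtain ⟨σ₂, hσ₂⟩ : ∃ τ, τ = separate.den σ₁ := ⟨_, rfl⟩
  rw [← hσ₂]
  have hE₂ : Env G dem c p q L M σ₂ := hσ₂ ▸ hE₁.den _ (by decide) (by decide)
  have hS₂ : Represents σ₂ s := hS₁.congr fun a h1 h2 => by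
    rw [hσ₂, den_arr _ _ (by simp [separate, arrs]; omega)]
  have h8₂ : ∀ x : Fin n, σ₂.arr 8 x = s.rate dem x := fun x => by
    rw [hσ₂, den_arr _ _ (by simp [separate, arrs])]; exact h8₁ x
  have h9₂ := separate_spec hE₁ hS₁ h8₁ h9₁
  rw [← hσ₂] at h9₂
  obtain ⟨σ₃, hσ₃⟩ : ∃ τ, τ = findEvent.den σ₂ := ⟨_, rfl⟩
  rw [← hσ₃]
  have hE₃ : Env G dem c p q L M σ₃ := hσ₃ ▸ hE₂.den _ (by decide) (by decide)
  have harr₃ : ∀ a, σ₃.arr a = σ₂.arr a := fun a => by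
    rw [hσ₃, den_arr _ _ (by simp [findEvent, arrs])]
  have hS₃ : Represents σ₃ s := hS₂.congr fun a h1 h2 => harr₃ a
  have h8₃ : ∀ x : Fin n, σ₃.arr 8 x = s.rate dem x := by rw [harr₃]; exact h8₂
  have hev := findEvent_spec hE₂ hS₂ h8₂ hM hslack hpot'
  rw [← hσ₃] at hev
  -- in the absence of an event, the program acts as if it were a void one at the vertex `0`
  obtain ⟨u, v, hu, hv, hmin, hcase⟩ : ∃ u v : Fin n, σ₃.reg 13 = u ∧ σ₃.reg 14 = v ∧
      (∀ a b, Candidate G dem s a b → σ₃.reg 11 ≤ gain dem s a b) ∧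
      (Candidate G dem s u v ∧ σ₃.reg 11 = gain dem s u v ∨
        u = v ∧ σ₃.reg 11 = 0 ∧ ∀ a b, ¬ Candidate G dem s a b) := by
    rcases hev with ⟨h1, h2, h3, h4⟩ | ⟨u, v, h1, h2, h3, h4, h5⟩
    · exact ⟨⟨0, hn⟩, ⟨0, hn⟩, h3, h4, fun a b h => absurd h (h1 a b), Or.inr ⟨rfl, h2, h1⟩⟩
    · exact ⟨u, v, h3, h4, fun a b h => h2 ▸ h5 a b h, Or.inl ⟨h1, h2⟩⟩
  obtain ⟨Δ, hΔ⟩ : ∃ d, d = σ₃.reg 11 := ⟨_, rfl⟩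
  rw [← hΔ] at hmin hcase
  obtain ⟨h6₄, h7₄⟩ := update_spec hE₃ hS₃ h8₃ hslack hpot'
  simp only [← hΔ] at h6₄ h7₄
  obtain ⟨σ₄, hσ₄⟩ : ∃ τ, τ = update.den σ₃ := ⟨_, rfl⟩
  rw [← hσ₄] at h6₄ h7₄ ⊢
  have hE₄ : Env G dem c p q L M σ₄ := hσ₄ ▸ hE₃.den _ (by decide) (by decide)
  have hr₄ : ∀ r, r ≠ 7 → σ₄.reg r = σ₃.reg r := fun r hr => by
    rw [hσ₄, den_reg _ _ (by simpa [update, regs] using hr)]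
  have ha₄ : ∀ a, a ≠ 6 → a ≠ 7 → σ₄.arr a = σ₃.arr a := fun a h1 h2 => by
    rw [hσ₄, den_arr _ _ (by simpa [update, arrs] using ⟨h1, h2⟩)]
  obtain ⟨h5₅, h7₅, h4₅⟩ := join_spec (σ := σ₄) (u := u) (v := v) (lab := s.lab)
    (f := fun x => 2 * s.pot x - s.rate dem x * Δ) (F := s.forest) hE₄.reg2 hE₄.reg4
    (by rw [ha₄ 5 (by decide) (by decide)]; exact hS₃.lab) h7₄
    (fun x y => by rw [ha₄ 4 (by decide) (by decide)]; exact hS₃.forest x y)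
    ((hr₄ 13 (by decide)).trans hu) ((hr₄ 14 (by decide)).trans hv) (fun hne => by
      have h1 : s.pot (s.lab u) + s.pot (s.lab v) ≤ ∑ x, s.pot x := by
        rw [← sum_pair hne]
        exact sum_le_sum_of_subset (subset_univ _)
      omega)
  obtain ⟨σ₅, hσ₅⟩ : ∃ τ, τ = join.den σ₄ := ⟨_, rfl⟩
  rw [← hσ₅] at h5₅ h7₅ h4₅ ⊢
  have ha₅ : ∀ a, a ≠ 4 → a ≠ 7 → a ≠ 5 → σ₅.arr a = σ₄.arr a := fun a h1 h2 h3 => by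
    have hj : join.arrs = [4, 4, 7, 7, 5] := rfl
    rw [hσ₅, den_arr _ _ (by simp [hj, h1, h2, h3])]
  refine ⟨nextState dem s Δ u v, Δ, u, v, step_nextState hmin hcase,
    ⟨?_, fun x y => ?_, ?_, ?_⟩, ?_⟩
  · exact h5₅
  · rw [ha₅ 6 (by decide) (by decide) (by decide)]
    exact h6₄ x y
  · exact h7₅
  · exact h4₅
  · intro x y
    rw [ha₅ 9 (by decide) (by decide) (by decide), ha₄ 9 (by decide) (by decide), harr₃]
    exact h9₂ x y

end RAM

/-! ### Correctness of a stage -/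

namespace RAM

open Term Cmd Finset
open scoped Classical

variable {n : ℕ} {σ τ : Store} {G : SimpleGraph (Fin n)} {dem : Fin n → Fin n → Prop}
  {c : Fin n → Fin n → ℕ} {p q L M : ℕ} {s : Moat.State (Fin n)}

/-- The slacks and the potentials at most double in each step, so that `2 ^ (L + 1)` times their
initial bound `B` is a bound for `L` steps and for what is computed on the way. -/
theorem for_growStep_spec (hn : 0 < n) (hE : Env G dem c p q L M σ) (hS : Represents σ s)
    (h9 : IsMatrix (n := n) σ 9 fun _ _ => False) {B : ℕ} (hslack : ∀ x y, s.slack x y ≤ B)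
    (hpot : ∑ x, s.pot x ≤ B) (hM : 0 < M) (hB : 2 ^ (L + 1) * B ≤ M) :
    ∃ (S : ℕ → Moat.State (Fin n)) (Δ : ℕ → ℕ) (u v : ℕ → Fin n), S 0 = s ∧
      (∀ t < L, Moat.Step G dem (S t) (S (t + 1)) (Δ t) (u t) (v t)) ∧
      Represents ((Cmd.for 20 1 growStep).den σ) (S L) ∧
      IsMatrix ((Cmd.for 20 1 growStep).den σ) 9 fun x y => ¬ Moat.Together dem S L x y := by
  have key := Cmd.for_rule (σ := σ) (x := 20) (b := 1) (p := growStep)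
    (fun i τ => ∃ (S : ℕ → Moat.State (Fin n)) (Δ : ℕ → ℕ) (u v : ℕ → Fin n), S 0 = s ∧
      (∀ t < i, Moat.Step G dem (S t) (S (t + 1)) (Δ t) (u t) (v t)) ∧ Represents τ (S i) ∧
      (IsMatrix τ 9 fun x y => ¬ Moat.Together dem S i x y) ∧
      (∀ x y, (S i).slack x y ≤ 2 ^ i * B) ∧ ∑ x, (S i).pot x ≤ 2 ^ i * B) ?_ ?_ ?_
  · rw [hE.reg1] at key
    obtain ⟨S, Δ, u, v, h1, h2, h3, h4, -⟩ := key
    exact ⟨S, Δ, u, v, h1, h2, h3, h4⟩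
  · rintro i τ w ⟨S, Δ, u, v, h1, h2, h3, h4, h5⟩
    exact ⟨S, Δ, u, v, h1, h2, h3.congr fun _ _ _ => rfl, h4, h5⟩
  · have : Inhabited (Fin n) := ⟨⟨0, hn⟩⟩
    refine ⟨fun _ => s, default, default, default, rfl, by simp, hS, fun x y => ?_,
      by simpa using hslack, by simpa using hpot⟩
    rw [h9 x y, if_neg id, if_neg]
    exact not_not.2 fun t ht => absurd ht (Nat.not_lt_zero t)
  · rintro i hi τ hr ha - ⟨S, Δ, u, v, h1, h2, h3, h4, h5, h6⟩
    rw [hE.reg1] at hi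
    have hregs : ∀ r ∈ growStep.regs, 5 ≤ r := by decide
    have harrs : ∀ a ∈ growStep.arrs, 4 ≤ a := by decide
    have hEτ : Env G dem c p q L M τ := hE.congr
      (fun r h1 h2 => hr r (by omega) fun h => by have := hregs r h; omega)
      (fun a h1 => ha a fun h => by have := harrs a h; omega)
    have hpow : 2 * (2 ^ i * B) ≤ M := by
      refine le_trans ?_ hB
      rw [← mul_assoc, ← pow_succ']
      exact Nat.mul_le_mul_right B (Nat.pow_le_pow_right (by norm_num) (by omega))
    obtain ⟨s', δ, a, b, hstep, hS', h9'⟩ := growStep_spec hn hEτ h3 h4 hM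
      (fun x y => (Nat.mul_le_mul_left 2 (h5 x y)).trans hpow)
      ((Nat.mul_le_mul_left 2 h6).trans hpow)
    have hU : ∀ t, t ≤ i → Function.update S (i + 1) s' t = S t := fun t ht =>
      Function.update_of_ne (by omega) _ _
    refine ⟨Function.update S (i + 1) s', Function.update Δ i δ, Function.update u i a,
      Function.update v i b, ?_, fun t ht => ?_, ?_, ?_, fun x y => ?_, ?_⟩
    · rw [hU 0 (Nat.zero_le i), h1]
    · rcases Nat.lt_succ_iff_lt_or_eq.1 ht with ht | rfl
      · rw [hU t ht.le, hU (t + 1) (by omega), Function.update_of_ne ht.ne,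
          Function.update_of_ne ht.ne, Function.update_of_ne ht.ne]
        exact h2 t ht
      · rw [hU t le_rfl]
        simpa using hstep
    · rwa [Function.update_self]
    · refine h9'.congr fun x y => ?_
      rw [← not_iff_not, not_or, not_not, not_not]
      constructor
      · rintro ⟨h7, h8⟩ t ht
        rcases Nat.lt_succ_iff_lt_or_eq.1 ht with ht | rfl
        · rw [hU t ht.le]; exact h7 t ht
        · rw [hU t le_rfl]
          intro hne
          by_contra h
          exact h8 ⟨hne, h⟩
      · intro h
        refine ⟨fun t ht => ?_, fun h7 => h7.2 ?_⟩
        · have := h t (by omega)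
          rwa [hU t ht.le] at this
        · have := h i (by omega)
          rw [hU i le_rfl] at this
          exact this h7.1
    · rw [Function.update_self, hstep.slack_eq, pow_succ', mul_assoc]
      exact (Nat.sub_le _ _).trans (Nat.mul_le_mul_left 2 (h5 x y))
    · rw [Function.update_self, pow_succ', mul_assoc]
      exact hstep.sum_pot_le.trans (Nat.mul_le_mul_left 2 h6)

/-- Every edge of `H` adds its share to the potential of its component once in each direction, as in
the definition of a stage. -/
theorem initStage_spec {H : SimpleGraph (Fin n)} (hE : Env G dem c p q L M σ)
    (h4 : IsMatrix σ 4 H.Adj) (hslack : ∀ x y, 2 * (p * c x y) ≤ M)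
    (hpot : ∑ z : Fin n × Fin n with H.Adj z.1 z.2, q * c z.1 z.2 ≤ M) :
    ∃ s : Moat.State (Fin n), s.forest = H ∧ (∀ x y, s.lab x = s.lab y ↔ H.Reachable x y) ∧
      (∀ x y, s.slack x y = 2 * (p * c x y)) ∧
      (∀ a, s.pot a = ∑ z : Fin n × Fin n with H.Adj z.1 z.2 ∧ s.lab z.1 = a, q * c z.1 z.2) ∧
      Represents (initStage.den σ) s ∧ IsMatrix (n := n) (initStage.den σ) 9 fun _ _ => False := by
  obtain ⟨lab, hlab, hreach⟩ := components_spec hE.reg2 hE.reg3 h4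
  refine ⟨⟨lab, fun x y => 2 * (p * c x y),
    fun a => ∑ z : Fin n × Fin n with H.Adj z.1 z.2 ∧ lab z.1 = a, q * c z.1 z.2, H⟩,
    rfl, hreach, fun _ _ => rfl, fun _ => rfl, ?_⟩
  unfold initStage
  simp only [den_seq]
  obtain ⟨σ₁, hσ₁⟩ : ∃ τ, τ = components.den σ := ⟨_, rfl⟩
  have hE₁ : Env G dem c p q L M σ₁ := hσ₁ ▸ hE.den _ (by decide) (by decide)
  have h4₁ : IsMatrix σ₁ 4 H.Adj := fun x y => by
    rw [hσ₁, den_arr _ _ (by decide)]; exact h4 x y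
  rw [← hσ₁] at hlab ⊢
  obtain ⟨σ₂, hσ₂⟩ : ∃ τ, τ = (Cmd.for 7 2 (store 7 (reg 7) 0)).den σ₁ := ⟨_, rfl⟩
  rw [← hσ₂]
  have hE₂ : Env G dem c p q L M σ₂ := hσ₂ ▸ hE₁.den _ (by decide) (by decide)
  have ha₂ : ∀ a, a ≠ 7 → σ₂.arr a = σ₁.arr a := fun a h => by
    rw [hσ₂, den_arr _ _ (by simpa [arrs] using h)]
  have h7₂ : ∀ x : Fin n, σ₂.arr 7 x = 0 := fun x => by
    rw [hσ₂, Cmd.for_map (fun _ => 0) rfl (by simp [arrs])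
      (fun i hi τ hr ha hx h j => by simp [den, hx]), if_pos (by rw [hE₁.reg2]; exact x.isLt)]
  obtain ⟨C, hC⟩ : ∃ C, C = branch (cell 4 (reg 7))
    (storeC 7 (rowLab 7) (cell 7 (rowLab 7) + cell 0 2 * cell 3 (reg 7))) skip := ⟨_, rfl⟩
  have hCr : C.regs = [] := by rw [hC]; rfl
  have hCa : C.arrs = [7] := by rw [hC]; rfl
  rw [← hC]
  have key := Cmd.for_rule (σ := σ₂) (x := 7) (b := 3) (p := C)
    (fun i τ => ∀ x : Fin n, τ.arr 7 x = ∑ z : Fin n × Fin n,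
      if (H.Adj z.1 z.2 ∧ lab z.1 = x) ∧ (z.1 : ℕ) * n + z.2 < i then q * c z.1 z.2 else 0)
    (fun _ _ _ h => h) (by simpa using h7₂) ?_
  · obtain ⟨σ₃, hσ₃⟩ : ∃ τ, τ = (Cmd.for 7 3 C).den σ₂ := ⟨_, rfl⟩
    rw [← hσ₃, hE₂.reg3] at key
    rw [← hσ₃]
    have hE₃ : Env G dem c p q L M σ₃ := hσ₃ ▸ hE₂.den _ (by simp [regs, hCr]) (by simp [arrs, hCa])
    have ha₃ : ∀ a, a ≠ 7 → σ₃.arr a = σ₂.arr a := fun a h => by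
      rw [hσ₃, den_arr _ _ (by simpa [arrs, hCa] using h)]
    obtain ⟨σ₄, hσ₄⟩ : ∃ τ, τ =
      (Cmd.for 7 3 (storeC 6 (reg 7) (2 * (cell 0 1 * cell 3 (reg 7))))).den σ₃ := ⟨_, rfl⟩
    rw [← hσ₄]
    have hE₄ : Env G dem c p q L M σ₄ := hσ₄ ▸ hE₃.den _ (by decide) (by decide)
    have ha₄ : ∀ a, a ≠ 6 → σ₄.arr a = σ₃.arr a := fun a h => by
      rw [hσ₄, den_arr _ _ (by simpa [arrs] using h)]
    have h6₄ : ∀ x y : Fin n, σ₄.arr 6 (x * n + y) = 2 * (p * c x y) := fun x y => by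
      rw [hσ₄, Cmd.for_map (fun i => min (2 * (p * σ₃.arr 3 i)) M) rfl (by simp [arrs])
        (fun i hi τ hr ha hx h j => by
          simp [den, hx, ha, hr, hE₃.arr0.1, hE₃.reg4]),
        if_pos (by rw [hE₃.reg3]; exact index_lt x y), hE₃.arr3, min_eq_left (hslack x y)]
    obtain ⟨σ₅, hσ₅⟩ : ∃ τ, τ = (Cmd.for 7 3 (store 9 (reg 7) 0)).den σ₄ := ⟨_, rfl⟩
    rw [← hσ₅]
    have ha₅ : ∀ a, a ≠ 9 → σ₅.arr a = σ₄.arr a := fun a h => by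
      rw [hσ₅, den_arr _ _ (by simpa [arrs] using h)]
    refine ⟨⟨fun x => ?_, fun x y => ?_, fun x => ?_, fun x y => ?_⟩, fun x y => ?_⟩
    · rw [ha₅ 5 (by decide), ha₄ 5 (by decide), ha₃ 5 (by decide), ha₂ 5 (by decide)]
      exact hlab x
    · rw [ha₅ 6 (by decide)]
      exact h6₄ x y
    · rw [ha₅ 7 (by decide), ha₄ 7 (by decide), key x]
      simp only [index_lt, and_true, sum_filter]
    · rw [ha₅ 4 (by decide), ha₄ 4 (by decide), ha₃ 4 (by decide), ha₂ 4 (by decide)]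
      exact h4₁ x y
    · rw [hσ₅, Cmd.for_map (fun _ => 0) rfl (by simp [arrs])
        (fun i hi τ hr ha hx h j => by simp [den, hx]),
        if_pos (by rw [hE₄.reg3]; exact index_lt x y), if_neg id]
  · intro i hi τ hr ha hx hP x
    rw [hE₂.reg3] at hi
    obtain ⟨a, b, rfl⟩ := exists_index hi
    rw [hCa] at ha
    rw [hCr] at hr
    have hEτ : Env G dem c p q L M τ := hE₂.congr
      (fun r h1 h2 => hr r (by omega) (by simp)) (fun a h1 => ha a (by simp; omega))
    have hrl : (rowLab 7).value τ = lab a := by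
      rw [value_rowLab hEτ.reg2 hx, ha 5 (by simp), ha₂ 5 (by decide), hlab]
    have h4τ : τ.arr 4 (a * n + b) = if H.Adj a b then 1 else 0 := by
      rw [ha 4 (by simp), ha₂ 4 (by decide)]; exact h4₁ a b
    have hsplit : (∑ z : Fin n × Fin n, if (H.Adj z.1 z.2 ∧ lab z.1 = x) ∧
        (z.1 : ℕ) * n + z.2 < a * n + b + 1 then q * c z.1 z.2 else 0) =
        τ.arr 7 x + if H.Adj a b ∧ lab a = x then q * c a b else 0 := by
      rw [hP x]
      have : (if H.Adj a b ∧ lab a = x then q * c a b else 0) = ∑ z : Fin n × Fin n,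
          if z = (a, b) then (if H.Adj z.1 z.2 ∧ lab z.1 = x then q * c z.1 z.2 else 0) else 0 := by
        rw [sum_ite_eq' univ (a, b), if_pos (mem_univ _)]
      rw [this, ← sum_add_distrib]
      refine sum_congr rfl fun z _ => ?_
      obtain ⟨z₁, z₂⟩ := z
      by_cases hz : (z₁, z₂) = (a, b)
      · obtain ⟨rfl, rfl⟩ := Prod.mk.inj hz
        simp
      · have hlt : (z₁ : ℕ) * n + z₂ < a * n + b + 1 ↔ (z₁ : ℕ) * n + z₂ < a * n + b := by
          rw [Nat.lt_succ_iff_lt_or_eq, index_inj, or_iff_left]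
          exact fun h => hz (by rw [h.1, h.2])
        simp only [hz, hlt, if_false, add_zero]
    rw [hsplit, hC]
    simp only [Cmd.den, value_cell, value_reg, hx, h4τ, hrl]
    by_cases hab : H.Adj a b
    · have hle : τ.arr 7 (lab a) + q * c a b ≤ M := by
        refine le_trans ?_ hpot
        rw [hP, sum_filter]
        have : q * c a b = ∑ z : Fin n × Fin n,
          if z = (a, b) then (if H.Adj z.1 z.2 then q * c z.1 z.2 else 0) else 0 := by
          rw [sum_ite_eq' univ (a, b), if_pos (mem_univ _), if_pos hab]
        rw [this, ← sum_add_distrib]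
        refine sum_le_sum fun z _ => ?_
        obtain ⟨z₁, z₂⟩ := z
        by_cases hz : (z₁, z₂) = (a, b)
        · obtain ⟨rfl, rfl⟩ := Prod.mk.inj hz
          simp
        · simp only [hz, if_false, add_zero]
          split_ifs with h1 h2
          · exact le_rfl
          · exact absurd h1.1.1 h2
          · exact Nat.zero_le _
          · exact le_rfl
      simp only [hab, if_true, one_ne_zero, if_false, Store.setCell_arr, value_add, value_mul,
        value_cell, value_reg, value_ofNat, hrl, hEτ.arr0.2, hx, hEτ.arr3, hEτ.reg4,
        min_eq_left hle, true_and, Fin.val_inj]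
      by_cases hxa : x = lab a
      · simp [hxa]
      · simp [hxa, Ne.symm hxa]
    · simp [hab]

end RAM

namespace RAM

open Term Cmd Finset
open scoped Classical

variable {n : ℕ} {σ τ : Store} {G : SimpleGraph (Fin n)} {dem : Fin n → Fin n → Prop}
  {c : Fin n → Fin n → ℕ} {p q L M : ℕ}

/-- The flag in register `12` tells whether a pair that has to be connected is separated. -/
theorem search_spec {R : Fin n → Fin n → Prop} {lab : Fin n → Fin n} (h2 : σ.reg 2 = n)
    (h3 : σ.reg 3 = n * n) (h5 : ∀ x : Fin n, σ.arr 5 x = lab x)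
    (h9 : IsMatrix σ 9 fun x y => ¬ R x y) (h12 : σ.reg 12 = 0) :
    ((Cmd.for 7 3 (branch ((1 - cell 9 (reg 7)) * apart 7) (assign 12 1) skip)).den σ).reg 12 = 0 ↔
      ∀ x y, R x y → lab x = lab y := by
  have key := Cmd.for_rule (σ := σ) (x := 7) (b := 3)
    (p := branch ((1 - cell 9 (reg 7)) * apart 7) (assign 12 1) skip)
    (fun i τ => τ.reg 12 = 0 ↔ ∀ x y : Fin n, (x : ℕ) * n + y < i → R x y → lab x = lab y)
    (fun i τ v h => by simpa using h) (by simp [h12]) ?_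
  · rw [key, h3]
    exact ⟨fun h x y => h x y (index_lt x y), fun h x y _ => h x y⟩
  · intro i hi τ hr ha hx hP
    rw [h3] at hi
    obtain ⟨a, b, rfl⟩ := exists_index hi
    have hreg : ∀ r, r ≠ 7 → r ≠ 12 → τ.reg r = σ.reg r := fun r h1 h2 =>
      hr r h1 (by simp [regs, h2])
    have harr : ∀ a, τ.arr a = σ.arr a := fun a => ha a (by simp [arrs])
    have h2τ : τ.reg 2 = n := (hreg 2 (by decide) (by decide)).trans h2
    have hcond : ((1 - cell 9 (reg 7)) * apart 7).value τ = 0 ↔ (R a b → lab a = lab b) := by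
      simp only [value_mul, value_sub, value_cell, value_reg, value_ofNat, hx, harr, h9 a b, apart,
        value_eq, value_rowLab h2τ hx, value_colLab h2τ hx, h5, Fin.val_inj]
      by_cases h1 : R a b <;> by_cases h2 : lab a = lab b <;> simp [h1, h2]
    have hext : (∀ x y : Fin n, (x : ℕ) * n + y < a * n + b + 1 → R x y → lab x = lab y) ↔
        (R a b → lab a = lab b) ∧
          ∀ x y : Fin n, (x : ℕ) * n + y < a * n + b → R x y → lab x = lab y := by
      refine ⟨fun h => ⟨h a b (Nat.lt_succ_self _),
          fun x y hlt => h x y (hlt.trans (Nat.lt_succ_self _))⟩,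
        fun h x y hlt => ?_⟩
      rcases Nat.lt_succ_iff_lt_or_eq.1 hlt with h1 | h1
      · exact h.2 x y h1
      · obtain ⟨rfl, rfl⟩ := index_inj.1 h1
        exact h.1
    rw [hext, Cmd.den]
    by_cases hc : R a b → lab a = lab b
    · rw [if_pos (hcond.2 hc), ← hP]
      exact ⟨fun h => ⟨hc, h⟩, fun h => h.2⟩
    · rw [if_neg (mt hcond.1 hc)]
      simp [Cmd.den, hc]

/-- One pass over the edges suffices: an edge that was kept because it was needed remains needed
when further edges are deleted. -/
theorem prune_spec {F : SimpleGraph (Fin n)} {R : Fin n → Fin n → Prop}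
    (hE : Env G dem c p q L M σ) (h4 : IsMatrix σ 4 F.Adj) (h9 : IsMatrix σ 9 fun x y => ¬ R x y)
    (hR : ∀ x y, R x y → F.Reachable x y) :
    ∃ H, IsMatrix (prune.den σ) 4 H.Adj ∧ Moat.IsPruned R F H := by
  unfold prune
  obtain ⟨S, hS⟩ : ∃ S, S =
    Cmd.for 7 3 (branch ((1 - cell 9 (reg 7)) * apart 7) (assign 12 1) skip) := ⟨_, rfl⟩
  have hSr : S.regs = [7, 12] := by rw [hS]; rfl
  have hSa : S.arrs = [] := by rw [hS]; rfl
  have hcr : ∀ r ∈ components.regs, 7 ≤ r ∧ r ≤ 10 := by decide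
  have hca : ∀ r ∈ components.arrs, r = 5 := by decide
  rw [← hS]
  obtain ⟨C, hC⟩ : ∃ C, C = branch (cell 4 (reg 20))
    (store 4 (reg 20) 0 ;; store 4 (col 20 * reg 2 + row 20) 0 ;; components ;; assign 12 0 ;;
      S ;; branch (reg 12) (store 4 (reg 20) 1 ;; store 4 (col 20 * reg 2 + row 20) 1) skip)
    skip := ⟨_, rfl⟩
  have hCr : ∀ r ∈ C.regs, 5 ≤ r := by rw [hC, hS]; decide
  have hCa : ∀ a ∈ C.arrs, a = 4 ∨ a = 5 := by rw [hC, hS]; decide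
  rw [← hC]
  have key := Cmd.for_rule (σ := σ) (x := 20) (b := 3) (p := C)
    (fun i τ => ∃ H : SimpleGraph (Fin n), IsMatrix τ 4 H.Adj ∧ H ≤ F ∧
      (∀ x y, R x y → H.Reachable x y) ∧ ∀ x y : Fin n, (x : ℕ) * n + y < i → H.Adj x y →
        ∃ a b, R a b ∧ ¬ (H.deleteEdges {s(x, y)}).Reachable a b)
    (fun i τ v h => h) ⟨F, h4, le_rfl, hR, by simp⟩ ?_
  · rw [hE.reg3] at key
    obtain ⟨H, h1, h2, h3, h4⟩ := key
    exact ⟨H, h1, h2, h3, fun x y => h4 x y (index_lt x y)⟩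
  · rintro i hi τ hr ha hx ⟨H, h1, h2, h3, h5⟩
    rw [hE.reg3] at hi
    obtain ⟨x, y, rfl⟩ := exists_index hi
    have hEτ : Env G dem c p q L M τ := hE.congr
      (fun r h1 h2 => hr r (by omega) fun h => by have := hCr r h; omega)
      (fun a h1 => ha a fun h => by have := hCa a h; omega)
    have h9τ : IsMatrix τ 9 fun x y => ¬ R x y := fun x y => by
      rw [ha 9 fun h => by have := hCa 9 h; omega]
      exact h9 x y
    have hext : ∀ {H : SimpleGraph (Fin n)}, (∀ x' y' : Fin n, (x' : ℕ) * n + y' < x * n + y →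
        H.Adj x' y' → ∃ a b, R a b ∧ ¬ (H.deleteEdges {s(x', y')}).Reachable a b) →
        (H.Adj x y → ∃ a b, R a b ∧ ¬ (H.deleteEdges {s(x, y)}).Reachable a b) →
        ∀ x' y' : Fin n, (x' : ℕ) * n + y' < x * n + y + 1 → H.Adj x' y' →
          ∃ a b, R a b ∧ ¬ (H.deleteEdges {s(x', y')}).Reachable a b := by
      intro H h6 h7 x' y' hlt
      rcases Nat.lt_succ_iff_lt_or_eq.1 hlt with h8 | h8
      · exact h6 x' y' h8
      · obtain ⟨rfl, rfl⟩ := index_inj.1 h8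
        exact h7
    rw [hC, Cmd.den, value_cell, value_reg, hx, h1 x y]
    by_cases hxy : H.Adj x y
    swap
    · rw [if_neg hxy, if_pos rfl]
      exact ⟨H, h1, h2, h3, hext h5 fun h => absurd h hxy⟩
    rw [if_pos hxy, if_neg one_ne_zero]
    simp only [den_seq]
    obtain ⟨τ₁, hτ₁⟩ : ∃ τ', τ' = (store 4 (col 20 * reg 2 + row 20) 0).den
      ((store 4 (reg 20) 0).den τ) := ⟨_, rfl⟩
    rw [← hτ₁]
    have hreg₁ : τ₁.reg = τ.reg := by rw [hτ₁]; rfl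
    have harr₁ : ∀ a, a ≠ 4 → τ₁.arr a = τ.arr a := fun a h => by
      rw [hτ₁, den_arr _ _ (by simpa [arrs] using h), den_arr _ _ (by simpa [arrs] using h)]
    obtain ⟨H', hH'⟩ : ∃ H', H' = H.deleteEdges {s(x, y)} := ⟨_, rfl⟩
    have hadj : ∀ a b, H'.Adj a b ↔ H.Adj a b ∧ ¬ (a = x ∧ b = y ∨ a = y ∧ b = x) := by
      intro a b
      rw [hH', SimpleGraph.deleteEdges_adj, Set.mem_singleton_iff, Sym2.eq_iff]
    have h4₁ : IsMatrix τ₁ 4 H'.Adj := by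
      intro a b
      have hc := value_col (σ := (store 4 (reg 20) 0).den τ) (i := 20) (a := x) (b := y)
        hEτ.reg2 hx
      have hw := value_row (σ := (store 4 (reg 20) 0).den τ) (i := 20) (a := x) (b := y)
        hEτ.reg2 hx
      have hr2 : ((store 4 (reg 20) 0).den τ).reg 2 = n := hEτ.reg2
      rw [hτ₁, Cmd.den, value_add, value_mul, hc, hw, value_reg, hr2]
      simp only [Cmd.den, Store.setCell_arr, value_reg, value_ofNat, hx, true_and, index_inj,
        h1 a b, hadj]
      by_cases h6 : a = x ∧ b = y <;> by_cases h7 : a = y ∧ b = x <;> simp [h6, h7]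
    obtain ⟨lab, hlab, hreach⟩ := components_spec (σ := τ₁) (H := H')
      (by rw [hreg₁]; exact hEτ.reg2) (by rw [hreg₁]; exact hEτ.reg3) h4₁
    obtain ⟨τ₂, hτ₂⟩ : ∃ τ', τ' = (assign 12 0).den (components.den τ₁) := ⟨_, rfl⟩
    rw [← hτ₂]
    have hreg₂ : ∀ r, r ≠ 12 → r < 7 ∨ 10 < r → τ₂.reg r = τ.reg r := fun r h6 h7 => by
      rw [hτ₂, den_reg _ _ (by simpa [regs] using h6), den_reg _ _ (fun h => by
        have := hcr r h; omega), hreg₁]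
    have harr₂ : ∀ a, a ≠ 5 → τ₂.arr a = τ₁.arr a := fun a h6 => by
      rw [hτ₂, den_arr _ _ (by simp [arrs]), den_arr _ _ (fun h => h6 (hca a h))]
    have h5₂ : ∀ x : Fin n, τ₂.arr 5 x = lab x := fun x => by
      rw [hτ₂, den_arr _ _ (by simp [arrs])]; exact hlab x
    have hsearch := search_spec (σ := τ₂) (R := R) (lab := lab)
      ((hreg₂ 2 (by decide) (by decide)).trans hEτ.reg2)
      ((hreg₂ 3 (by decide) (by decide)).trans hEτ.reg3) h5₂
      (fun x y => by rw [harr₂ 9 (by decide), harr₁ 9 (by decide)]; exact h9τ x y)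
      (by rw [hτ₂]; rfl)
    rw [← hS] at hsearch
    obtain ⟨τ₃, hτ₃⟩ : ∃ τ', τ' = S.den τ₂ := ⟨_, rfl⟩
    rw [← hτ₃] at hsearch ⊢
    have h4₃ : τ₃.arr 4 = τ₁.arr 4 := by
      rw [hτ₃, den_arr _ _ (by simp [hSa]), harr₂ 4 (by decide)]
    have hreg₃ : ∀ r, r ≠ 12 → r < 7 ∨ 10 < r → τ₃.reg r = τ.reg r := fun r h6 h7 => by
      rw [hτ₃, den_reg _ _ (by simp [hSr]; omega), hreg₂ r h6 h7]
    rw [Cmd.den, value_reg]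
    have hle : H' ≤ H := fun a b h => ((hadj a b).1 h).1
    by_cases h12 : τ₃.reg 12 = 0
    · rw [if_pos h12]
      refine ⟨H', fun a b => ?_, hle.trans h2,
        fun a b hab => (hreach a b).1 (hsearch.1 h12 a b hab),
        hext (fun x' y' hlt hxy' => ?_) fun h => absurd (Or.inl ⟨rfl, rfl⟩) ((hadj x y).1 h).2⟩
      · change τ₃.arr 4 (a * n + b) = _
        rw [h4₃]; exact h4₁ a b
      · obtain ⟨a, b, h6, h7⟩ := h5 x' y' hlt (hle hxy')
        exact ⟨a, b, h6, fun h => h7 (h.mono (SimpleGraph.deleteEdges_mono hle))⟩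
    · rw [if_neg h12]
      refine ⟨H, fun a b => ?_, h2, h3, hext h5 fun _ => ?_⟩
      · have hr2 : τ₃.reg 2 = n := (hreg₃ 2 (by decide) (by decide)).trans hEτ.reg2
        have hx₃ : τ₃.reg 20 = x * n + y := (hreg₃ 20 (by decide) (by decide)).trans hx
        have hc := value_col (σ := (store 4 (reg 20) 1).den τ₃) (i := 20) (a := x) (b := y) hr2 hx₃
        have hw := value_row (σ := (store 4 (reg 20) 1).den τ₃) (i := 20) (a := x) (b := y) hr2 hx₃
        have hr2' : ((store 4 (reg 20) 1).den τ₃).reg 2 = n := hr2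
        rw [den_seq, Cmd.den, value_add, value_mul, hc, hw, value_reg, hr2']
        simp only [Cmd.den, Store.setCell_arr, value_reg, value_ofNat, hx₃, true_and, index_inj,
          h4₃, h4₁ a b, hadj]
        by_cases h6 : a = x ∧ b = y
        · simp [h6, hxy]
        · by_cases h7 : a = y ∧ b = x
          · simp [h7, hxy.symm]
          · simp [h6, h7]
      · by_contra hno
        push Not at hno
        exact h12 (hsearch.2 fun a b hab => (hreach a b).2 (hH' ▸ hno a b hab))

/-- The bounds on the numbers ensure that nothing is clamped, so the program carries out a stage. -/
theorem stage_spec {H : SimpleGraph (Fin n)} (hn : 0 < n) (hE : Env G dem c p q L M σ)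
    (h4 : IsMatrix σ 4 H.Adj) (hH : H ≤ G) (hc : ∀ x y, c x y = c y x) (hL : 2 * n + 1 < L)
    (hfeas : ∀ x y, dem x y → G.Reachable x y) {B : ℕ} (hM : 0 < M) (hB : 2 ^ (L + 1) * B ≤ M)
    (hslack : ∀ x y, 2 * (p * c x y) ≤ B)
    (hpot : ∑ z : Fin n × Fin n with H.Adj z.1 z.2, q * c z.1 z.2 ≤ B) :
    ∃ H', IsMatrix (stage.den σ) 4 H'.Adj ∧ Moat.Stage G dem c p q L H H' := by
  have hBM : B ≤ M := (Nat.le_mul_of_pos_left B (by positivity)).trans hB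
  obtain ⟨s, rfl, hs2, hs3, hs4, hS, h9⟩ := initStage_spec hE h4 (fun x y => (hslack x y).trans hBM)
    (hpot.trans hBM)
  unfold stage
  simp only [den_seq]
  obtain ⟨σ₁, hσ₁⟩ : ∃ τ, τ = initStage.den σ := ⟨_, rfl⟩
  rw [← hσ₁] at hS h9 ⊢
  have hE₁ : Env G dem c p q L M σ₁ := hσ₁ ▸ hE.den _ (by decide) (by decide)
  have hsum : ∑ x, s.pot x = ∑ z : Fin n × Fin n with s.forest.Adj z.1 z.2, q * c z.1 z.2 := by
    simp only [hs4]
    rw [← sum_fiberwise (univ.filter fun z : Fin n × Fin n => s.forest.Adj z.1 z.2)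
      (fun z => s.lab z.1)]
    simp only [filter_filter]
  obtain ⟨S, Δ, u, v, h1, h2, h3, h9⟩ := for_growStep_spec hn hE₁ hS h9 (B := B)
    (fun x y => (hs3 x y).trans_le (hslack x y)) (hsum.trans_le hpot) hM hB
  obtain ⟨σ₂, hσ₂⟩ : ∃ τ, τ = (Cmd.for 20 1 growStep).den σ₁ := ⟨_, rfl⟩
  rw [← hσ₂] at h3 h9 ⊢
  have hE₂ : Env G dem c p q L M σ₂ := hσ₂ ▸ hE₁.den _ (by decide) (by decide)
  have hrun : Moat.Run G dem S L Δ u v := ⟨h2, by rw [h1]; exact hs2, by rw [h1]; exact hH,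
    fun x y => by rw [h1, hs3, hs3, hc]⟩
  obtain ⟨H', h5, h6⟩ := prune_spec (R := Moat.Together dem S L) hE₂ h3.forest h9 fun x y hxy =>
    hrun.reachable_of_lab_eq le_rfl (hrun.lab_last_eq hfeas (by simpa using hL) hxy)
  exact ⟨H', h5, S, Δ, u, v, hrun, by rw [h1], by rw [h1]; exact hs3,
    fun a => by rw [h1]; convert hs4 a, h6⟩

end RAM

/-! ### Reading the input -/

namespace SteinerInstance

open Finset
open scoped Classical

/-- The entries of a square matrix, row by row. -/
def matrixList {n : ℕ} (g : Fin n → Fin n → ℕ) : List ℕ :=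
  List.ofFn fun p : Fin (n * n) => g p.divNat p.modNat

@[simp] theorem length_matrixList {n : ℕ} (g : Fin n → Fin n → ℕ) :
    (matrixList g).length = n * n := List.length_ofFn

theorem getElem_matrixList {n : ℕ} (g : Fin n → Fin n → ℕ) (x y : Fin n)
    (h : (x : ℕ) * n + y < (matrixList g).length) : (matrixList g)[(x : ℕ) * n + y] = g x y := by
  simp only [matrixList, List.getElem_ofFn]
  congr 1 <;> ext <;> simp [Fin.divNat, Fin.modNat]

theorem getD_matrixList {n : ℕ} (g : Fin n → Fin n → ℕ) (x y : Fin n) :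
    (matrixList g).getD (x * n + y) 0 = g x y := by
  have h : (x : ℕ) * n + y < (matrixList g).length := by simpa using RAM.index_lt x y
  rw [List.getD_eq_getElem _ _ h, getElem_matrixList]

theorem getD_append_add (l l' : List ℕ) (i : ℕ) :
    (l ++ l').getD (l.length + i) 0 = l'.getD i 0 := by
  rw [List.getD_append_right _ _ _ _ (Nat.le_add_right _ _), Nat.add_sub_cancel_left]

variable (I : SteinerInstance) (ε : ℚ≥0)

theorem encode_eq : I.encode ε = [I.n, ε.num, ε.den] ++
    (matrixList (fun x y => if I.graph.Adj x y then 1 else 0) ++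
    (matrixList (fun x y => if I.graph.Adj x y then (I.cost s(x, y)).num else 0) ++
    (matrixList (fun x y => if I.graph.Adj x y then (I.cost s(x, y)).den else 0) ++
    matrixList (fun x y => if (x, y) ∈ I.demands then 1 else 0)))) := by
  simp only [encode, matrixList, List.append_assoc]

theorem length_encode : (I.encode ε).length = 3 + 4 * (I.n * I.n) := by
  rw [encode_eq]
  simp only [List.length_append, length_matrixList, List.length_cons, List.length_nil]
  ring

variable {I ε} (x y : Fin I.n)

theorem encode_adj : (I.encode ε).getD (3 + (x * I.n + y)) 0 =
    if I.graph.Adj x y then 1 else 0 := by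
  rw [encode_eq, show 3 = [I.n, ε.num, ε.den].length from rfl, getD_append_add, List.getD_append,
    getD_matrixList]
  simpa using RAM.index_lt x y

theorem encode_num : (I.encode ε).getD (3 + (I.n * I.n + (x * I.n + y))) 0 =
    if I.graph.Adj x y then (I.cost s(x, y)).num else 0 := by
  rw [encode_eq, show 3 = [I.n, ε.num, ε.den].length from rfl, getD_append_add,
    ← length_matrixList (fun x y => if I.graph.Adj x y then 1 else 0), getD_append_add,
    List.getD_append, getD_matrixList]
  simpa using RAM.index_lt x y

theorem encode_den : (I.encode ε).getD (3 + (I.n * I.n + (I.n * I.n + (x * I.n + y)))) 0 =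
    if I.graph.Adj x y then (I.cost s(x, y)).den else 0 := by
  rw [encode_eq, show 3 = [I.n, ε.num, ε.den].length from rfl, getD_append_add,
    List.getD_append_right _ _ _ _ (by simp), length_matrixList, Nat.add_sub_cancel_left,
    List.getD_append_right _ _ _ _ (by simp), length_matrixList, Nat.add_sub_cancel_left,
    List.getD_append, getD_matrixList]
  simpa using RAM.index_lt x y

theorem encode_dem : (I.encode ε).getD
    (3 + (I.n * I.n + (I.n * I.n + (I.n * I.n + (x * I.n + y))))) 0 =
      if (x, y) ∈ I.demands then 1 else 0 := by
  rw [encode_eq, show 3 = [I.n, ε.num, ε.den].length from rfl, getD_append_add,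
    List.getD_append_right _ _ _ _ (by simp), length_matrixList, Nat.add_sub_cancel_left,
    List.getD_append_right _ _ _ _ (by simp), length_matrixList, Nat.add_sub_cancel_left,
    List.getD_append_right _ _ _ _ (by simp), length_matrixList, Nat.add_sub_cancel_left,
    getD_matrixList]

end SteinerInstance

namespace RAM

open Term Cmd Finset
open scoped Classical

/-- The product of the positive ones among the first `L` values of `f`. -/
def posProd (f : ℕ → ℕ) (L : ℕ) : ℕ := ∏ i ∈ range L, if f i = 0 then 1 else f i

/-- The number `∏ (f i + 2)` bounds all values of `f`, their number (even the corresponding power of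
two), and `posProd`, but its bit length is linear in the size of the list of these values. -/
def boundProd (f : ℕ → ℕ) (L : ℕ) : ℕ := ∏ i ∈ range L, (f i + 2)

theorem posProd_pos (f : ℕ → ℕ) (L : ℕ) : 0 < posProd f L :=
  prod_pos fun i _ => by split_ifs <;> omega

theorem posProd_mono (f : ℕ → ℕ) {i L : ℕ} (h : i ≤ L) : posProd f i ≤ posProd f L :=
  prod_le_prod_of_subset_of_one_le' (range_mono h) fun i _ _ => by split_ifs <;> omega

theorem dvd_posProd (f : ℕ → ℕ) {i L : ℕ} (h : i < L) (h0 : f i ≠ 0) : f i ∣ posProd f L := by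
  have := dvd_prod_of_mem (fun i => if f i = 0 then 1 else f i) (mem_range.2 h)
  simp only [if_neg h0] at this
  exact this

theorem posProd_le_boundProd (f : ℕ → ℕ) (L : ℕ) : posProd f L ≤ boundProd f L :=
  prod_le_prod' fun i _ => by split_ifs <;> omega

theorem boundProd_mono (f : ℕ → ℕ) {i L : ℕ} (h : i ≤ L) : boundProd f i ≤ boundProd f L :=
  prod_le_prod_of_subset_of_one_le' (range_mono h) fun i _ _ => by omega

theorem add_two_le_boundProd (f : ℕ → ℕ) {i L : ℕ} (h : i < L) : f i + 2 ≤ boundProd f L :=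
  single_le_prod' (f := fun i => f i + 2) (fun i _ => by omega) (mem_range.2 h)

theorem two_pow_le_boundProd (f : ℕ → ℕ) (L : ℕ) : 2 ^ L ≤ boundProd f L := by
  have := pow_card_le_prod (range L) (fun i => f i + 2) 2 fun i _ => by omega
  simpa [boundProd] using this

/-- Outside the list the default `0` is within the bound, too. -/
theorem getD_le_boundProd (l : List ℕ) (i : ℕ) :
    l.getD i 0 ≤ boundProd (fun i => l.getD i 0) l.length := by
  by_cases hi : i < l.length
  · exact (Nat.le_add_right _ 2).trans (add_two_le_boundProd (fun i => l.getD i 0) hi)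
  · simp [not_lt.1 hi]

theorem boundProd_le_two_pow (l : List ℕ) :
    boundProd (fun i => l.getD i 0) l.length ≤ 2 ^ bitSize l := by
  induction l with
  | nil => simp [boundProd, bitSize]
  | cons a l ih =>
    have h1 : a + 2 ≤ 2 ^ (a.size + 1) := by
      have := Nat.lt_size_self a
      rw [pow_succ]
      omega
    simp only [boundProd, List.length_cons, prod_range_succ', List.getD_cons_zero,
      List.getD_cons_succ, bitSize, List.map_cons, List.sum_cons] at ih ⊢
    rw [pow_add, mul_comm]
    exact Nat.mul_le_mul h1 ih

theorem length_le_bitSize (l : List ℕ) : l.length ≤ bitSize l := by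
  induction l with
  | nil => simp
  | cons a l ih => simp [bitSize] at ih ⊢; omega

variable {σ : Store} {M : ℕ}

/-- The costs are multiplied by `posProd f L`, of which all denominators are divisors. -/
theorem readInput_spec {n L : ℕ} {f : ℕ → ℕ} (h1 : σ.reg 1 = L)
    (h3 : σ.reg 3 = n * n) (h4 : σ.reg 4 = M) (h0 : σ.arr 0 = f) (hD : posProd f L ≤ M) :
    (∀ i < n * n, (readInput.den σ).arr 1 i = f (3 + i)) ∧
    (∀ i < n * n, (readInput.den σ).arr 2 i = f (3 + 3 * (n * n) + i)) ∧
    ∀ i < n * n, (readInput.den σ).arr 3 i =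
      min (f (3 + n * n + i) * (posProd f L / f (3 + 2 * (n * n) + i))) M := by
  unfold readInput
  simp only [den_seq]
  have key := Cmd.for_rule (σ := (assign 5 1).den σ) (x := 7) (b := 1)
    (p := branch (cell 0 (reg 7)) (assignC 5 (reg 5 * cell 0 (reg 7))) skip)
    (fun i τ => τ.reg 5 = posProd f i) (fun i τ v h => by simpa using h)
    (by simp [posProd, den]) ?_
  · obtain ⟨σ₁, hσ₁⟩ : ∃ τ, τ = (Cmd.for 7 1 (branch (cell 0 (reg 7))
      (assignC 5 (reg 5 * cell 0 (reg 7))) skip)).den ((assign 5 1).den σ) := ⟨_, rfl⟩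
    rw [← hσ₁, show ((assign 5 1).den σ).reg 1 = L from h1] at key
    rw [← hσ₁]
    have hr₁ : ∀ r, r ≠ 5 → r ≠ 7 → σ₁.reg r = σ.reg r := fun r h5 h7 => by
      rw [hσ₁, den_reg _ _ (by simp [regs, h5, h7]), den_reg _ _ (by simp [regs, h5])]
    have ha₁ : ∀ a, σ₁.arr a = σ.arr a := fun a => by
      rw [hσ₁, den_arr _ _ (by simp [arrs]), den_arr _ _ (by simp [arrs])]
    obtain ⟨σ₂, hσ₂⟩ : ∃ τ, τ = (Cmd.for 7 3 (store 1 (reg 7) (cell 0 (3 + reg 7)))).den σ₁ :=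
      ⟨_, rfl⟩
    rw [← hσ₂]
    have hr₂ : ∀ r, r ≠ 7 → σ₂.reg r = σ₁.reg r := fun r h => by
      rw [hσ₂, den_reg _ _ (by simpa [regs] using h)]
    have ha₂ : ∀ a, a ≠ 1 → σ₂.arr a = σ₁.arr a := fun a h => by
      rw [hσ₂, den_arr _ _ (by simpa [arrs] using h)]
    obtain ⟨σ₃, hσ₃⟩ : ∃ τ, τ =
      (Cmd.for 7 3 (store 2 (reg 7) (cell 0 (3 + 3 * reg 3 + reg 7)))).den σ₂ := ⟨_, rfl⟩
    rw [← hσ₃]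
    have hr₃ : ∀ r, r ≠ 7 → σ₃.reg r = σ₂.reg r := fun r h => by
      rw [hσ₃, den_reg _ _ (by simpa [regs] using h)]
    have ha₃ : ∀ a, a ≠ 2 → σ₃.arr a = σ₂.arr a := fun a h => by
      rw [hσ₃, den_arr _ _ (by simpa [arrs] using h)]
    have h3₁ : σ₁.reg 3 = n * n := (hr₁ 3 (by decide) (by decide)).trans h3
    have h3₂ : σ₂.reg 3 = n * n := (hr₂ 3 (by decide)).trans h3₁
    have h3₃ : σ₃.reg 3 = n * n := (hr₃ 3 (by decide)).trans h3₂
    have h4₃ : σ₃.reg 4 = M := by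
      rw [hr₃ 4 (by decide), hr₂ 4 (by decide), hr₁ 4 (by decide) (by decide), h4]
    have h5₃ : σ₃.reg 5 = posProd f L := by
      rw [hr₃ 5 (by decide), hr₂ 5 (by decide), key]
    have f₁ : σ₁.arr 0 = f := (ha₁ 0).trans h0
    have f₂ : σ₂.arr 0 = f := (ha₂ 0 (by decide)).trans f₁
    have f₃ : σ₃.arr 0 = f := (ha₃ 0 (by decide)).trans f₂
    refine ⟨fun i hi => ?_, fun i hi => ?_, fun i hi => ?_⟩
    · rw [den_arr _ _ (by simp [arrs]), ha₃ 1 (by decide), hσ₂,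
        Cmd.for_map (fun i => f (3 + i)) rfl (by simp [arrs])
        (fun i hi τ hr ha hx h j => by simp [den, hx, ha, f₁]), if_pos (by rwa [h3₁])]
    · rw [den_arr _ _ (by simp [arrs]), hσ₃,
        Cmd.for_map (fun i => f (3 + 3 * (n * n) + i)) rfl (by simp [arrs])
        (fun i hi τ hr ha hx h j => by simp [den, hx, ha, hr, f₂, h3₂]), if_pos (by rwa [h3₂])]
    · rw [Cmd.for_map (fun i => min (f (3 + n * n + i) *
        (posProd f L / f (3 + 2 * (n * n) + i))) M) rfl (by simp [arrs])
        (fun i hi τ hr ha hx h j => by simp [den, hx, ha, hr, f₃, h3₃, h4₃, h5₃]),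
        if_pos (by rwa [h3₃])]
  · intro i hi τ hr ha hx hP
    have hi' : i < L := h1 ▸ hi
    have h0τ : τ.arr 0 = f := by rw [ha 0 (by simp [arrs])]; exact h0
    have h4τ : τ.reg 4 = M := by rw [hr 4 (by decide) (by simp [regs])]; exact h4
    have hsucc : posProd f (i + 1) = posProd f i * if f i = 0 then 1 else f i := prod_range_succ _ _
    have hle : posProd f (i + 1) ≤ M := (posProd_mono f hi').trans hD
    rw [hsucc] at hle ⊢
    simp only [Cmd.den, value_cell, value_reg, hx, h0τ]
    by_cases h : f i = 0
    · simpa [h] using hP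
    · simp only [h, if_false] at hle ⊢
      simp [hx, h0τ, hP, h4τ, hle]

end RAM

/-! ### Loop bounds and the bound on all numbers -/

namespace RAM

open Term Finset

variable {σ : Store} {M B : ℕ}

theorem exec_assign (hM : M < 2 ^ B) (h : σ.Bdd M) (x : ℕ) (e : Term) (he : e.value σ ≤ M) :
    (σ.setReg x (e.value σ)).Bdd M ∧ ∃ k ≤ (1 + e.weight) * (B + 1),
      Exec (Prog.assign x e) σ (σ.setReg x (e.value σ)) k := by
  refine ⟨h.setReg he, _, ?_, Exec.assign σ x e⟩
  have := e.cost_le hM h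
  rw [add_mul, one_mul]
  omega

/-- Multiply register `4` by `a + 2` for all entries `a` of the input. -/
def boundLoop : Prog :=
  Prog.loop ((reg 5).lt (reg 1))
    (Prog.seq (Prog.assign 4 (reg 4 * (cell 0 (reg 5) + 2))) (Prog.assign 5 (reg 5 + 1)))

/-- Compute the loop bounds and the bound on all numbers in the registers `1` to `4`. -/
def prelude : Prog :=
  Prog.seq (Prog.assign 1 (reg 0)) <| Prog.seq (Prog.assign 2 (cell 0 0)) <|
  Prog.seq (Prog.assign 3 (reg 2 * reg 2)) <| Prog.seq (Prog.assign 4 1) <|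
  Prog.seq boundLoop <| Prog.seq (Prog.assign 4 (reg 4 * reg 4)) <|
  Prog.seq (Prog.assign 4 (reg 4 * reg 4)) <| Prog.assign 4 (reg 4 * reg 4)

/-- The last `m` rounds of the loop. -/
theorem exec_boundLoop {f : ℕ → ℕ} {L : ℕ} (hM : M < 2 ^ B) (hf : boundProd f L ≤ M) (hL : L ≤ M)
    (m : ℕ) {i : ℕ} (hi : i + m = L) {σ : Store} (hσ : σ.Bdd M) (h1 : σ.reg 1 = L)
    (h4 : σ.reg 4 = boundProd f i) (h5 : σ.reg 5 = i) (h0 : σ.arr 0 = f) :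
    ∃ τ, τ.Bdd M ∧ τ.reg 4 = boundProd f L ∧ (∀ r, r ≠ 4 → r ≠ 5 → τ.reg r = σ.reg r) ∧
      τ.arr = σ.arr ∧ ∃ k ≤ (m + 1) * (40 * (B + 1)), Exec boundLoop σ τ k := by
  have hcost := ((reg 5).lt (reg 1)).cost_le hM hσ
  have hw : ((reg 5).lt (reg 1)).weight = 5 := by decide
  rw [hw] at hcost
  induction m generalizing i σ with
  | zero =>
    refine ⟨σ, hσ, by rw [h4, ← hi, add_zero], fun _ _ _ => rfl, rfl, _, ?_,
      Exec.loop_false (by simp [h1, h5, ← hi])⟩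
    omega
  | succ m ih =>
    have hsucc : boundProd f (i + 1) = boundProd f i * (f i + 2) := prod_range_succ _ _
    have hv : (reg 4 * (cell 0 (reg 5) + 2)).value σ = boundProd f (i + 1) := by
      simp [h4, h5, h0, hsucc]
    obtain ⟨hb₁, k₁, hk₁, he₁⟩ := exec_assign hM hσ 4 (reg 4 * (cell 0 (reg 5) + 2))
      (by rw [hv]; exact (boundProd_mono f (by omega)).trans hf)
    rw [hv] at hb₁ he₁
    have hv₂ : (reg 5 + 1).value (σ.setReg 4 (boundProd f (i + 1))) = i + 1 := by simp [h5]
    obtain ⟨hb₂, k₂, hk₂, he₂⟩ := exec_assign hM hb₁ 5 (reg 5 + 1) (by rw [hv₂]; omega)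
    rw [hv₂] at hb₂ he₂
    obtain ⟨τ, hτ, hτ4, hτr, hτa, k, hk, he⟩ := ih (i := i + 1) (by omega) hb₂ (by simpa using h1)
      (by simp) (by simp) h0 (by
        have := ((reg 5).lt (reg 1)).cost_le hM hb₂
        rwa [hw] at this)
    refine ⟨τ, hτ, hτ4, fun r hr4 hr5 => by rw [hτr r hr4 hr5]; simp [hr4, hr5],
      by rw [hτa]; rfl, _, ?_, Exec.loop_true (by simp [h1, h5]; omega) (he₁.seq he₂) he⟩
    have hw₁ : (reg 4 * (cell 0 (reg 5) + 2)).weight ≤ 20 := by decide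
    have hw₂ : (reg 5 + 1).weight ≤ 8 := by decide
    have h6 := hk₁.trans (Nat.mul_le_mul_right (B + 1) (Nat.add_le_add_left hw₁ 1))
    have h7 := hk₂.trans (Nat.mul_le_mul_right (B + 1) (Nat.add_le_add_left hw₂ 1))
    rw [add_mul _ 1, one_mul]
    omega

/-- The prelude is not a bounded loop program, as it computes the loop bounds, so its time is
estimated directly. Three squarings turn the product into its eighth power. -/
theorem exec_prelude (l : List ℕ) : ∃ σ : Store, ∃ M,
    M = boundProd (fun i => l.getD i 0) l.length ^ 8 ∧ M < 2 ^ (8 * bitSize l + 1) ∧ σ.Bdd M ∧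
    σ.reg 1 = l.length ∧ σ.reg 2 = l.getD 0 0 ∧
    σ.reg 3 = l.getD 0 0 * l.getD 0 0 ∧ σ.reg 4 = M ∧ σ.arr = (initial l).arr ∧
    ∃ k ≤ (40 * bitSize l + 120) * (8 * bitSize l + 2), Exec prelude (initial l) σ k := by
  obtain ⟨f, hf⟩ : ∃ f : ℕ → ℕ, f = fun i => l.getD i 0 := ⟨_, rfl⟩
  obtain ⟨X, hX⟩ : ∃ X, X = boundProd f l.length := ⟨_, rfl⟩
  obtain ⟨B, hB⟩ : ∃ B, B = 8 * bitSize l + 1 := ⟨_, rfl⟩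
  have hM : X ^ 8 < 2 ^ B := by
    have := Nat.pow_le_pow_left (boundProd_le_two_pow l) 8
    rw [← pow_mul, ← hf, ← hX] at this
    refine this.trans_lt (Nat.pow_lt_pow_right (by norm_num) (by omega))
  have hX1 : 1 ≤ X := by
    rw [hX]
    exact Nat.succ_le_of_lt (prod_pos fun i _ => Nat.succ_pos (f i + 1))
  have hXM : X ≤ X ^ 8 := Nat.le_self_pow (by norm_num) X
  have hlX : l.length ≤ X := hX ▸ Nat.lt_two_pow_self.le.trans (two_pow_le_boundProd f _)
  have hfX : ∀ i, f i ≤ X := fun i => by rw [hX, hf]; exact getD_le_boundProd l i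
  have hpow : ∀ j, j ≤ 8 → X ^ j ≤ X ^ 8 := fun j => Nat.pow_le_pow_right hX1
  have harr : (initial l).arr 0 = f := by rw [hf]; rfl
  have hb₀ : (initial l).Bdd (X ^ 8) := by
    refine ⟨fun r => ?_, fun a i => ?_⟩
    · simp only [initial]; split_ifs <;> omega
    · by_cases ha : a = 0
      · rw [ha, harr]; exact (hfX i).trans hXM
      · simp [initial, ha]
  rw [← hf, ← hX, ← hB, show 8 * bitSize l + 2 = B + 1 by omega]
  obtain ⟨hb₁, k₁, hk₁, he₁⟩ := exec_assign hM hb₀ 1 (reg 0) (hlX.trans hXM)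
  obtain ⟨σ₁, hσ₁⟩ : ∃ τ, τ = (initial l).setReg 1 ((reg 0).value (initial l)) := ⟨_, rfl⟩
  rw [← hσ₁] at hb₁ he₁
  have v₂ : (cell 0 0).value σ₁ = f 0 := by rw [hσ₁, ← harr]; rfl
  obtain ⟨hb₂, k₂, hk₂, he₂⟩ := exec_assign hM hb₁ 2 (cell 0 0)
    (by rw [v₂]; exact (hfX 0).trans hXM)
  rw [v₂] at hb₂ he₂
  obtain ⟨σ₂, hσ₂⟩ : ∃ τ, τ = σ₁.setReg 2 (f 0) := ⟨_, rfl⟩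
  rw [← hσ₂] at hb₂ he₂
  have v₃ : (reg 2 * reg 2).value σ₂ = f 0 * f 0 := by simp [hσ₂]
  obtain ⟨hb₃, k₃, hk₃, he₃⟩ := exec_assign hM hb₂ 3 (reg 2 * reg 2) (by
    rw [v₃]
    refine le_trans (Nat.mul_le_mul (hfX 0) (hfX 0)) ?_
    rw [← sq]
    exact hpow 2 (by norm_num))
  rw [v₃] at hb₃ he₃
  obtain ⟨σ₃, hσ₃⟩ : ∃ τ, τ = σ₂.setReg 3 (f 0 * f 0) := ⟨_, rfl⟩
  rw [← hσ₃] at hb₃ he₃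
  obtain ⟨hb₄, k₄, hk₄, he₄⟩ := exec_assign hM hb₃ 4 1 (le_trans (by simp) (hX1.trans hXM))
  obtain ⟨σ₄, hσ₄⟩ : ∃ τ, τ = σ₃.setReg 4 ((1 : Term).value σ₃) := ⟨_, rfl⟩
  rw [← hσ₄] at hb₄ he₄
  obtain ⟨σ₅, hb₅, h45, hr₅, ha₅, k₅, hk₅, he₅⟩ := exec_boundLoop (f := f) (L := l.length) hM
    (hX ▸ hXM) (hlX.trans hXM) l.length (i := 0) (by omega) hb₄
    (by simp [hσ₄, hσ₃, hσ₂, hσ₁, initial]) (by simp [hσ₄, boundProd])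
    (by simp [hσ₄, hσ₃, hσ₂, hσ₁, initial]) (by rw [← harr, hσ₄, hσ₃, hσ₂, hσ₁]; rfl)
  rw [← hX] at h45
  have v₆ : (reg 4 * reg 4).value σ₅ = X ^ 2 := by simp [h45, sq]
  obtain ⟨hb₆, k₆, hk₆, he₆⟩ := exec_assign hM hb₅ 4 (reg 4 * reg 4)
    (by rw [v₆]; exact hpow 2 (by norm_num))
  rw [v₆] at hb₆ he₆
  have v₇ : (reg 4 * reg 4).value (σ₅.setReg 4 (X ^ 2)) = X ^ 4 := by simp; ring
  obtain ⟨hb₇, k₇, hk₇, he₇⟩ := exec_assign hM hb₆ 4 (reg 4 * reg 4)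
    (by rw [v₇]; exact hpow 4 (by norm_num))
  rw [v₇] at hb₇ he₇
  have v₈ : (reg 4 * reg 4).value ((σ₅.setReg 4 (X ^ 2)).setReg 4 (X ^ 4)) = X ^ 8 := by simp; ring
  obtain ⟨hb₈, k₈, hk₈, he₈⟩ := exec_assign hM hb₇ 4 (reg 4 * reg 4) (by rw [v₈])
  rw [v₈] at hb₈ he₈
  refine ⟨_, X ^ 8, rfl, hM, hb₈, ?_, ?_, ?_, by simp, ?_, _, ?_, he₁.seq <| he₂.seq <| he₃.seq <|
    he₄.seq <| he₅.seq <| he₆.seq <| he₇.seq he₈⟩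
  · simp [hr₅, hσ₄, hσ₃, hσ₂, hσ₁, initial]
  · rw [show l.getD 0 0 = f 0 by rw [hf]]
    simp [hr₅, hσ₄, hσ₃, hσ₂]
  · rw [show l.getD 0 0 = f 0 by rw [hf]]
    simp [hr₅, hσ₄, hσ₃]
  · change σ₅.arr = _
    rw [ha₅, hσ₄, hσ₃, hσ₂, hσ₁]; rfl
  · have w₁ : (reg 0).weight = 1 := rfl
    have w₂ : (cell 0 0).weight = 2 := by decide
    have w₃ : (reg 2 * reg 2).weight = 5 := by decide
    have w₄ : (1 : Term).weight = 2 := by decide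
    have w₅ : (reg 4 * reg 4).weight = 5 := by decide
    rw [w₁] at hk₁
    rw [w₂] at hk₂
    rw [w₃] at hk₃
    rw [w₄] at hk₄
    rw [w₅] at hk₆ hk₇ hk₈
    have h9 : (l.length + 1) * (40 * (B + 1)) ≤ (40 * bitSize l + 40) * (B + 1) := by
      rw [← mul_assoc]
      have := length_le_bitSize l
      exact Nat.mul_le_mul_right _ (by omega)
    have h10 : (40 * bitSize l + 120) * (B + 1) =
      (40 * bitSize l + 40) * (B + 1) + 80 * (B + 1) := by ring
    rw [h10]
    omega

end RAM

/-! ### Writing the output -/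

namespace RAM

open Term Cmd
open SteinerInstance (matrixList getElem_matrixList length_matrixList)
open scoped Classical

variable {n : ℕ} {σ τ : Store} {dem : Fin n → Fin n → Prop} {lab : Fin n → Fin n}
  {H : SimpleGraph (Fin n)}

/-- The list `l` has been appended to the output, whose entry `0` is filled in at the very end. -/
structure Written (σ : Store) (l : List ℕ) : Prop where
  reg5 : σ.reg 5 = 1 + l.length
  arr0 : ∀ (j : ℕ) (h : j < l.length), σ.arr 0 (1 + j) = l[j]

theorem Written.congr {l : List ℕ} (h : Written σ l) (h5 : τ.reg 5 = σ.reg 5)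
    (h0 : τ.arr 0 = σ.arr 0) : Written τ l := ⟨h5.trans h.reg5, fun j hj => h0 ▸ h.arr0 j hj⟩

/-- Neither the value nor the new length of the output is clamped. -/
theorem emit_spec {l : List ℕ} (h : Written σ l) {e : Term} (he : e.value σ ≤ σ.reg 4)
    (hl : l.length + 2 ≤ σ.reg 4) : Written ((emit e).den σ) (l ++ [e.value σ]) := by
  have h5 := h.reg5
  constructor
  · simp [emit, den, h5]
    omega
  · intro j hj
    simp only [emit, den, Store.setReg_arr, Store.setCell_arr, value_reg, h5, true_and,
      Nat.add_left_cancel_iff, min_eq_left he]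
    rw [List.getElem_append]
    split_ifs with h1 h2 h2
    · omega
    · simp
    · exact h.arr0 j h2
    · simp at hj; omega

/-- A loop that appends the values of a function `g`, of which the term may assume that nothing but
the output and the two counters has changed. -/
theorem for_emit_spec {l : List ℕ} {b N : ℕ} {e : Term} {g : ℕ → ℕ} (h : Written σ l)
    (hb : σ.reg b = N) (hl : l.length + N + 1 ≤ σ.reg 4) (hg : ∀ i < N, g i ≤ σ.reg 4)
    (he : ∀ τ : Store, (∀ r, r ≠ 5 → r ≠ 7 → τ.reg r = σ.reg r) →
      (∀ a, a ≠ 0 → τ.arr a = σ.arr a) → τ.reg 7 < N → e.value τ = g (τ.reg 7)) :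
    Written ((Cmd.for 7 b (emit e)).den σ) (l ++ (List.range N).map g) := by
  subst hb
  refine Cmd.for_rule (σ := σ) (fun i τ => Written τ (l ++ (List.range i).map g))
    (fun i τ v h => h.congr (by simp) rfl) (by simpa using h) fun i hi τ hr ha hx hP => ?_
  have hr' : ∀ r, r ≠ 5 → r ≠ 7 → τ.reg r = σ.reg r := fun r h5 h7 =>
    hr r h7 (by simp [emit, regs, h5])
  have hv := he τ hr' (fun a h => ha a (by simp [emit, arrs, h])) (by omega)
  have h4 := hr' 4 (by decide) (by decide)
  rw [List.range_succ, List.map_append, List.map_singleton, ← List.append_assoc, ← hx, ← hv]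
  refine emit_spec (hx ▸ hP) ?_ ?_
  · rw [hv, h4, hx]; exact hg i hi
  · simp only [List.length_append, List.length_map, List.length_range]
    omega

/-- The part of the output for the cluster with label `v`. -/
noncomputable def block (H : SimpleGraph (Fin n)) (dem : Fin n → Fin n → Prop)
    (lab : Fin n → Fin n) (v : ℕ) : List ℕ :=
  (List.ofFn fun x : Fin n => if lab x = v then 1 else 0) ++
    (matrixList fun x y => if H.Adj x y ∧ lab x = v then 1 else 0) ++
    matrixList fun x y => if dem x y ∧ lab x = v then 1 else 0

@[simp] theorem length_block (v : ℕ) : (block H dem lab v).length = n + n * n + n * n := by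
  simp [block, add_assoc]

theorem ofFn_eq_map {g : Fin n → ℕ} {f : ℕ → ℕ} (h : ∀ x : Fin n, f x = g x) :
    List.ofFn g = (List.range n).map f :=
  List.ext_getElem (by simp) fun i hi _ => by
    simp only [List.length_ofFn] at hi
    simpa using (h ⟨i, hi⟩).symm

theorem matrixList_eq_map {g : Fin n → Fin n → ℕ} {f : ℕ → ℕ}
    (h : ∀ x y : Fin n, f (x * n + y) = g x y) : matrixList g = (List.range (n * n)).map f :=
  List.ext_getElem (by simp) fun i hi _ => by
    obtain ⟨x, y, rfl⟩ := exists_index (by simpa using hi)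
    rw [getElem_matrixList]
    simp [h]

theorem for_emit_matrix {l : List ℕ} {a v : ℕ} {R : Fin n → Fin n → Prop} (h : Written σ l)
    (h2 : σ.reg 2 = n) (h3 : σ.reg 3 = n * n) (h5 : ∀ x : Fin n, σ.arr 5 x = lab x)
    (h20 : σ.reg 20 = v) (ha : a ≠ 0) (hR : IsMatrix σ a R) (hl : l.length + n * n + 1 ≤ σ.reg 4) :
    Written ((Cmd.for 7 3 (emit (cell a (reg 7) * (rowLab 7).eq (reg 20)))).den σ)
      (l ++ matrixList fun x y : Fin n => if R x y ∧ lab x = v then 1 else 0) := by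
  obtain ⟨f, hf⟩ : ∃ f : ℕ → ℕ, f = fun j =>
    if ∃ a b : Fin n, j = a * n + b ∧ R a b ∧ lab a = v then 1 else 0 := ⟨_, rfl⟩
  have key : ∀ x y : Fin n, f (x * n + y) = if R x y ∧ lab x = v then 1 else 0 := by
    intro x y
    rw [hf]
    by_cases k1 : R x y ∧ lab x = v
    · exact (if_pos ⟨x, y, rfl, k1⟩).trans (if_pos k1).symm
    · refine (if_neg ?_).trans (if_neg k1).symm
      rintro ⟨a', b', k2, k3⟩
      obtain ⟨rfl, rfl⟩ := index_inj.1 k2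
      exact k1 k3
  rw [matrixList_eq_map key]
  refine for_emit_spec h h3 hl (fun j _ => ?_) fun τ hr' ha' hx => ?_
  · rw [hf]
    dsimp only
    split_ifs <;> omega
  · obtain ⟨x, y, hxy⟩ := exists_index hx
    rw [hxy]
    refine Eq.trans ?_ (key x y).symm
    rw [value_mul, value_cell, value_reg, hxy, value_eq,
      value_rowLab ((hr' 2 (by decide) (by decide)).trans h2) hxy, ha' 5 (by decide), h5,
      value_reg, hr' 20 (by decide) (by decide), h20, ha' a ha, hR x y]
    by_cases k1 : R x y <;> by_cases k2 : (lab x : ℕ) = v <;> simp [k1, k2]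

theorem for_emit_vector {l : List ℕ} {v : ℕ} (h : Written σ l)
    (h2 : σ.reg 2 = n) (h5 : ∀ x : Fin n, σ.arr 5 x = lab x)
    (h20 : σ.reg 20 = v) (hl : l.length + n + 1 ≤ σ.reg 4) :
    Written ((Cmd.for 7 2 (emit ((cell 5 (reg 7)).eq (reg 20)))).den σ)
      (l ++ List.ofFn fun x : Fin n => if lab x = v then 1 else 0) := by
  rw [ofFn_eq_map (f := fun j => if σ.arr 5 j = v then 1 else 0) (fun x => by rw [h5])]
  refine for_emit_spec h h2 hl (fun j _ => ?_) fun τ hr' ha' hx => ?_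
  · split_ifs <;> omega
  · rw [value_eq, value_cell, value_reg, value_reg, ha' 5 (by decide),
      hr' 20 (by decide) (by decide), h20]

theorem hasDemand_spec {v : ℕ} (h2 : σ.reg 2 = n) (h3 : σ.reg 3 = n * n) (hd : IsMatrix σ 2 dem)
    (h5 : ∀ x : Fin n, σ.arr 5 x = lab x) (h20 : σ.reg 20 = v) (h12 : σ.reg 12 = 0) :
    ((Cmd.for 7 3 (branch (cell 2 (reg 7) * (rowLab 7).eq (reg 20)) (assign 12 1) skip)).den
      σ).reg 12 ≠ 0 ↔ ∃ x y, dem x y ∧ lab x = v := by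
  have key := Cmd.for_rule (σ := σ) (x := 7) (b := 3)
    (p := branch (cell 2 (reg 7) * (rowLab 7).eq (reg 20)) (assign 12 1) skip)
    (fun i τ => τ.reg 12 ≠ 0 ↔ ∃ x y : Fin n, (x : ℕ) * n + y < i ∧ dem x y ∧ lab x = v)
    (fun i τ v h => by simpa using h) (by simp [h12]) ?_
  · rw [key, h3]
    exact ⟨fun ⟨x, y, h⟩ => ⟨x, y, h.2⟩, fun ⟨x, y, h⟩ => ⟨x, y, index_lt x y, h⟩⟩
  · intro i hi τ hr ha hx hP
    rw [h3] at hi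
    obtain ⟨a, b, rfl⟩ := exists_index hi
    have hreg : ∀ r, r ≠ 7 → r ≠ 12 → τ.reg r = σ.reg r := fun r h1 h2 =>
      hr r h1 (by simp [regs, h2])
    have harr : ∀ a, τ.arr a = σ.arr a := fun a => ha a (by simp [arrs])
    have h2τ : τ.reg 2 = n := (hreg 2 (by decide) (by decide)).trans h2
    have hcond : (cell 2 (reg 7) * (rowLab 7).eq (reg 20)).value τ =
        if dem a b ∧ lab a = v then 1 else 0 := by
      simp only [value_mul, value_cell, value_reg, hx, harr, hd a b, value_eq,
        value_rowLab h2τ hx, h5, hreg 20 (by decide) (by decide), h20]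
      by_cases h1 : dem a b <;> by_cases h2 : (lab a : ℕ) = v <;> simp [h1, h2]
    have hext : (∃ x y : Fin n, (x : ℕ) * n + y < a * n + b + 1 ∧ dem x y ∧ lab x = v) ↔
        (dem a b ∧ lab a = v) ∨
          ∃ x y : Fin n, (x : ℕ) * n + y < a * n + b ∧ dem x y ∧ lab x = v := by
      constructor
      · rintro ⟨x, y, hlt, h⟩
        rcases Nat.lt_succ_iff_lt_or_eq.1 hlt with h1 | h1
        · exact Or.inr ⟨x, y, h1, h⟩
        · obtain ⟨rfl, rfl⟩ := index_inj.1 h1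
          exact Or.inl h
      · rintro (h | ⟨x, y, hlt, h⟩)
        · exact ⟨a, b, Nat.lt_succ_self _, h⟩
        · exact ⟨x, y, hlt.trans (Nat.lt_succ_self _), h⟩
    rw [hext, Cmd.den, hcond]
    by_cases hc : dem a b ∧ lab a = v
    · simp [hc, Cmd.den]
    · rw [if_neg hc, if_pos rfl, or_iff_right hc]
      exact hP

/-- The labels of the clusters with a demand. -/
noncomputable def labels (dem : Fin n → Fin n → Prop) (lab : Fin n → Fin n) (i : ℕ) : List ℕ :=
  (List.range i).filter fun v => ∃ x y, dem x y ∧ lab x = v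

theorem labels_succ (i : ℕ) : labels dem lab (i + 1) =
    labels dem lab i ++ if ∃ x y, dem x y ∧ lab x = i then [i] else [] := by
  simp only [labels, List.range_succ, List.filter_append, List.filter_singleton]
  by_cases h : ∃ x y, dem x y ∧ lab x = i <;> simp

theorem length_labels_le (i : ℕ) : (labels dem lab i).length ≤ i :=
  (List.length_filter_le _ _).trans_eq List.length_range

theorem mem_labels {v : ℕ} : v ∈ labels dem lab n ↔ ∃ x y, dem x y ∧ (lab x : ℕ) = v := by
  rw [labels, List.mem_filter, List.mem_range, decide_eq_true_eq]
  exact ⟨fun h => h.2, fun ⟨x, y, h1, h2⟩ => ⟨h2 ▸ (lab x).isLt, x, y, h1, h2⟩⟩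

theorem nodup_labels (i : ℕ) : (labels dem lab i).Nodup := List.nodup_range.filter _

theorem length_flatMap_block (l : List ℕ) :
    (l.flatMap (block H dem lab)).length = l.length * (n + n * n + n * n) := by
  induction l with
  | nil => simp
  | cons a l ih => simp [ih, add_mul]; ring

/-- The output is the number of clusters with a demand, followed by their parts. -/
theorem writeOutput_spec {M : ℕ} (h2 : σ.reg 2 = n) (h3 : σ.reg 3 = n * n) (h4 : σ.reg 4 = M)
    (hd : IsMatrix σ 2 dem) (hH : IsMatrix σ 4 H.Adj) (h5 : ∀ x : Fin n, σ.arr 5 x = lab x)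
    (hM : n * (n + n * n + n * n) + 1 ≤ M) (hnM : n ≤ M) :
    (writeOutput.den σ).output = (labels dem lab n).length ::
      (labels dem lab n).flatMap (block H dem lab) := by
  unfold writeOutput
  simp only [den_seq]
  obtain ⟨σ₁, hσ₁⟩ : ∃ τ, τ = (assign 6 0).den ((assign 5 1).den σ) := ⟨_, rfl⟩
  rw [← hσ₁]
  obtain ⟨S, hS⟩ : ∃ S, S =
    Cmd.for 7 3 (branch (cell 2 (reg 7) * (rowLab 7).eq (reg 20)) (assign 12 1) skip) := ⟨_, rfl⟩
  rw [← hS]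
  obtain ⟨E₁, hE₁⟩ : ∃ E, E = Cmd.for 7 2 (emit ((cell 5 (reg 7)).eq (reg 20))) := ⟨_, rfl⟩
  obtain ⟨E₂, hE₂⟩ : ∃ E, E = Cmd.for 7 3 (emit (cell 4 (reg 7) * (rowLab 7).eq (reg 20))) :=
    ⟨_, rfl⟩
  obtain ⟨E₃, hE₃⟩ : ∃ E, E = Cmd.for 7 3 (emit (cell 2 (reg 7) * (rowLab 7).eq (reg 20))) :=
    ⟨_, rfl⟩
  rw [← hE₁, ← hE₂, ← hE₃]
  obtain ⟨C, hC⟩ : ∃ C, C = (assign 12 0 ;; S ;; branch (reg 12) (assignC 6 (reg 6 + 1) ;;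
    E₁ ;; E₂ ;; E₃) skip) := ⟨_, rfl⟩
  rw [← hC]
  have hCr : ∀ r ∈ C.regs, r = 5 ∨ r = 6 ∨ r = 7 ∨ r = 12 := by
    rw [hC, hS, hE₁, hE₂, hE₃]; decide
  have hCa : ∀ a ∈ C.arrs, a = 0 := by rw [hC, hS, hE₁, hE₂, hE₃]; decide
  have hSr : ∀ r ∈ S.regs, r = 7 ∨ r = 12 := by rw [hS]; decide
  have hSa : S.arrs = [] := by rw [hS]; rfl
  have hr₁ : ∀ r, r ≠ 5 → r ≠ 6 → σ₁.reg r = σ.reg r := fun r h5 h6 => by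
    rw [hσ₁]; simp [den, h5, h6]
  have ha₁ : ∀ a, σ₁.arr a = σ.arr a := fun a => by rw [hσ₁]; rfl
  have key := Cmd.for_rule (σ := σ₁) (x := 20) (b := 2) (p := C)
    (fun i τ => Written τ ((labels dem lab i).flatMap (block H dem lab)) ∧
      τ.reg 6 = (labels dem lab i).length)
    (fun i τ v h => ⟨h.1.congr (by simp) rfl, by simpa using h.2⟩)
    ⟨⟨by rw [hσ₁]; simp [labels, den], fun j hj => by simp [labels] at hj⟩,
      by rw [hσ₁]; simp [labels, den]⟩ ?_
  · obtain ⟨υ, hυ⟩ : ∃ τ, τ = (Cmd.for 20 2 C).den σ₁ := ⟨_, rfl⟩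
    rw [← hυ, hr₁ 2 (by decide) (by decide), h2] at key
    rw [← hυ]
    obtain ⟨⟨k5, k0⟩, k6⟩ := key
    obtain ⟨m, hm⟩ : ∃ m, m = (labels dem lab n).flatMap (block H dem lab) := ⟨_, rfl⟩
    rw [← hm]
    simp only [← hm] at k5 k0
    have e0 : ((assign 0 (reg 5)).den ((store 0 0 (reg 6)).den υ)).reg 0 = m.length + 1 := by
      simp [den, k5, add_comm]
    rw [Store.output, e0, List.range_succ_eq_map, List.map_cons, List.map_map]
    refine congrArg₂ List.cons (by simp [den, k6]) ?_
    refine List.ext_getElem (by simp) fun j hj hj' => ?_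
    rw [← k0 j hj', add_comm 1 j]
    simp [den]
  · rintro i hi τ hr ha hx ⟨hw, h6⟩
    rw [hr₁ 2 (by decide) (by decide), h2] at hi
    have hrτ : ∀ r, r ≠ 5 → r ≠ 6 → r ≠ 7 → r ≠ 12 → r ≠ 20 → τ.reg r = σ.reg r := by
      intro r k5 k6 k7 k12 k20
      rw [hr r k20 (fun h => by have := hCr r h; omega), hr₁ r k5 k6]
    have haτ : ∀ a, a ≠ 0 → τ.arr a = σ.arr a := fun a h => by
      rw [ha a fun h' => h (hCa a h'), ha₁]
    rw [hC]
    simp only [den_seq]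
    have hcheck := hasDemand_spec (σ := (assign 12 0).den τ) (dem := dem) (lab := lab) (v := i)
      ((hrτ 2 (by decide) (by decide) (by decide) (by decide) (by decide)).trans h2)
      ((hrτ 3 (by decide) (by decide) (by decide) (by decide) (by decide)).trans h3)
      (fun x y => by rw [den_arr _ _ (by simp [arrs]), haτ 2 (by decide)]; exact hd x y)
      (fun x => by rw [den_arr _ _ (by simp [arrs]), haτ 5 (by decide)]; exact h5 x)
      hx (by simp [den])
    rw [← hS] at hcheck
    obtain ⟨τ₁, hτ₁⟩ : ∃ τ', τ' = S.den ((assign 12 0).den τ) := ⟨_, rfl⟩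
    rw [← hτ₁] at hcheck ⊢
    have hr₂ : ∀ r, r ≠ 7 → r ≠ 12 → τ₁.reg r = τ.reg r := fun r k7 k12 => by
      rw [hτ₁, den_reg _ _ (fun h => by have := hSr r h; omega),
        den_reg _ _ (by simpa [regs] using k12)]
    have ha₂ : ∀ a, τ₁.arr a = τ.arr a := fun a => by
      rw [hτ₁, den_arr _ _ (by simp [hSa]), den_arr _ _ (by simp [arrs])]
    have hw₁ : Written τ₁ ((labels dem lab i).flatMap (block H dem lab)) :=
      hw.congr (hr₂ 5 (by decide) (by decide)) (ha₂ 0)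
    have h6₁ : τ₁.reg 6 = (labels dem lab i).length := (hr₂ 6 (by decide) (by decide)).trans h6
    rw [labels_succ, Cmd.den, value_reg]
    by_cases hv : ∃ x y, dem x y ∧ lab x = i
    swap
    · rw [if_pos (not_not.1 (mt hcheck.1 hv)), if_neg hv, List.append_nil]
      exact ⟨hw₁, h6₁⟩
    rw [if_neg (hcheck.2 hv), if_pos hv]
    simp only [den_seq]
    obtain ⟨τ₂, hτ₂⟩ : ∃ τ', τ' = (assignC 6 (reg 6 + 1)).den τ₁ := ⟨_, rfl⟩
    rw [← hτ₂]
    have hr₃ : ∀ r, r ≠ 5 → r ≠ 6 → r ≠ 7 → r ≠ 12 → r ≠ 20 → τ₂.reg r = σ.reg r := by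
      intro r k5 k6 k7 k12 k20
      rw [hτ₂, den_reg _ _ (by simpa [regs] using k6), hr₂ r k7 k12, hrτ r k5 k6 k7 k12 k20]
    have ha₃ : ∀ a, a ≠ 0 → τ₂.arr a = σ.arr a := fun a h => by
      rw [hτ₂, den_arr _ _ (by simp [arrs]), ha₂, haτ a h]
    have h4₂ : τ₂.reg 4 = M :=
      (hr₃ 4 (by decide) (by decide) (by decide) (by decide) (by decide)).trans h4
    have h20₂ : τ₂.reg 20 = i := by
      rw [hτ₂, den_reg _ _ (by simp [regs]), hr₂ 20 (by decide) (by decide), hx]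
    have h6₂ : τ₂.reg 6 = (labels dem lab i).length + 1 := by
      have hlen := length_labels_le (dem := dem) (lab := lab) i
      have h4₁ : τ₁.reg 4 = M := by
        rw [hr₂ 4 (by decide) (by decide),
          hrτ 4 (by decide) (by decide) (by decide) (by decide) (by decide), h4]
      rw [hτ₂]
      simp only [Cmd.den, Store.setReg_reg, value_add, value_reg, value_ofNat, h6₁, h4₁, if_true]
      omega
    have hw₂ : Written τ₂ ((labels dem lab i).flatMap (block H dem lab)) :=
      hw₁.congr (by rw [hτ₂, den_reg _ _ (by simp [regs])])
        (by rw [hτ₂, den_arr _ _ (by simp [arrs])])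
    have hcap : ((labels dem lab i).flatMap (block H dem lab)).length +
        (n + n * n + n * n) + 1 ≤ M := by
      refine le_trans (Nat.add_le_add_right ?_ 1) hM
      rw [length_flatMap_block, ← Nat.succ_mul]
      exact Nat.mul_le_mul_right _
        ((Nat.succ_le_succ (length_labels_le (dem := dem) (lab := lab) i)).trans hi)
    have h2₂ := (hr₃ 2 (by decide) (by decide) (by decide) (by decide) (by decide)).trans h2
    have h3₂ := (hr₃ 3 (by decide) (by decide) (by decide) (by decide) (by decide)).trans h3
    have hw₃ := for_emit_vector (lab := lab) hw₂ h2₂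
      (fun x => by rw [ha₃ 5 (by decide)]; exact h5 x) h20₂ (by omega)
    rw [← hE₁] at hw₃
    obtain ⟨τ₃, hτ₃⟩ : ∃ τ', τ' = E₁.den τ₂ := ⟨_, rfl⟩
    rw [← hτ₃] at hw₃ ⊢
    have hr₄ : ∀ r, r ≠ 5 → r ≠ 7 → τ₃.reg r = τ₂.reg r := fun r k5 k7 => by
      rw [hτ₃, hE₁, den_reg _ _ (by simp [regs, emit, k5, k7])]
    have ha₄ : ∀ a, a ≠ 0 → τ₃.arr a = σ.arr a := fun a h => by
      rw [hτ₃, hE₁, den_arr _ _ (by simp [arrs, emit, h]), ha₃ a h]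
    have hw₄ := for_emit_matrix (a := 4) (R := H.Adj) (lab := lab) hw₃
      ((hr₄ 2 (by decide) (by decide)).trans h2₂) ((hr₄ 3 (by decide) (by decide)).trans h3₂)
      (fun x => by rw [ha₄ 5 (by decide)]; exact h5 x) ((hr₄ 20 (by decide) (by decide)).trans h20₂)
      (by decide) (fun x y => by rw [ha₄ 4 (by decide)]; exact hH x y)
      (by rw [hr₄ 4 (by decide) (by decide), List.length_append, List.length_ofFn]; omega)
    rw [← hE₂] at hw₄
    obtain ⟨τ₄, hτ₄⟩ : ∃ τ', τ' = E₂.den τ₃ := ⟨_, rfl⟩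
    rw [← hτ₄] at hw₄ ⊢
    have hr₅ : ∀ r, r ≠ 5 → r ≠ 7 → τ₄.reg r = τ₂.reg r := fun r k5 k7 => by
      rw [hτ₄, hE₂, den_reg _ _ (by simp [regs, emit, k5, k7]), hr₄ r k5 k7]
    have ha₅ : ∀ a, a ≠ 0 → τ₄.arr a = σ.arr a := fun a h => by
      rw [hτ₄, hE₂, den_arr _ _ (by simp [arrs, emit, h]), ha₄ a h]
    have hw₅ := for_emit_matrix (a := 2) (R := dem) (lab := lab) hw₄
      ((hr₅ 2 (by decide) (by decide)).trans h2₂) ((hr₅ 3 (by decide) (by decide)).trans h3₂)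
      (fun x => by rw [ha₅ 5 (by decide)]; exact h5 x) ((hr₅ 20 (by decide) (by decide)).trans h20₂)
      (by decide) (fun x y => by rw [ha₅ 2 (by decide)]; exact hd x y)
      (by
        rw [hr₅ 4 (by decide) (by decide), List.length_append, List.length_append, List.length_ofFn,
          length_matrixList]
        omega)
    rw [← hE₃] at hw₅
    constructor
    · rw [List.flatMap_append, List.flatMap_singleton, block]
      simpa only [List.append_assoc] using hw₅
    · rw [hE₃, den_reg _ _ (by simp [regs, emit]), hr₅ 6 (by decide) (by decide), h6₂]
      simp

end RAM

/-! ### The clusters of a forest -/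

namespace SteinerInstance

open Finset RAM
open scoped Classical

variable {I : SteinerInstance} {H : SimpleGraph (Fin I.n)} {lab : Fin I.n → Fin I.n}

/-- The subgraph on the vertices with label `v`. -/
def labelSubgraph (hH : H ≤ I.graph) (hadj : ∀ x y, H.Adj x y → lab x = lab y) (v : ℕ) :
    I.graph.Subgraph where
  verts := {x | (lab x : ℕ) = v}
  Adj x y := H.Adj x y ∧ (lab x : ℕ) = v
  adj_sub h := hH h.1
  edge_vert h := h.2
  symm := ⟨fun x y h => ⟨h.1.symm, hadj x y h.1 ▸ h.2⟩⟩

/-- The clusters of a forest whose components are labelled by `lab`, for the labels in the list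
`ls`. -/
noncomputable def clustering (hH : H ≤ I.graph) (hadj : ∀ x y, H.Adj x y → lab x = lab y)
    (ls : List ℕ) : I.Clustering where
  k := ls.length
  T i := labelSubgraph hH hadj ls[i]
  part i := I.demands.filter fun d => (lab d.1 : ℕ) = ls[i]

/-- Indicators agree even if the two decidability instances do not. -/
theorem indicator_congr {p q : Prop} {hp : Decidable p} {hq : Decidable q} (h : p ↔ q) :
    (if p then 1 else 0 : ℕ) = if q then 1 else 0 := if_congr h rfl rfl

/-- The output of the program is the encoding of the clustering. -/
theorem encode_clustering (hH : H ≤ I.graph) (hadj : ∀ x y, H.Adj x y → lab x = lab y)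
    (ls : List ℕ) : (clustering hH hadj ls).encode = ls.length :: ls.flatMap
        (block H (fun x y => (x, y) ∈ I.demands) lab) := by
  unfold Clustering.encode
  refine congrArg₂ List.cons rfl (congrArg List.flatten ?_)
  refine List.ext_getElem (by simp [clustering]) fun i hi hi' => ?_
  simp only [clustering, labelSubgraph, List.getElem_ofFn, List.getElem_map, block, matrixList,
    mem_filter]
  refine congrArg₂ (· ++ ·) (congrArg₂ (· ++ ·) ?_ ?_) ?_
  all_goals
    refine congrArg List.ofFn (funext fun x => ?_)
    exact indicator_congr Iff.rfl

theorem isTree_labelSubgraph (hH : H ≤ I.graph) (hac : H.IsAcyclic)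
    (hlab : ∀ x y, lab x = lab y ↔ H.Reachable x y) (x : Fin I.n) :
    (labelSubgraph hH (fun x y h => (hlab x y).2 h.reachable) (lab x)).coe.IsTree := by
  refine ⟨@SimpleGraph.Connected.mk _ _ ?_ ⟨⟨x, rfl⟩⟩, ?_⟩
  · have hreach : ∀ y (hy : (lab y : ℕ) = lab x), (labelSubgraph hH
        (fun x y h => (hlab x y).2 h.reachable) (lab x)).coe.Reachable ⟨x, rfl⟩ ⟨y, hy⟩ := by
      intro y hy
      have h1 := (SimpleGraph.reachable_iff_reflTransGen _ _).1 ((hlab x y).1 (Fin.ext hy.symm))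
      induction h1 with
      | refl => exact SimpleGraph.Reachable.refl _
      | @tail b c hb hbc ih =>
        have hb' : (lab b : ℕ) = lab x := by
          rw [(hlab x b).2 ((SimpleGraph.reachable_iff_reflTransGen _ _).2 hb)]
        exact (ih hb').trans (SimpleGraph.Adj.reachable ⟨hbc, hb'⟩)
    exact fun a b => (hreach a a.2).symm.trans (hreach b b.2)
  · exact hac.comap ⟨Subtype.val, fun h => h.1⟩ Subtype.val_injective

/-- All properties of the clustering that do not depend on how the forest was found. The components
without a demand are dropped, so that no part is empty; this can only decrease the total length. -/
theorem clustering_spec (hH : H ≤ I.graph) (hac : H.IsAcyclic)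
    (hlab : ∀ x y, lab x = lab y ↔ H.Reachable x y)
    (hdem : ∀ d ∈ I.demands, H.Reachable d.1 d.2) {ls : List ℕ}
    (hmem : ∀ v, v ∈ ls ↔ ∃ x y, (x, y) ∈ I.demands ∧ (lab x : ℕ) = v) (hnodup : ls.Nodup)
    (C : I.Clustering) (hC : C = clustering hH (fun x y h => (hlab x y).2 h.reachable) ls) :
    (∀ i, (C.T i).coe.IsTree) ∧
    (∀ i, (C.part i).Nonempty) ∧
    (∀ i j, i ≠ j → Disjoint (C.part i) (C.part j)) ∧
    I.demands = Finset.univ.biUnion C.part ∧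
    (∀ i, ∀ d ∈ C.part i, d.1 ∈ (C.T i).verts ∧ d.2 ∈ (C.T i).verts) ∧
    ∑ i, I.length (C.T i).edgeSet ≤ I.length H.edgeSet ∧
    ∑ i, I.opt (C.part i) ≤ ∑ a, I.opt (I.demands.filter fun d => lab d.1 = a) := by
  subst hC
  simp only [clustering]
  have hinj : ∀ i j : Fin ls.length, ls[i] = ls[j] → i = j := fun i j h =>
    Fin.ext ((hnodup.getElem_inj_iff).1 h)
  refine ⟨fun i => ?_, fun i => ?_, fun i j hij => ?_, ?_, fun i d hd => ?_, ?_, ?_⟩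
  · obtain ⟨x, y, -, hx⟩ := (hmem ls[i]).1 (List.getElem_mem _)
    rw [← hx]
    exact isTree_labelSubgraph hH hac hlab x
  · obtain ⟨x, y, h1, hx⟩ := (hmem ls[i]).1 (List.getElem_mem _)
    exact ⟨(x, y), mem_filter.2 ⟨h1, hx⟩⟩
  · rw [disjoint_left]
    intro d h1 h2
    exact hij (hinj i j ((mem_filter.1 h1).2.symm.trans (mem_filter.1 h2).2))
  · ext d
    simp only [mem_biUnion, mem_filter]
    refine ⟨fun hd => ?_, fun ⟨i, _, h, _⟩ => h⟩
    obtain ⟨i, hi, hv⟩ := List.getElem_of_mem ((hmem (lab d.1)).2 ⟨d.1, d.2, hd, rfl⟩)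
    exact ⟨⟨i, hi⟩, mem_univ _, hd, hv.symm⟩
  · obtain ⟨h1, h2⟩ := mem_filter.1 hd
    exact ⟨h2, (congrArg Fin.val ((hlab d.1 d.2).2 (hdem d h1))).symm.trans h2⟩
  · simp only [length]
    rw [← sum_biUnion]
    · refine sum_le_sum_of_subset fun e he => ?_
      simp only [mem_biUnion, mem_univ, true_and, mem_filter] at he ⊢
      obtain ⟨i, -, he⟩ := he
      induction e with
      | h x y => exact he.1
    · intro i _ j _ hij
      rw [Function.onFun, disjoint_left]
      intro e h1 h2
      simp only [mem_filter, mem_univ, true_and] at h1 h2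
      induction e with
      | h x y => exact hij (hinj i j (h1.2.symm.trans h2.2))
  · have hlt : ∀ i : Fin ls.length, ls[i] < I.n := fun i => by
      obtain ⟨x, y, -, hx⟩ := (hmem ls[i]).1 (List.getElem_mem _)
      rw [← hx]
      exact (lab x).isLt
    have hle := sum_le_sum_of_subset_of_nonneg
      (subset_univ (univ.image fun i : Fin ls.length => (⟨ls[i], hlt i⟩ : Fin I.n)))
      (f := fun a => I.opt (I.demands.filter fun d => lab d.1 = a)) fun a _ _ => I.opt_nonneg _
    rw [sum_image fun i _ j _ h => hinj i j (congrArg Fin.val h)] at hle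
    refine le_of_eq_of_le (sum_congr rfl fun i _ => ?_) hle
    simp only [Fin.ext_iff]

end SteinerInstance

/-! ### The algorithm -/

namespace RAM

open Term Cmd Finset
open SteinerInstance
open scoped Classical

variable {I : SteinerInstance} {ε : ℚ≥0} {σ : Store} {l : List ℕ} {X : ℕ}

/-- The costs become integral after multiplication by a common denominator `D`, and they are at most
`X ^ 2`, as the numerators and the common denominator are at most `X`. -/
theorem readInput_env (hl : l = I.encode ε) (hX : X = boundProd (fun i => l.getD i 0) l.length)
    (h1 : σ.reg 1 = l.length) (h2 : σ.reg 2 = I.n) (h3 : σ.reg 3 = I.n * I.n)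
    (h4 : σ.reg 4 = X ^ 8) (ha : σ.arr = (initial l).arr) :
    ∃ (D : ℕ) (c : Fin I.n → Fin I.n → ℕ), 0 < D ∧
      (∀ x y, I.graph.Adj x y → (c x y : ℚ≥0) = D * I.cost s(x, y)) ∧
      (∀ x y, c x y = c y x) ∧ (∀ x y, c x y ≤ X * X) ∧
      Env I.graph (fun x y => (x, y) ∈ I.demands) c ε.num ε.den l.length (X ^ 8)
        (readInput.den σ) := by
  obtain ⟨f, hf⟩ : ∃ f : ℕ → ℕ, f = fun i => l.getD i 0 := ⟨_, rfl⟩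
  have hX0 : 0 < X := hX ▸ (Nat.two_pow_pos _).trans_le (two_pow_le_boundProd _ _)
  have hXM : ∀ j ≤ 8, X ^ j ≤ X ^ 8 := fun j => Nat.pow_le_pow_right hX0
  have hfX : ∀ i, f i ≤ X := fun i => by rw [hX, hf]; exact getD_le_boundProd l i
  have hDX : posProd f l.length ≤ X := by rw [hX, hf]; exact posProd_le_boundProd _ _
  have h0 : σ.arr 0 = f := by rw [ha, hf]; rfl
  have hlen : l.length = 3 + 4 * (I.n * I.n) := by rw [hl, length_encode]
  have hnum : ∀ x y : Fin I.n, f (3 + I.n * I.n + (x * I.n + y)) =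
      if I.graph.Adj x y then (I.cost s(x, y)).num else 0 := fun x y => by
    rw [add_assoc, hf, hl]
    exact encode_num x y
  have hden : ∀ x y : Fin I.n, f (3 + 2 * (I.n * I.n) + (x * I.n + y)) =
      if I.graph.Adj x y then (I.cost s(x, y)).den else 0 := fun x y => by
    rw [show 3 + 2 * (I.n * I.n) + (x * I.n + y : ℕ) =
      3 + (I.n * I.n + (I.n * I.n + (x * I.n + y))) by ring, hf, hl]
    exact encode_den x y
  obtain ⟨hm1, hm2, hm3⟩ := readInput_spec h1 h3 h4 h0
    (hDX.trans (by simpa using hXM 1 (by norm_num)))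
  obtain ⟨c, hc⟩ : ∃ c : Fin I.n → Fin I.n → ℕ, c = fun x y : Fin I.n =>
    f (3 + I.n * I.n + (x * I.n + y)) * (posProd f l.length / f (3 + 2 * (I.n * I.n) +
      (x * I.n + y))) := ⟨_, rfl⟩
  have hcX : ∀ x y, c x y ≤ X * X := fun x y => by
    rw [hc]
    exact Nat.mul_le_mul (hfX _) ((Nat.div_le_self _ _).trans hDX)
  refine ⟨posProd f l.length, c, posProd_pos _ _, fun x y hxy => ?_, fun x y => ?_, hcX, ?_⟩
  · have hd := hden x y
    rw [if_pos hxy] at hd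
    have hdvd : (I.cost s(x, y)).den ∣ posProd f l.length := by
      rw [← hd]
      refine dvd_posProd f ?_ (by rw [hd]; exact (I.cost s(x, y)).den_ne_zero)
      have := index_lt x y
      omega
    have hne : ((I.cost s(x, y)).den : ℚ≥0) ≠ 0 := Nat.cast_ne_zero.2 (NNRat.den_ne_zero _)
    rw [hc]
    dsimp only
    rw [hd, hnum x y, if_pos hxy, Nat.cast_mul, Nat.cast_div hdvd hne]
    conv_rhs => rw [← NNRat.num_div_den (I.cost s(x, y))]
    field_simp
  · rw [hc]
    simp only [hnum, hden, I.graph.adj_comm x y, Sym2.eq_swap (a := x)]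
  · have hr : ∀ r, 1 ≤ r → r ≤ 4 → (readInput.den σ).reg r = σ.reg r := fun r k1 k2 =>
      den_reg _ _ fun h => by
        have : ∀ r ∈ readInput.regs, 5 ≤ r := by decide
        have := this r h
        omega
    have h0' : (readInput.den σ).arr 0 = f := by rw [den_arr _ _ (by decide), h0]
    refine ⟨(hr 1 (by decide) (by decide)).trans h1, (hr 2 (by decide) (by decide)).trans h2,
      (hr 3 (by decide) (by decide)).trans h3, (hr 4 (by decide) (by decide)).trans h4,
      ⟨?_, ?_⟩, fun x y => ?_, fun x y => ?_, fun x y => ?_⟩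
    · rw [h0', hf, hl]; rfl
    · rw [h0', hf, hl]; rfl
    · rw [hm1 _ (index_lt x y), hf, hl]
      exact (encode_adj x y).trans (indicator_congr Iff.rfl)
    · rw [hm2 _ (index_lt x y), show 3 + 3 * (I.n * I.n) + (x * I.n + y : ℕ) =
        3 + (I.n * I.n + (I.n * I.n + (I.n * I.n + (x * I.n + y)))) by ring, hf, hl]
      exact (encode_dem x y).trans (indicator_congr Iff.rfl)
    · rw [hm3 _ (index_lt x y), hc]
      refine min_eq_left ((by simpa only [hc] using hcX x y : _ ≤ X * X).trans ?_)
      rw [← sq]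
      exact hXM 2 (by norm_num)

/-- The program finds the forest of the second stage and writes its clusters. The numbers in either
stage start with at most `X ^ 5` and get doubled at most as often as the input is long, so they are
at most `2 ^ (l.length + 1) * X ^ 5 ≤ X ^ 8` and no clamping takes place. -/
theorem main_spec (hε : 0 < ε) (hI : I.Feasible) (hl : l = I.encode ε)
    (hX : X = boundProd (fun i => l.getD i 0) l.length)
    (h1 : σ.reg 1 = l.length) (h2 : σ.reg 2 = I.n) (h3 : σ.reg 3 = I.n * I.n)
    (h4 : σ.reg 4 = X ^ 8) (ha : σ.arr = (initial l).arr) :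
    ∃ (H : SimpleGraph (Fin I.n)) (lab : Fin I.n → Fin I.n), H ≤ I.graph ∧ H.IsAcyclic ∧
      (∀ x y, lab x = lab y ↔ H.Reachable x y) ∧ (∀ d ∈ I.demands, H.Reachable d.1 d.2) ∧
      (I.length H.edgeSet : ℝ) ≤ (4 / (ε : ℝ) + 2) * I.opt I.demands ∧
      ∑ a, I.opt (I.demands.filter fun d => lab d.1 = a) ≤ (1 + (ε : ℝ)) * I.opt I.demands ∧
      (main.den σ).output = (labels (fun x y => (x, y) ∈ I.demands) lab I.n).length ::
        (labels (fun x y => (x, y) ∈ I.demands) lab I.n).flatMap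
          (block H (fun x y => (x, y) ∈ I.demands) lab) := by
  obtain ⟨D, c, hD, hc, hsymm, hcX, hE⟩ := readInput_env hl hX h1 h2 h3 h4 ha
  have hlen : l.length = 3 + 4 * (I.n * I.n) := by rw [hl, length_encode]
  have hX2 : 2 ^ l.length ≤ X := hX ▸ two_pow_le_boundProd _ _
  have hX4 : 4 ≤ X := le_trans (by
    rw [hlen, pow_add]
    have := Nat.two_pow_pos (4 * (I.n * I.n))
    omega) hX2
  have hget : ∀ i, l.getD i 0 ≤ X := fun i => hX ▸ getD_le_boundProd l i
  have hnX : I.n ≤ X := by simpa [hl, encode_eq] using hget 0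
  have hpX : ε.num ≤ X := by simpa [hl, encode_eq] using hget 1
  have hqX : ε.den ≤ X := by simpa [hl, encode_eq] using hget 2
  have hpow : ∀ j ≤ 8, X ^ j ≤ X ^ 8 := fun j => Nat.pow_le_pow_right (by omega)
  unfold main
  simp only [den_seq]
  obtain ⟨σ₁, hσ₁⟩ : ∃ τ, τ = readInput.den σ := ⟨_, rfl⟩
  have h4₁ : IsMatrix σ₁ 4 (⊥ : SimpleGraph (Fin I.n)).Adj := fun x y => by
    rw [hσ₁, den_arr _ _ (by decide), ha]
    simp [initial]
  rw [← hσ₁] at hE ⊢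
  obtain ⟨σ₂, hσ₂⟩ : ∃ τ, τ = stage.den σ₁ := ⟨_, rfl⟩
  have hE₂ := hσ₂ ▸ hE.den stage (by decide) (by decide)
  obtain ⟨σ₃, hσ₃⟩ : ∃ τ, τ = stage.den σ₂ := ⟨_, rfl⟩
  have hE₃ := hσ₃ ▸ hE₂.den stage (by decide) (by decide)
  obtain ⟨σ₄, hσ₄⟩ : ∃ τ, τ = components.den σ₃ := ⟨_, rfl⟩
  have hE₄ := hσ₄ ▸ hE₃.den components (by decide) (by decide)
  rw [← hσ₂, ← hσ₃, ← hσ₄]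
  have hout : I.n * (I.n + I.n * I.n + I.n * I.n) + 1 ≤ X ^ 8 := by
    have hnn : I.n * I.n ≤ X * X := Nat.mul_le_mul hnX hnX
    have hXX : X * 4 ≤ X * X := Nat.mul_le_mul_left X hX4
    calc I.n * (I.n + I.n * I.n + I.n * I.n) + 1
        ≤ X * (3 * (X * X)) + X := by
          refine Nat.add_le_add (Nat.mul_le_mul hnX ?_) (by omega)
          omega
      _ ≤ X * (X * (X * X)) := by
          have h5 : 4 * (X * X) ≤ X * (X * X) := Nat.mul_le_mul_right _ hX4
          rw [← Nat.mul_succ]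
          exact Nat.mul_le_mul_left X (by omega)
      _ = X ^ 4 := by ring
      _ ≤ X ^ 8 := hpow 4 (by norm_num)
  have hnM : I.n ≤ X ^ 8 := hnX.trans (by simpa using hpow 1 (by norm_num))
  -- an idle step names a vertex, so the stages are only meaningful if there is one
  rcases Nat.eq_zero_or_pos I.n with hn | hn
  · have hempty : IsEmpty (Fin I.n) := by rw [hn]; infer_instance
    refine ⟨⊥, id, bot_le, by simp, isEmptyElim, fun d => isEmptyElim d.1, ?_, ?_, ?_⟩
    · have h0 : I.length (⊥ : SimpleGraph (Fin I.n)).edgeSet = 0 := by simp [length]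
      have := I.opt_nonneg I.demands
      rw [h0, NNRat.cast_zero]
      positivity
    · have := I.opt_nonneg I.demands
      rw [univ_eq_empty, sum_empty]
      positivity
    · exact writeOutput_spec hE₄.reg2 hE₄.reg3 hE₄.reg4 hE₄.arr2 isEmptyElim isEmptyElim hout hnM
  have hL : 2 * I.n + 1 < l.length := by
    have := Nat.mul_le_mul_left I.n hn
    omega
  have hM0 : 0 < X ^ 8 := pow_pos (by omega) 8
  have hB : 2 ^ (l.length + 1) * X ^ 5 ≤ X ^ 8 := by
    calc 2 ^ (l.length + 1) * X ^ 5 ≤ X ^ 2 * X ^ 5 := by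
          refine Nat.mul_le_mul_right _ ?_
          rw [pow_succ, sq]
          exact Nat.mul_le_mul hX2 (by omega)
      _ = X ^ 7 := by ring
      _ ≤ X ^ 8 := hpow 7 (by norm_num)
  have hslack : ∀ x y, 2 * (ε.num * c x y) ≤ X ^ 5 := fun x y => by
    calc 2 * (ε.num * c x y) ≤ X ^ 2 * (X * (X * X)) :=
          Nat.mul_le_mul (le_trans (by omega) (Nat.le_self_pow two_ne_zero X))
            (Nat.mul_le_mul hpX (hcX x y))
      _ = X ^ 5 := by ring
  have hpot : ∀ F : SimpleGraph (Fin I.n),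
      ∑ z : Fin I.n × Fin I.n with F.Adj z.1 z.2, ε.den * c z.1 z.2 ≤ X ^ 5 := fun F => by
    refine (sum_le_card_nsmul _ _ (X * (X * X)) fun z _ => Nat.mul_le_mul hqX (hcX _ _)).trans ?_
    have hcard := card_le_univ (univ.filter fun z : Fin I.n × Fin I.n => F.Adj z.1 z.2)
    rw [Fintype.card_prod, Fintype.card_fin] at hcard
    calc _ ≤ (X * X) * (X * (X * X)) :=
          Nat.mul_le_mul_right _ (hcard.trans (Nat.mul_le_mul hnX hnX))
      _ = X ^ 5 := by ring
  obtain ⟨H₁, hm₁, hs₁⟩ := stage_spec hn hE h4₁ bot_le hsymm hL (fun x y hd => hI (x, y) hd) hM0 hB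
    hslack (hpot ⊥)
  rw [← hσ₂] at hm₁
  have hH₁ := (hs₁.steiner (NNRat.num_pos.2 hε)).1
  obtain ⟨H₂, hm₂, hs₂⟩ := stage_spec hn hE₂ hm₁ hH₁ hsymm hL (fun x y hd => hI (x, y) hd) hM0 hB
    hslack (hpot H₁)
  rw [← hσ₃] at hm₂
  obtain ⟨lab, hlab, hreach⟩ := components_spec hE₃.reg2 hE₃.reg3 hm₂
  rw [← hσ₄] at hlab
  obtain ⟨k1, k2, k3, k4, k5⟩ := cluster_of_stages hε hI hD hc hL hs₁ hs₂
  refine ⟨H₂, lab, k1, k2, hreach, k3, k4, k5 lab fun x y => (hreach x y).symm,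
    writeOutput_spec hE₄.reg2 hE₄.reg3 hE₄.reg4 hE₄.arr2 (fun x y => ?_) hlab hout hnM⟩
  rw [hσ₄, den_arr _ _ (by decide)]
  exact hm₂ x y

theorem bitSize_output_le {τ : Store} {M B : ℕ} (hM : M < 2 ^ B) (h : τ.Bdd M) :
    bitSize τ.output ≤ τ.output.length * (B + 1) := by
  rw [bitSize]
  refine (List.sum_le_card_nsmul _ (B + 1) fun a ha => ?_).trans_eq (by simp)
  simp only [Store.output, List.map_map, List.mem_map, Function.comp_apply] at ha
  obtain ⟨i, -, rfl⟩ := ha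
  exact Nat.succ_le_succ (Nat.size_le.2 ((h.2 0 i).trans_lt hM))

end RAM

/-- One program clusters every instance, within time polynomial in the bit size of the input. -/
theorem theorem3 :
    ∃ (P : RAM.Prog) (time : Polynomial ℕ),
      ∀ (I : SteinerInstance) (ε : ℚ≥0), 0 < ε → I.Feasible →
        ∃ C : I.Clustering,
          RAM.Computes P (I.encode ε) C.encode (time.eval (RAM.bitSize (I.encode ε))) ∧
          (∀ i, (C.T i).coe.IsTree) ∧
          (∀ i, (C.part i).Nonempty) ∧
          (∀ i j, i ≠ j → Disjoint (C.part i) (C.part j)) ∧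
          I.demands = Finset.univ.biUnion C.part ∧
          (∀ i, ∀ d ∈ C.part i, d.1 ∈ (C.T i).verts ∧ d.2 ∈ (C.T i).verts) ∧
          ∑ i, (I.length (C.T i).edgeSet : ℝ) ≤ (4 / (ε : ℝ) + 2) * I.opt I.demands ∧
          ∑ i, I.opt (C.part i) ≤ (1 + (ε : ℝ)) * I.opt I.demands := by
  classical
  refine ⟨RAM.Prog.seq RAM.prelude RAM.main.compile,
    (40 * Polynomial.X + 120 + RAM.main.time + (1 + 3 * Polynomial.X ^ 2)) *
      (8 * Polynomial.X + 2), fun I ε hε hI => ?_⟩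
  obtain ⟨σ, M, hM, hMB, hbdd, h1, h2, h3, h4, ha, k₁, hk₁, he₁⟩ := RAM.exec_prelude (I.encode ε)
  have h0 : (I.encode ε).getD 0 0 = I.n := by rw [SteinerInstance.encode_eq]; rfl
  rw [h0] at h2 h3
  obtain ⟨H, lab, hH, hac, hlab, hdem, hlen, hopt, hout⟩ :=
    RAM.main_spec hε hI rfl rfl h1 h2 h3 (h4.trans hM) ha
  obtain ⟨b, hb⟩ : ∃ b, b = RAM.bitSize (I.encode ε) := ⟨_, rfl⟩
  rw [← hb] at hk₁ hMB ⊢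
  have hLb : 3 + 4 * (I.n * I.n) ≤ b := by
    rw [hb, ← I.length_encode ε]
    exact RAM.length_le_bitSize _
  have hnn : I.n ≤ I.n * I.n := Nat.le_mul_self I.n
  have hM1 : 1 ≤ M := by
    rw [hM]
    exact Nat.one_le_pow _ _
      ((Nat.two_pow_pos _).trans_le (RAM.two_pow_le_boundProd _ (I.encode ε).length))
  obtain ⟨hbdd', k₂, hk₂, he₂⟩ := RAM.Cmd.exists_exec (s := b) hMB hM1 RAM.main RAM.wf_main σ hbdd
    (fun r hr1 hr2 => by
      obtain rfl | rfl | rfl : r = 1 ∨ r = 2 ∨ r = 3 := by omega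
      · rw [h1, I.length_encode]; exact hLb
      · omega
      · omega)
  obtain ⟨C, hC⟩ : ∃ C, C = SteinerInstance.clustering hH
    (fun x y h => (hlab x y).2 h.reachable)
    (RAM.labels (fun x y => (x, y) ∈ I.demands) lab I.n) := ⟨_, rfl⟩
  have hCe : (RAM.main.den σ).output = C.encode := by
    rw [hout, hC, SteinerInstance.encode_clustering]
  obtain ⟨c1, c2, c3, c4, c5, c6, c7⟩ := SteinerInstance.clustering_spec hH hac hlab hdem
    (fun v => RAM.mem_labels) (RAM.nodup_labels _) C hC
  refine ⟨C, ⟨_, _, he₁.seq he₂, hCe, ?_⟩, c1, c2, c3, c4, c5, le_trans ?_ hlen, c7.trans hopt⟩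
  · have hsize := RAM.bitSize_output_le hMB hbdd'
    have hlength : (RAM.main.den σ).output.length ≤ 1 + 3 * b ^ 2 := by
      rw [hout, List.length_cons, RAM.length_flatMap_block, add_comm]
      refine Nat.add_le_add_left ?_ 1
      calc _ ≤ b * (3 * b) := Nat.mul_le_mul ((RAM.length_labels_le _).trans (by omega)) (by omega)
        _ = 3 * b ^ 2 := by ring
    have h5 := hsize.trans (Nat.mul_le_mul_right _ hlength)
    rw [hCe] at h5
    simp only [Polynomial.eval_mul, Polynomial.eval_add, Polynomial.eval_pow, Polynomial.eval_X,
      Polynomial.eval_ofNat, Polynomial.eval_one]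
    have h6 : 8 * b + 1 + 1 = 8 * b + 2 := rfl
    rw [h6] at hk₂ h5
    rw [add_mul, add_mul _ (RAM.main.time.eval b)]
    omega
  · exact_mod_cast c6
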